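/- Let $K\ge 0$ and consider a network with terminals $T_0,\dots,T_{K+1}$: a source terminal $T_0$, relays $T_1,\dots,T_K$ and a destination $T_{K+1}$. A discrete memoryless channel $p(y_1,\dots,y_{K+1}\mid x_0,\dots,x_K)$ with finite alphabets $\mathcal X_0,\dots,\mathcal X_K,\mathcal Y_1,\dots,\mathcal Y_{K+1}$ is given, where $x_i$ and $y_i$ are the channel input and output of $T_i$. Let $(S_{0,j},\dots,S_{K+1,j})_{j\ge1}$ be i.i.d. copies of a tuple $(S_0,\dots,S_{K+1})$ with an arbitrary joint distribution on a finite alphabet $\mathcal S_0\times\dots\times\mathcal S_{K+1}$; $T_0$ observes the source $S_0$, and $T_i$, $1\le i\le K+1$, observes the side information $S_i$. An $(m,n)$ code consists of an encoder $X_0^n=f_0(S_0^m)$, relay functions $X_{i,t}=f_{i,t}(Y_{i,1},\dots,Y_{i,t-1},S_i^m)$ for $1\le i\le K$, $1\le t\le n$, and a decoder $\hat S_0^m=g(Y_{K+1}^n,S_{K+1}^m)\in\mathcal S_0^m$; its error probability is $P_e^{(m,n)}=\Pr\{\hat S_0^m\ne S_0^m\}$, averaged over the sources and the channel. A rate $r\ge0$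 is achievable if there is a sequence of $(m,n)$ codes with $m,n\to\infty$, $m/n\ge r$ and $P_e^{(m,n)}\to0$. The source-channel capacity is the supremum in $[0,\infty]$ of all achievable rates (with value $0$ if there are none). Suppose that the network is physically degraded, i.e. for every distribution $p(x_0,\dots,x_K)$ of the inputs and every $i=1,\dots,K$, $$(X_0,\dots,X_{i-1})\to(Y_i,X_i,\dots,X_K)\to(Y_{i+1},\dots,Y_{K+1})$$ is a Markov chain, and that $S_0\to S_1\to\cdots\to S_{K+1}$ is a Markov chain. Then the source-channel capacity equals $$\sup_{p(x_0,\dots,x_K)}\ \min_{i=1,\dots,K+1}\ \frac{I(X_0,\dots,X_{i-1};\,Y_i\mid X_i,\dots,X_K)}{H(S_0\mid S_i)},$$ where the supremum is over all joint distributions of the channel inputs (for $i=K+1$ there is no conditioning), the information measures use a common base of the logarithm, and a quotient with $H(S_0\mid S_i)=0$ is read as $+\infty$. -/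

import Mathlib

open Filter Topology
open scoped ENNReal NNReal

namespace RelayNetwork

noncomputable section

/-! ### Finite-alphabet probability and information measures

Random variables are functions on a sample space carrying a probability mass function. -/

/-- `Pr{f = a}` under `μ`. -/
def prob {Ω A : Type*} (μ : PMF Ω) (f : Ω → A) (a : A) : ℝ :=
  ((μ.map f) a).toReal

/-- `A → B → C` is a Markov chain: `A` and `C` are conditionally independent given `B`. -/
def IsMarkov {Ω A B C : Type*} (μ : PMF Ω) (f : Ω → A) (g : Ω → B) (h : Ω → C) : Prop :=
  ∀ a b c, prob μ (fun ω => (f ω, g ω, h ω)) (a, b, c) * prob μ g b =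
    prob μ (fun ω => (f ω, g ω)) (a, b) * prob μ (fun ω => (g ω, h ω)) (b, c)

/-- Conditional entropy `H(A|B) = -∑ p(a,b) log p(a|b)`, in nats. -/
def condEntropy {Ω A B : Type*} [Fintype A] [Fintype B] (μ : PMF Ω)
    (f : Ω → A) (g : Ω → B) : ℝ :=
  -∑ a, ∑ b, prob μ (fun ω => (f ω, g ω)) (a, b) *
    Real.log (prob μ (fun ω => (f ω, g ω)) (a, b) / prob μ g b)

/-- Conditional mutual information `I(A;B|C) = H(A|C) - H(A|B,C)`, in nats. -/
def condMutualInfo {Ω A B C : Type*} [Fintype A] [Fintype B] [Fintype C] (μ : PMF Ω)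
    (f : Ω → A) (g : Ω → B) (h : Ω → C) : ℝ :=
  condEntropy μ f h - condEntropy μ f (fun ω => (g ω, h ω))

/-! ### The relay network

There are `K + 2` terminals `T_0, …, T_{K+1}`.
* `X j`, `j : Fin (K+1)`, is the input alphabet of terminal `T_j` (`j = 0, …, K`);
* `Y j`, `j : Fin (K+1)`, is the output alphabet of terminal `T_{j+1}`;
* `S i`, `i : Fin (K+2)`, is the alphabet of the source (`i = 0`) or of the side information
  of terminal `T_i`.

So the terminal with channel output `Y j` has side information `S j.succ`, and its own channel
input, if it is a relay, is the one with index `j + 1`. -/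

/-- An `(m,n)` joint source-channel code. The `i`-th relay function belongs to the terminal
`T_{i+1}`; at time `t` it uses only the outputs received strictly before `t`. -/
structure Code {K : ℕ} (X Y : Fin (K + 1) → Type*) (S : Fin (K + 2) → Type*) (m n : ℕ) where
  enc : (Fin m → S 0) → Fin n → X 0
  relay : ∀ (i : Fin K) (t : Fin n),
    (Fin t → Y i.castSucc) → (Fin m → S i.castSucc.succ) → X i.succ
  dec : (Fin n → Y (Fin.last K)) → (Fin m → S (Fin.last K).succ) → (Fin m → S 0)

namespace Code

variable {K : ℕ} {X Y : Fin (K + 1) → Type*} {S : Fin (K + 2) → Type*} {m n : ℕ}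

/-- The channel inputs `(x_{0,t}, …, x_{K,t})` produced by the code at time `t`, when the
source and side information samples are `s` and the channel outputs are `y`. -/
def input (c : Code X Y S m n) (s : Fin m → ∀ i, S i) (y : Fin n → ∀ j, Y j) (t : Fin n) :
    ∀ j, X j :=
  Fin.cases (motive := X) (c.enc (fun k => s k 0) t)
    (fun i => c.relay i t (fun u => y (Fin.castLE t.isLt.le u) i.castSucc)
      (fun k => s k i.castSucc.succ))

open scoped Classical in
/-- Probability of error: the samples `s` are i.i.d. with law `q`, and given the past the
outputs at time `t` are drawn from the memoryless channel `W` with the current inputs. -/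
def errorProb [∀ j, Fintype (Y j)] [∀ i, Fintype (S i)] (c : Code X Y S m n)
    (W : (∀ j, X j) → PMF (∀ j, Y j)) (q : PMF (∀ i, S i)) : ℝ :=
  ∑ s : Fin m → ∀ i, S i, ∑ y : Fin n → ∀ j, Y j,
    if c.dec (fun t => y t (Fin.last K)) (fun k => s k (Fin.last K).succ) ≠ fun k => s k 0 then
      (∏ k, (q (s k)).toReal) * ∏ t, (W (c.input s y t) (y t)).toReal
    else 0

end Code

section Network

variable {K : ℕ} {X Y : Fin (K + 1) → Type*} {S : Fin (K + 2) → Type*}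

/-- The source-channel code rate `r` (source samples per channel use) is achievable. -/
def Achievable [∀ j, Fintype (Y j)] [∀ i, Fintype (S i)]
    (W : (∀ j, X j) → PMF (∀ j, Y j)) (q : PMF (∀ i, S i)) (r : ℝ≥0) : Prop :=
  ∃ (m n : ℕ → ℕ) (c : ∀ k, Code X Y S (m k) (n k)),
    (∀ k, 0 < n k ∧ (r : ℝ) ≤ (m k : ℝ) / (n k : ℝ)) ∧
    Tendsto m atTop atTop ∧ Tendsto n atTop atTop ∧
    Tendsto (fun k => (c k).errorProb W q) atTop (𝓝 0)

/-- The supremum of the achievable rates, in `[0, ∞]`; it is `0` if no rate is achievable. -/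
def sourceChannelCapacity [∀ j, Fintype (Y j)] [∀ i, Fintype (S i)]
    (W : (∀ j, X j) → PMF (∀ j, Y j)) (q : PMF (∀ i, S i)) : ℝ≥0∞ :=
  ⨆ (r : ℝ≥0) (_ : Achievable W q r), (r : ℝ≥0∞)

/-- The joint law of the channel inputs and outputs for the input distribution `p`. -/
def jointLaw (W : (∀ j, X j) → PMF (∀ j, Y j)) (p : PMF (∀ j, X j)) :
    PMF ((∀ j, X j) × (∀ j, Y j)) :=
  p.bind fun x => (W x).map (Prod.mk x)

/-- Entries `0, …, j` of a tuple. -/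
def upTo {N : ℕ} {Z : Fin N → Type*} (j : Fin N) (z : ∀ k, Z k) : ∀ k : {k // k ≤ j}, Z k :=
  fun k => z k

/-- Entries `0, …, j - 1` of a tuple. -/
def before {N : ℕ} {Z : Fin N → Type*} (j : Fin N) (z : ∀ k, Z k) : ∀ k : {k // k < j}, Z k :=
  fun k => z k

/-- Entries `j + 1, j + 2, …` of a tuple. -/
def after {N : ℕ} {Z : Fin N → Type*} (j : Fin N) (z : ∀ k, Z k) : ∀ k : {k // j < k}, Z k :=
  fun k => z k

/-- Physical degradedness: for every input distribution and every relay `T_{i+1}`, `i < K`,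
`(X_0, …, X_i) → (Y_{i+1}, X_{i+1}, …, X_K) → (Y_{i+2}, …, Y_{K+1})` is a Markov chain
(terminal numbering; the output of `T_{i+1}` has index `i` in the family `Y`). -/
def PhysicallyDegraded (W : (∀ j, X j) → PMF (∀ j, Y j)) : Prop :=
  ∀ (p : PMF (∀ j, X j)) (i : Fin K),
    IsMarkov (jointLaw W p)
      (fun ω => upTo i.castSucc ω.1)
      (fun ω => (ω.2 i.castSucc, after i.castSucc ω.1))
      (fun ω => after i.castSucc ω.2)

/-- `S_0 → S_1 → ⋯ → S_{K+1}` is a Markov chain: for every `i`, past and future are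
conditionally independent given `S_i`. -/
def DegradedSideInfo (q : PMF (∀ i, S i)) : Prop :=
  ∀ i : Fin (K + 2), IsMarkov q (fun s => before i s) (fun s => s i) (fun s => after i s)

/-- `I(X_0, …, X_j; Y | X_{j+1}, …, X_K)` where `Y` is the output of terminal `T_{j+1}`. -/
def cutInfo [∀ j, Fintype (X j)] [∀ j, Fintype (Y j)]
    (W : (∀ j, X j) → PMF (∀ j, Y j)) (p : PMF (∀ j, X j)) (j : Fin (K + 1)) : ℝ :=
  condMutualInfo (jointLaw W p)
    (fun ω => upTo j ω.1) (fun ω => ω.2 j) (fun ω => after j ω.1)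

/-- The quotient `a / h`, read as `∞` if `h = 0` (even if `a = 0`): a terminal that already
knows the source puts no constraint on the rate. -/
def ratio (a h : ℝ) : ℝ≥0∞ :=
  open scoped Classical in if h = 0 then ⊤ else ENNReal.ofReal (a / h)

end Network

end

end RelayNetwork

set_option linter.unusedSectionVars false

namespace RelayNetwork

noncomputable section

open scoped Classical

/-! ### Finite sums of probabilities -/

section Probability

variable {Ω A B C : Type*}

/-! Converse. Fix a code and let `p` be its input law averaged over time; this one law serves all
cuts. For the cut `j` compare the true law with an auxiliary one in which the output `Y j` is
generated from `X_{j+1}, …, X_K` alone, with the conditional law computed from `p` (`cutKernel`).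
The log-likelihood ratio of the two is a sum of information densities with mean `n * cutInfo W p j`.
By physical degradedness the later outputs depend on the inputs only through `Y j` and `X_{j+1}, …,
X_K` (`PhysicallyDegraded.exists_factor`). In the auxiliary system the terminals from `T_{j+1}` on
therefore learn nothing about the source beyond their side information, which by the Markov chain is
no better than `S_{j+1}` (`Code.sum_cutKernel_correct_le`). Averaging `1 + x ≤ exp x`, with `x` the
difference between the source information recovered and the information density, gives `m H ≤ n I +
1 + O(m P_e)` (`Code.exists_input_bound`), a substitute for Fano's inequality and the chain rule.

Achievability. Dependent inputs are written as functions of independent letters of levels `0, …, K`,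
where level `a` settles the input `X_{K-a}` given those settled before (`sum_prodWeight_inputOf`,
`avgFrom_letterWeight_mul`). The code is block Markov: in block `c` level `a` carries the source
block with index `c + a`, so that `T_l` needs the source blocks up to index `c + K - l` only. The
source block `e` is thus sent in the blocks `e - K, …, e`, each time at a lower level, and `T_{j+1}`
decodes it from the first `j + 1` of them, knowing all earlier source blocks. The levels involved
are `K - j, …, K`, and by the chain rule their informations add up to `cutInfo`
(`sum_letterExp_log_levelDensity`).

A source block is sent unbinned. The decoding metric is its conditional probability given the side
information times the likelihood ratios of its letters, compared with a threshold. A wrong block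
passes rarely because the metric of an independent competitor has small mean; the true one fails
rarely because a negative moment of its metric is small (`sum_bookWeight_metricFails_le`). Random
coding and a union bound give one codebook good for all terminals and blocks. `exists_code_of_tests`
turns it into a code: as long as all tests succeed, the true system behaves as if every terminal
knew the messages. -/

lemma prob_nonneg (μ : PMF Ω) (f : Ω → A) (a : A) : 0 ≤ prob μ f a := ENNReal.toReal_nonneg

variable [Fintype Ω]

lemma sum_toReal_pmf (μ : PMF Ω) : ∑ ω, (μ ω).toReal = 1 := by
  rw [← ENNReal.toReal_sum (fun ω _ => μ.apply_ne_top ω), ← tsum_fintype (L := .unconditional _),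
    μ.tsum_coe, ENNReal.toReal_one]

lemma prob_eq_sum (μ : PMF Ω) (f : Ω → A) (a : A) :
    prob μ f a = ∑ ω, if f ω = a then (μ ω).toReal else 0 := by
  rw [prob, PMF.map_apply, tsum_fintype, ENNReal.toReal_sum]
  · refine Finset.sum_congr rfl fun ω _ => ?_
    by_cases h : f ω = a
    · simp [h]
    · simp [h, Ne.symm h]
  · intro ω _
    split_ifs
    · exact μ.apply_ne_top ω
    · exact ENNReal.zero_ne_top

lemma toReal_le_prob (μ : PMF Ω) (f : Ω → A) (ω : Ω) : (μ ω).toReal ≤ prob μ f (f ω) := by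
  rw [prob_eq_sum]
  refine le_trans ?_ (Finset.single_le_sum (f := fun ω' => if f ω' = f ω then (μ ω').toReal else 0)
    (fun i _ => ?_) (Finset.mem_univ ω))
  · simp
  · split_ifs <;> simp

lemma prob_pos (μ : PMF Ω) (f : Ω → A) {ω : Ω} (h : 0 < (μ ω).toReal) : 0 < prob μ f (f ω) :=
  h.trans_le (toReal_le_prob μ f ω)

lemma prob_le_prob_comp (μ : PMF Ω) (f : Ω → A) (g : A → B) (a : A) :
    prob μ f a ≤ prob μ (fun ω => g (f ω)) (g a) := by
  rw [prob_eq_sum, prob_eq_sum]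
  refine Finset.sum_le_sum fun ω _ => ?_
  by_cases h : f ω = a
  · simp [h]
  · simp only [h, if_false]
    split_ifs <;> simp

lemma sum_prob_comp [Fintype A] (μ : PMF Ω) (f : Ω → A) (g : A → B) (b : B) :
    ∑ a, (if g a = b then prob μ f a else 0) = prob μ (fun ω => g (f ω)) b := by
  simp only [prob_eq_sum]
  simp_rw [← Finset.sum_filter]
  rw [Finset.sum_comm' (t' := Finset.univ.filter fun ω => g (f ω) = b) (s' := fun ω => {f ω})]
  · simp
  · intro a ω
    simp only [Finset.mem_filter, Finset.mem_univ, true_and, Finset.mem_singleton]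
    constructor
    · rintro ⟨h1, rfl⟩; exact ⟨rfl, h1⟩
    · rintro ⟨rfl, h2⟩; exact ⟨h2, rfl⟩

lemma sum_prob_mul [Fintype A] (μ : PMF Ω) (f : Ω → A) (F : A → ℝ) :
    ∑ a, prob μ f a * F a = ∑ ω, (μ ω).toReal * F (f ω) := by
  simp only [prob_eq_sum, Finset.sum_mul, ite_mul, zero_mul]
  rw [Finset.sum_comm]
  simp

lemma condEntropy_eq_sum [Fintype A] [Fintype B] (μ : PMF Ω) (f : Ω → A) (g : Ω → B) :
    condEntropy μ f g = -∑ ω, (μ ω).toReal *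
      Real.log (prob μ (fun ω => (f ω, g ω)) (f ω, g ω) / prob μ g (g ω)) := by
  rw [condEntropy, ← sum_prob_mul μ (fun ω => (f ω, g ω)) (fun ab =>
    Real.log (prob μ (fun ω => (f ω, g ω)) ab / prob μ g ab.2)), Fintype.sum_prod_type]

lemma condEntropy_nonneg [Fintype A] [Fintype B] (μ : PMF Ω) (f : Ω → A) (g : Ω → B) :
    0 ≤ condEntropy μ f g := by
  rw [condEntropy_eq_sum, neg_nonneg]
  refine Finset.sum_nonpos fun ω _ => mul_nonpos_of_nonneg_of_nonpos ENNReal.toReal_nonneg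
    (Real.log_nonpos (div_nonneg (prob_nonneg _ _ _) (prob_nonneg _ _ _))
      (div_le_one_of_le₀ ?_ (prob_nonneg _ _ _)))
  exact prob_le_prob_comp μ (fun ω => (f ω, g ω)) Prod.snd (f ω, g ω)

end Probability

/-! ### Products of causal kernels -/

section Causal

variable {𝒳 𝒴 𝒵 𝒱 : Type*}

/-- The value `x y t` depends only on the entries of `y` before time `t`. -/
def Causal {n : ℕ} (x : (Fin n → 𝒴) → Fin n → 𝒳) : Prop :=
  ∀ t y y', (∀ u < t, y u = y' u) → x y t = x y' t

lemma Causal.cons {n : ℕ} {x : (Fin (n + 1) → 𝒴) → Fin (n + 1) → 𝒳} (hx : Causal x) (b : 𝒴) :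
    Causal fun (y : Fin n → 𝒴) t => x (Fin.cons b y) t.succ := by
  intro t y y' h
  refine hx _ _ _ fun u hu => ?_
  induction u using Fin.cases with
  | zero => rfl
  | succ u => simpa using h u (by simpa using hu)

lemma Causal.zero {n : ℕ} {x : (Fin (n + 1) → 𝒴) → Fin (n + 1) → 𝒳} (hx : Causal x)
    (y y' : Fin (n + 1) → 𝒴) : x y 0 = x y' 0 :=
  hx _ _ _ fun u hu => absurd hu (Fin.not_lt_zero u)

lemma sum_cons [Fintype 𝒴] {n : ℕ} (F : (Fin (n + 1) → 𝒴) → ℝ) :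
    ∑ y, F y = ∑ b, ∑ y : Fin n → 𝒴, F (Fin.cons b y) := by
  rw [← Fintype.sum_prod_type', ← (Fin.consEquiv fun _ : Fin (n + 1) => 𝒴).sum_comp]
  rfl

/-- A causal system observed through a projection is again causal if the projected kernel depends
only on the projected input. Induction peels off the first time step. Inequalities suffice
throughout, which admits the defective kernels produced by divisions by zero. With trivial inputs
the lemma applies to the memoryless source as well. -/
lemma sum_causal_proj_le [Fintype 𝒴] [Fintype 𝒵] (Q : 𝒳 → 𝒴 → ℝ) (U : 𝒱 → 𝒵 → ℝ)
    (ρ : 𝒳 → 𝒱) (π : 𝒴 → 𝒵) (hQ : ∀ x y, 0 ≤ Q x y) (hU : ∀ v z, 0 ≤ U v z)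
    (hQU : ∀ x z, ∑ y, (if π y = z then Q x y else 0) ≤ U (ρ x) z) {n : ℕ}
    (x : (Fin n → 𝒴) → Fin n → 𝒳) (v : (Fin n → 𝒵) → Fin n → 𝒱) (hx : Causal x) (hv : Causal v)
    (hxv : ∀ y t, ρ (x y t) = v (fun u => π (y u)) t) (F : (Fin n → 𝒵) → ℝ) (hF : ∀ z, 0 ≤ F z) :
    ∑ y, F (fun u => π (y u)) * ∏ t, Q (x y t) (y t) ≤ ∑ z, F z * ∏ t, U (v z t) (z t) := by
  induction n with
  | zero =>
    simp only [Finset.univ_unique, Finset.sum_singleton, Finset.univ_eq_empty, Finset.prod_empty]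
    rw [Subsingleton.elim (fun u => π ((default : Fin 0 → 𝒴) u)) default]
  | succ n ih =>
    rw [sum_cons, sum_cons]
    rcases isEmpty_or_nonempty 𝒴 with h𝒴 | ⟨⟨y₀⟩⟩
    · simp only [Finset.univ_eq_empty, Finset.sum_empty]
      exact Finset.sum_nonneg fun _ _ => Finset.sum_nonneg fun _ _ =>
        mul_nonneg (hF _) (Finset.prod_nonneg fun _ _ => hU _ _)
    set x₀ := x (fun _ => y₀) 0 with hx₀
    set G : 𝒵 → ℝ := fun b => ∑ z : Fin n → 𝒵, F (Fin.cons b z) *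
      ∏ t : Fin n, U (v (Fin.cons b z) t.succ) (z t) with hG
    have hcomp : ∀ (b : 𝒴) (y : Fin n → 𝒴), (fun u => π ((Fin.cons b y : Fin (n + 1) → 𝒴) u)) =
        Fin.cons (π b) (fun u => π (y u)) := by
      intro b y
      funext u
      induction u using Fin.cases <;> simp
    have key : ∀ b, ∑ y : Fin n → 𝒴, F (fun u => π ((Fin.cons b y : Fin (n + 1) → 𝒴) u)) *
        ∏ t, Q (x (Fin.cons b y) t) ((Fin.cons b y : Fin (n + 1) → 𝒴) t) ≤
        Q x₀ b * G (π b) := by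
      intro b
      have h := ih (fun y t => x (Fin.cons b y) t.succ) (fun z t => v (Fin.cons (π b) z) t.succ)
        (hx.cons b) (hv.cons (π b)) (fun y t => by rw [hxv, hcomp]) (fun z => F (Fin.cons (π b) z))
        (fun _ => hF _)
      refine le_trans (le_of_eq ?_) (mul_le_mul_of_nonneg_left h (hQ x₀ b))
      rw [Finset.mul_sum]
      refine Finset.sum_congr rfl fun y _ => ?_
      rw [Fin.prod_univ_succ, hcomp, hx.zero (Fin.cons b y) (fun _ => y₀)]
      simp only [Fin.cons_zero, Fin.cons_succ, ← hx₀]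
      ring
    have hG0 : ∀ b, 0 ≤ G b := fun b => Finset.sum_nonneg fun _ _ =>
        mul_nonneg (hF _) (Finset.prod_nonneg fun _ _ => hU _ _)
    calc _ ≤ ∑ b, Q x₀ b * G (π b) := Finset.sum_le_sum fun b _ => key b
      _ = ∑ c, (∑ b, if π b = c then Q x₀ b else 0) * G c := by
        simp only [Finset.sum_mul, ite_mul, zero_mul]
        rw [Finset.sum_comm]
        simp
      _ ≤ ∑ c, U (ρ x₀) c * G c :=
        Finset.sum_le_sum fun c _ => mul_le_mul_of_nonneg_right (hQU x₀ c) (hG0 c)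
      _ = _ := by
        refine Finset.sum_congr rfl fun c _ => ?_
        rw [hG, Finset.mul_sum]
        refine Finset.sum_congr rfl fun z _ => ?_
        rw [Fin.prod_univ_succ, hx₀, hxv, hv.zero _ (Fin.cons c z)]
        simp only [Fin.cons_zero, Fin.cons_succ]
        ring

lemma sum_causal_le_one [Fintype 𝒴] (Q : 𝒳 → 𝒴 → ℝ) (hQ : ∀ x y, 0 ≤ Q x y)
    (hQ1 : ∀ x, ∑ y, Q x y ≤ 1) {n : ℕ} (x : (Fin n → 𝒴) → Fin n → 𝒳) (hx : Causal x) :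
    ∑ y, ∏ t, Q (x y t) (y t) ≤ 1 := by
  have h := sum_causal_proj_le Q (fun (_ : Unit) (_ : Unit) => (1 : ℝ)) (fun _ => ()) (fun _ => ())
    hQ (fun _ _ => zero_le_one) (fun x _ => by simpa using hQ1 x) x (fun _ _ => ()) hx
    (fun _ _ _ _ => rfl) (fun _ _ => rfl) (fun _ => 1) (fun _ => zero_le_one)
  simpa using h

lemma sum_causal_eq_one [Fintype 𝒴] [Nonempty 𝒴] (Q : 𝒳 → 𝒴 → ℝ) (hQ1 : ∀ x, ∑ y, Q x y = 1) {n : ℕ}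
    (x : (Fin n → 𝒴) → Fin n → 𝒳) (hx : Causal x) : ∑ y, ∏ t, Q (x y t) (y t) = 1 := by
  induction n with
  | zero => simp
  | succ n ih =>
    rw [sum_cons]
    obtain ⟨y₀⟩ := ‹Nonempty 𝒴›
    rw [← hQ1 (x (fun _ => y₀) 0)]
    refine Finset.sum_congr rfl fun b _ => ?_
    have h := ih (fun y t => x (Fin.cons b y) t.succ) (hx.cons b)
    rw [← mul_one (Q _ b), ← h, Finset.mul_sum]
    refine Finset.sum_congr rfl fun y _ => ?_
    rw [Fin.prod_univ_succ, hx.zero _ (fun _ => y₀)]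
    simp

/-- The kernels after `t₀` sum out to one and, given the past, the output at `t₀` has law `Q (x y
t₀)`. This makes the information densities of a code single-letter. -/
lemma sum_causal_expect [Fintype 𝒴] (Q : 𝒳 → 𝒴 → ℝ) (hQ1 : ∀ x, ∑ y, Q x y = 1) {n : ℕ}
    (x : (Fin n → 𝒴) → Fin n → 𝒳) (hx : Causal x) (h : 𝒳 → 𝒴 → ℝ) (t₀ : Fin n) :
    ∑ y, (∏ t, Q (x y t) (y t)) * h (x y t₀) (y t₀) =
      ∑ y, (∏ t, Q (x y t) (y t)) * ∑ b, Q (x y t₀) b * h (x y t₀) b := by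
  induction n with
  | zero => exact t₀.elim0
  | succ n ih =>
    rcases isEmpty_or_nonempty 𝒴 with h𝒴 | h𝒴
    · simp
    obtain ⟨y₀⟩ := id h𝒴
    have split : ∀ (b : 𝒴) (y : Fin n → 𝒴), ∏ t, Q (x (Fin.cons b y) t)
        ((Fin.cons b y : Fin (n + 1) → 𝒴) t) = Q (x (fun _ => y₀) 0) b *
          ∏ t : Fin n, Q (x (Fin.cons b y) t.succ) (y t) := by
      intro b y
      rw [Fin.prod_univ_succ, hx.zero _ (fun _ => y₀)]
      simp
    simp only [sum_cons (n := n), split]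
    induction t₀ using Fin.cases with
    | zero =>
      have hz : ∀ (b : 𝒴) (y : Fin n → 𝒴), x (Fin.cons b y) 0 = x (fun _ => y₀) 0 :=
        fun b y => hx.zero _ _
      simp only [hz, Fin.cons_zero, ← Finset.sum_mul, ← Finset.mul_sum,
        fun b => sum_causal_eq_one Q hQ1 _ (hx.cons b), mul_one, hQ1, one_mul]
    | succ t₀ =>
      refine Finset.sum_congr rfl fun b _ => ?_
      simp only [mul_assoc, ← Finset.mul_sum, Fin.cons_succ]
      rw [ih (fun y t => x (Fin.cons b y) t.succ) (hx.cons b) t₀]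

end Causal

/-! ### Single-letter formulas for the network -/

section SingleLetter

variable {K : ℕ} {X Y : Fin (K + 1) → Type*} {S : Fin (K + 2) → Type*}

lemma eq_of_upTo_of_after {N : ℕ} {Z : Fin N → Type*} {j : Fin N} {z z' : ∀ k, Z k}
    (h₁ : upTo j z = upTo j z') (h₂ : after j z = after j z') : z = z' := by
  funext k
  rcases le_or_gt k j with h | h
  · exact congrFun h₁ ⟨k, h⟩
  · exact congrFun h₂ ⟨k, h⟩

/-- Entries `j, j + 1, …` of a tuple. -/
def tailFrom {N : ℕ} {Z : Fin N → Type*} (j : Fin N) (z : ∀ k, Z k) :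
    Z j × (∀ k : {k // j < k}, Z k) :=
  (z j, after j z)

lemma eq_of_tailFrom_eq {N : ℕ} {Z : Fin N → Type*} {j : Fin N} {z z' : ∀ k, Z k}
    (h : tailFrom j z = tailFrom j z') {k : Fin N} (hk : j ≤ k) : z k = z' k := by
  simp only [tailFrom, Prod.mk.injEq] at h
  rcases hk.eq_or_lt with rfl | hk
  · exact h.1
  · exact congrFun h.2 ⟨k, hk⟩

lemma after_surjective {N : ℕ} {Z : Fin N → Type*} (j : Fin N) (z₀ : ∀ k, Z k) :
    Function.Surjective (after j : (∀ k, Z k) → _) := by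
  intro w
  refine ⟨fun k => if h : j < k then w ⟨k, h⟩ else z₀ k, ?_⟩
  funext k
  simp [after, k.2]

lemma tailFrom_surjective {N : ℕ} {Z : Fin N → Type*} (j : Fin N) (z₀ : ∀ k, Z k) :
    Function.Surjective (tailFrom j : (∀ k, Z k) → _) := by
  rintro ⟨b, w⟩
  refine ⟨fun k => if h : j < k then w ⟨k, h⟩ else Function.update z₀ j b k, ?_⟩
  refine Prod.ext ?_ ?_
  · simp [tailFrom]
  · funext k
    simp [tailFrom, after, k.2]

/-- The probability that terminal `T_{j+1}` receives `b` when the inputs are `x`. -/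
def outProb (W : (∀ j, X j) → PMF (∀ j, Y j)) (j : Fin (K + 1)) (x : ∀ j, X j) (b : Y j) : ℝ :=
  prob (W x) (fun y => y j) b

lemma outProb_nonneg (W : (∀ j, X j) → PMF (∀ j, Y j)) (j : Fin (K + 1)) (x : ∀ j, X j)
    (b : Y j) : 0 ≤ outProb W j x b := prob_nonneg _ _ _

variable [∀ j, Fintype (X j)] [∀ j, Fintype (Y j)] [∀ i, Fintype (S i)]

lemma sum_outProb_mul (W : (∀ j, X j) → PMF (∀ j, Y j)) (j : Fin (K + 1)) (x : ∀ j, X j)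
    (F : Y j → ℝ) : ∑ b, outProb W j x b * F b = ∑ y, (W x y).toReal * F (y j) :=
  sum_prob_mul _ _ _

lemma sum_outProb (W : (∀ j, X j) → PMF (∀ j, Y j)) (j : Fin (K + 1)) (x : ∀ j, X j) :
    ∑ b, outProb W j x b = 1 := by
  simpa [sum_toReal_pmf] using sum_outProb_mul W j x (fun _ => 1)

lemma jointLaw_apply (W : (∀ j, X j) → PMF (∀ j, Y j)) (p : PMF (∀ j, X j)) (x : ∀ j, X j)
    (y : ∀ j, Y j) : (jointLaw W p (x, y)).toReal = (p x).toReal * (W x y).toReal := by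
  rw [jointLaw, PMF.bind_apply, tsum_fintype, Finset.sum_eq_single x]
  · rw [ENNReal.toReal_mul, PMF.map_apply, tsum_fintype, Finset.sum_eq_single y]
    · simp
    · intro y' _ h
      rw [if_neg]
      simpa using Ne.symm h
    · simp
  · intro x' _ h
    rw [mul_eq_zero]
    right
    rw [PMF.map_apply, tsum_fintype]
    refine Finset.sum_eq_zero fun y' _ => if_neg ?_
    simp [Ne.symm h]
  · simp

lemma prob_jointLaw {A : Type*} (W : (∀ j, X j) → PMF (∀ j, Y j)) (p : PMF (∀ j, X j))
    (f : (∀ j, X j) × (∀ j, Y j) → A) (a : A) : prob (jointLaw W p) f a =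
      ∑ x, (p x).toReal * prob (W x) (fun y => f (x, y)) a := by
  simp only [prob_eq_sum, Fintype.sum_prod_type, jointLaw_apply, Finset.mul_sum, mul_ite, mul_zero]

lemma prob_const_pair {Ω A B : Type*} [Fintype Ω] (μ : PMF Ω) (g : Ω → B) (a a' : A) (b : B) :
    prob μ (fun ω => (a, g ω)) (a', b) = if a = a' then prob μ g b else 0 := by
  simp only [prob_eq_sum, Prod.mk.injEq]
  split_ifs with h <;> simp [h]

lemma prob_pair_const {Ω A B : Type*} [Fintype Ω] (μ : PMF Ω) (g : Ω → B) (a a' : A) (b : B) :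
    prob μ (fun ω => (g ω, a)) (b, a') = if a = a' then prob μ g b else 0 := by
  simp only [prob_eq_sum, Prod.mk.injEq]
  split_ifs with h <;> simp [h]

/-- The probability that the inputs of the terminals after `T_j` agree with those in `x`. -/
def tailProb (p : PMF (∀ j, X j)) (j : Fin (K + 1)) (x : ∀ j, X j) : ℝ :=
  ∑ x', if after j x' = after j x then (p x').toReal else 0

/-- The conditional probability that `T_{j+1}` receives `b` given the inputs of the terminals
after `T_j`. -/
def condOut (W : (∀ j, X j) → PMF (∀ j, Y j)) (p : PMF (∀ j, X j)) (j : Fin (K + 1))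
    (x : ∀ j, X j) (b : Y j) : ℝ :=
  (∑ x', if after j x' = after j x then (p x').toReal * outProb W j x' b else 0) / tailProb p j x

lemma tailProb_nonneg (p : PMF (∀ j, X j)) (j : Fin (K + 1)) (x : ∀ j, X j) :
    0 ≤ tailProb p j x :=
  Finset.sum_nonneg fun _ _ => by split_ifs <;> simp

lemma le_tailProb (p : PMF (∀ j, X j)) (j : Fin (K + 1)) (x : ∀ j, X j) :
    (p x).toReal ≤ tailProb p j x := by
  have h := toReal_le_prob p (after j) x
  rw [prob_eq_sum] at h
  rw [tailProb]
  convert h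

lemma condOut_nonneg (W : (∀ j, X j) → PMF (∀ j, Y j)) (p : PMF (∀ j, X j)) (j : Fin (K + 1))
    (x : ∀ j, X j) (b : Y j) : 0 ≤ condOut W p j x b := by
  refine div_nonneg (Finset.sum_nonneg fun _ _ => ?_) (tailProb_nonneg p j x)
  split_ifs
  · exact mul_nonneg ENNReal.toReal_nonneg (outProb_nonneg _ _ _ _)
  · exact le_rfl

lemma condOut_congr (W : (∀ j, X j) → PMF (∀ j, Y j)) (p : PMF (∀ j, X j)) (j : Fin (K + 1))
    {x x' : ∀ j, X j} (h : after j x = after j x') : condOut W p j x = condOut W p j x' := by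
  funext b
  simp only [condOut, tailProb, h]

lemma condOut_pos (W : (∀ j, X j) → PMF (∀ j, Y j)) (p : PMF (∀ j, X j)) (j : Fin (K + 1))
    {x : ∀ j, X j} {b : Y j} (hp : 0 < (p x).toReal) (hb : 0 < outProb W j x b) :
    0 < condOut W p j x b := by
  refine div_pos ?_ (hp.trans_le (le_tailProb p j x))
  refine (mul_pos hp hb).trans_le ?_
  refine le_trans ?_ (Finset.single_le_sum (f := fun x' => if after j x' = after j x then
    (p x').toReal * outProb W j x' b else 0) (fun i _ => ?_) (Finset.mem_univ x))
  · simp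
  · split_ifs
    · exact mul_nonneg ENNReal.toReal_nonneg (outProb_nonneg _ _ _ _)
    · exact le_rfl

lemma sum_condOut_le (W : (∀ j, X j) → PMF (∀ j, Y j)) (p : PMF (∀ j, X j)) (j : Fin (K + 1))
    (x : ∀ j, X j) : ∑ b, condOut W p j x b ≤ 1 := by
  simp only [condOut, ← Finset.sum_div]
  refine div_le_one_of_le₀ (le_of_eq ?_) (tailProb_nonneg p j x)
  rw [Finset.sum_comm, tailProb]
  refine Finset.sum_congr rfl fun x' _ => ?_
  split_ifs
  · rw [← Finset.mul_sum, sum_outProb, mul_one]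
  · simp

lemma toReal_le_outProb (W : (∀ j, X j) → PMF (∀ j, Y j)) (j : Fin (K + 1)) (x : ∀ j, X j)
    (y : ∀ j, Y j) : (W x y).toReal ≤ outProb W j x (y j) :=
  toReal_le_prob (W x) (fun y => y j) y

/-- The entries up to `j` and those after `j` determine the whole input, so the sums for the full
joint probabilities collapse to one term; the factors `p x` and `tailProb` then cancel in the ratio.
-/
lemma cutInfo_eq_sum (W : (∀ j, X j) → PMF (∀ j, Y j)) (p : PMF (∀ j, X j)) (j : Fin (K + 1)) :
    cutInfo W p j = ∑ x, ∑ y, (p x).toReal * (W x y).toReal *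
      Real.log (outProb W j x (y j) / condOut W p j x (y j)) := by
  rw [cutInfo, condMutualInfo, condEntropy_eq_sum, condEntropy_eq_sum, neg_sub_neg,
    ← Finset.sum_sub_distrib, Fintype.sum_prod_type]
  refine Finset.sum_congr rfl fun x _ => Finset.sum_congr rfl fun y _ => ?_
  rw [jointLaw_apply, ← mul_sub]
  rcases eq_or_lt_of_le (ENNReal.toReal_nonneg (a := p x)) with hp | hp
  · simp [← hp]
  rcases eq_or_lt_of_le (ENNReal.toReal_nonneg (a := W x y)) with hw | hw
  · simp [← hw]
  have ho : 0 < outProb W j x (y j) := hw.trans_le (toReal_le_outProb W j x y)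
  have hc := condOut_pos W p j hp ho
  have ht : 0 < tailProb p j x := hp.trans_le (le_tailProb p j x)
  have e1 : prob (jointLaw W p) (fun ω => (upTo j ω.1, ω.2 j, after j ω.1))
      (upTo j x, y j, after j x) = (p x).toReal * outProb W j x (y j) := by
    rw [prob_jointLaw, Finset.sum_eq_single x]
    · simp only [prob_const_pair, prob_pair_const, if_true]; rfl
    · intro x' _ hx'
      simp only [prob_const_pair, prob_pair_const]
      split_ifs with h1 h2
      · exact absurd (eq_of_upTo_of_after h1 h2) hx'
      all_goals simp
    · simp
  have e2 : prob (jointLaw W p) (fun ω => (ω.2 j, after j ω.1)) (y j, after j x) =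
      condOut W p j x (y j) * tailProb p j x := by
    rw [prob_jointLaw, condOut, div_mul_cancel₀ _ ht.ne']
    simp only [prob_pair_const, mul_ite, mul_zero]
    rfl
  have one : ∀ x', ∑ y, (W x' y).toReal = 1 := fun x' => sum_toReal_pmf (W x')
  have e3 : prob (jointLaw W p) (fun ω => (upTo j ω.1, after j ω.1)) (upTo j x, after j x) =
      (p x).toReal := by
    rw [prob_jointLaw, Finset.sum_eq_single x]
    · simp [prob_eq_sum, one]
    · intro x' _ hx'
      rw [mul_eq_zero, prob_eq_sum]
      refine Or.inr (Finset.sum_eq_zero fun y _ => if_neg fun h => hx' ?_)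
      simp only [Prod.mk.injEq] at h
      exact eq_of_upTo_of_after h.1 h.2
    · simp
  have e4 : prob (jointLaw W p) (fun ω => after j ω.1) (after j x) = tailProb p j x := by
    rw [prob_jointLaw, tailProb]
    refine Finset.sum_congr rfl fun x' _ => ?_
    simp only [prob_eq_sum]
    split_ifs <;> simp [one]
  simp only
  rw [e1, e2, e3, e4, ← Real.log_div (by positivity) (by positivity)]
  congr 2
  field_simp

/-- Under physical degradedness the outputs after `Y_j` depend on the inputs only through `Y_j`
and the inputs after `X_j`. -/
lemma PhysicallyDegraded.exists_factor {W : (∀ j, X j) → PMF (∀ j, Y j)}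
    (hW : PhysicallyDegraded W) (j : Fin (K + 1)) :
    ∃ R : (∀ k : {k // j < k}, X k) → Y j → (∀ k : {k // j < k}, Y k) → ℝ,
      (∀ v b z, 0 ≤ R v b z) ∧ (∀ v b, ∑ z, R v b z ≤ 1) ∧
      ∀ x b z, prob (W x) (fun y => (y j, after j y)) (b, z) =
        outProb W j x b * R (after j x) b z := by
  rcases isEmpty_or_nonempty (∀ j, X j) with hX | hX
  · exact ⟨fun _ _ _ => 0, fun _ _ _ => le_rfl, fun _ _ => by simp, fun x => hX.elim x⟩
  induction j using Fin.lastCases with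
  | last =>
    have : IsEmpty {k // Fin.last K < k} := ⟨fun k => (Fin.le_last k.1).not_gt k.2⟩
    refine ⟨fun _ _ _ => 1, fun _ _ _ => zero_le_one, fun _ _ => by simp, fun x b z => ?_⟩
    rw [mul_one, outProb, prob_eq_sum, prob_eq_sum]
    refine Finset.sum_congr rfl fun y _ => ?_
    simp [Subsingleton.elim (after (Fin.last K) y) z]
  | cast i =>
    -- A fully supported input law turns the Markov property into an identity for every single `x`;
    -- any such law would do.
    set p := PMF.uniformOfFintype (∀ j, X j) with hp
    have hp0 : ∀ x, 0 < (p x).toReal := fun x => by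
      rw [hp, PMF.uniformOfFintype_apply, ENNReal.toReal_inv, ENNReal.toReal_natCast]
      exact inv_pos.2 (Nat.cast_pos.2 Fintype.card_pos)
    set μ := jointLaw W p
    set g : (∀ j, X j) × (∀ j, Y j) → Y i.castSucc × _ :=
      fun ω => (ω.2 i.castSucc, after i.castSucc ω.1) with hg
    set h : (∀ j, X j) × (∀ j, Y j) → _ := fun ω => after i.castSucc ω.2 with hh
    refine ⟨fun v b z => prob μ (fun ω => (g ω, h ω)) ((b, v), z) / prob μ g (b, v),
      fun _ _ _ => div_nonneg (prob_nonneg _ _ _) (prob_nonneg _ _ _), fun v b => ?_,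
      fun x b z => ?_⟩
    · rw [← Finset.sum_div]
      refine div_le_one_of_le₀ (le_of_eq ?_) (prob_nonneg _ _ _)
      rw [← sum_prob_comp μ (fun ω => (g ω, h ω)) Prod.fst (b, v), Fintype.sum_prod_type,
        Finset.sum_eq_single (b, v)]
      · simp
      · intro c _ hc
        simp [hc]
      · simp
    · have hM := hW p i (upTo i.castSucc x) (b, after i.castSucc x) z
      have e1 : prob μ (fun ω => (upTo i.castSucc ω.1, g ω, h ω))
          (upTo i.castSucc x, (b, after i.castSucc x), z) = (p x).toReal *
            prob (W x) (fun y => (y i.castSucc, after i.castSucc y)) (b, z) := by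
        rw [prob_jointLaw, Finset.sum_eq_single x]
        · congr 1
          rw [prob_eq_sum, prob_eq_sum]
          simp [hg, hh, Prod.ext_iff]
        · intro x' _ hx'
          rw [mul_eq_zero]
          right
          rw [prob_eq_sum]
          refine Finset.sum_eq_zero fun y _ => if_neg fun h => hx' ?_
          simp only [Prod.mk.injEq, hg] at h
          exact eq_of_upTo_of_after h.1 h.2.1.2
        · simp
      have e2 : prob μ (fun ω => (upTo i.castSucc ω.1, g ω))
          (upTo i.castSucc x, (b, after i.castSucc x)) =
            (p x).toReal * outProb W i.castSucc x b := by
        rw [prob_jointLaw, Finset.sum_eq_single x]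
        · simp only [prob_const_pair, prob_pair_const, if_true, hg]; rfl
        · intro x' _ hx'
          simp only [prob_const_pair, prob_pair_const, hg]
          split_ifs with h1 h2
          · exact absurd (eq_of_upTo_of_after h1 h2) hx'
          all_goals simp
        · simp
      have e3 : (p x).toReal * outProb W i.castSucc x b ≤ prob μ g (b, after i.castSucc x) := by
        rw [← e2]
        exact prob_le_prob_comp μ (fun ω => (upTo i.castSucc ω.1, g ω)) Prod.snd _
      change prob μ (fun ω => (upTo i.castSucc ω.1, g ω, h ω))
          (upTo i.castSucc x, (b, after i.castSucc x), z) * prob μ g (b, after i.castSucc x) =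
        prob μ (fun ω => (upTo i.castSucc ω.1, g ω))
          (upTo i.castSucc x, (b, after i.castSucc x)) *
        prob μ (fun ω => (g ω, h ω)) ((b, after i.castSucc x), z) at hM
      rw [e1, e2, mul_assoc, mul_assoc, mul_right_inj' (hp0 x).ne'] at hM
      rcases eq_or_lt_of_le (prob_nonneg μ g (b, after i.castSucc x)) with h0 | h0
      · rw [← h0] at e3
        have ho : outProb W i.castSucc x b = 0 :=
          le_antisymm (by nlinarith [hp0 x]) (outProb_nonneg _ _ _ _)
        rw [ho, zero_mul]
        refine le_antisymm ?_ (prob_nonneg _ _ _)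
        rw [← ho]
        exact prob_le_prob_comp (W x) (fun y => (y i.castSucc, after i.castSucc y)) Prod.fst _
      · simp only
        rw [mul_div_assoc', eq_div_iff h0.ne', hM]

/-- The conditional probability of the source letter given the side information of `T_{j+1}`. -/
def condSource (q : PMF (∀ i, S i)) (j : Fin (K + 1)) (a : S 0) (b : S j.succ) : ℝ :=
  prob q (fun s => (s 0, s j.succ)) (a, b) / prob q (fun s => s j.succ) b

lemma condSource_nonneg (q : PMF (∀ i, S i)) (j : Fin (K + 1)) (a : S 0) (b : S j.succ) :
    0 ≤ condSource q j a b := div_nonneg (prob_nonneg _ _ _) (prob_nonneg _ _ _)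

lemma condSource_le_one (q : PMF (∀ i, S i)) (j : Fin (K + 1)) (a : S 0) (b : S j.succ) :
    condSource q j a b ≤ 1 :=
  div_le_one_of_le₀ (prob_le_prob_comp q (fun s => (s 0, s j.succ)) Prod.snd (a, b))
    (prob_nonneg _ _ _)

lemma condSource_pos (q : PMF (∀ i, S i)) (j : Fin (K + 1)) {s : ∀ i, S i}
    (hs : 0 < (q s).toReal) : 0 < condSource q j (s 0) (s j.succ) :=
  div_pos (prob_pos q (fun s => (s 0, s j.succ)) hs) (prob_pos q (fun s => s j.succ) hs)

lemma sum_condSource_le (q : PMF (∀ i, S i)) (j : Fin (K + 1)) (b : S j.succ) :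
    ∑ a, condSource q j a b ≤ 1 := by
  simp only [condSource, ← Finset.sum_div]
  refine div_le_one_of_le₀ (le_of_eq ?_) (prob_nonneg _ _ _)
  rw [← sum_prob_comp q (fun s => (s 0, s j.succ)) Prod.snd b, Fintype.sum_prod_type]
  simp

lemma condEntropy_source (q : PMF (∀ i, S i)) (j : Fin (K + 1)) :
    condEntropy q (fun s => s 0) (fun s => s j.succ) =
      ∑ s, (q s).toReal * -Real.log (condSource q j (s 0) (s j.succ)) := by
  rw [condEntropy_eq_sum, ← Finset.sum_neg_distrib]
  simp only [condSource, mul_neg]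

/-- Given `S_{j+1}` the source is independent of the later side information, so dividing by its
conditional probability leaves the law of the tail. Equality can fail only where `condSource` is
zero. -/
lemma DegradedSideInfo.sum_div_condSource_le {q : PMF (∀ i, S i)} (hq : DegradedSideInfo q)
    (j : Fin (K + 1)) (a : S 0) (b : S j.succ × (∀ k : {k // j.succ < k}, S k)) :
    ∑ s, (if (s 0, tailFrom j.succ s) = (a, b) then
      (q s).toReal / condSource q j (s 0) (s j.succ) else 0) ≤ prob q (tailFrom j.succ) b := by
  obtain ⟨b, c⟩ := b
  -- The hypothesis concerns the entire past of `S_{j+1}`; summing over its other entries leaves the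
  -- statement for `S_0`.
  have hM : prob q (fun s => (s 0, s j.succ, after j.succ s)) (a, b, c) *
      prob q (fun s => s j.succ) b = prob q (fun s => (s 0, s j.succ)) (a, b) *
        prob q (fun s => (s j.succ, after j.succ s)) (b, c) := by
    have h0 : (0 : Fin (K + 2)) < j.succ := Fin.succ_pos j
    have e1 := sum_prob_comp q (fun s => (before j.succ s, s j.succ, after j.succ s))
      (fun z => (z.1 ⟨0, h0⟩, z.2)) (a, b, c)
    have e2 := sum_prob_comp q (fun s => (before j.succ s, s j.succ))
      (fun z => (z.1 ⟨0, h0⟩, z.2)) (a, b)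
    change _ = prob q (fun s => (s 0, s j.succ, after j.succ s)) (a, b, c) at e1
    change _ = prob q (fun s => (s 0, s j.succ)) (a, b) at e2
    rw [← e1, ← e2, Fintype.sum_prod_type, Fintype.sum_prod_type, Finset.sum_mul, Finset.sum_mul]
    refine Finset.sum_congr rfl fun z _ => ?_
    rw [Finset.sum_eq_single (b, c), Finset.sum_eq_single b]
    · by_cases hz : z ⟨0, h0⟩ = a
      · simpa [hz] using hq j.succ z b c
      · simp [hz]
    · intro b' _ hb'; simp [hb']
    · simp
    · intro b' _ hb'; simp [hb']
    · simp
  have e : ∑ s, (if (s 0, tailFrom j.succ s) = (a, (b, c)) then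
      (q s).toReal / condSource q j (s 0) (s j.succ) else 0) =
      prob q (fun s => (s 0, s j.succ, after j.succ s)) (a, b, c) / condSource q j a b := by
    rw [prob_eq_sum, Finset.sum_div]
    refine Finset.sum_congr rfl fun s _ => ?_
    by_cases h : (s 0, tailFrom j.succ s) = (a, (b, c))
    · rw [if_pos h]
      simp only [Prod.mk.injEq, tailFrom] at h
      rw [if_pos (by simp [h]), h.1, h.2.1]
    · rw [if_neg h, if_neg (by simpa [tailFrom] using h), zero_div]
  rw [e]
  rcases eq_or_lt_of_le (condSource_nonneg q j a b) with h0 | h0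
  · rw [← h0, div_zero]; exact prob_nonneg _ _ _
  · rw [div_le_iff₀ h0]
    have hb : prob q (fun s => s j.succ) b ≠ 0 := fun hb => by simp [condSource, hb] at h0
    refine le_of_eq ?_
    rw [condSource, mul_div_assoc', eq_div_iff hb, hM, mul_comm]
    rfl

end SingleLetter

/-! ### The converse -/

section Converse

variable {K : ℕ} {X Y : Fin (K + 1) → Type*} {S : Fin (K + 2) → Type*} {m n : ℕ}

lemma Code.input_succ (c : Code X Y S m n) (s : Fin m → ∀ i, S i) (y : Fin n → ∀ j, Y j)
    (t : Fin n) (i : Fin K) : c.input s y t i.succ =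
      c.relay i t (fun u => y (Fin.castLE t.isLt.le u) i.castSucc)
        (fun k => s k i.castSucc.succ) := rfl

lemma Code.causal_input (c : Code X Y S m n) (s : Fin m → ∀ i, S i) :
    Causal fun y t => c.input s y t := by
  intro t y y' h
  funext j
  induction j using Fin.cases with
  | zero => rfl
  | succ i =>
    simp only [Code.input_succ]
    congr 1
    funext u
    rw [h _ (by rw [Fin.lt_def]; exact u.2)]

/-- The relay with input index `k > j` reads only the output `k - 1 ≥ j` and the side information `k
≥ j + 1`. Hence the terminals after `T_j` form a closed system once the output `Y j` is decoupled
from the inputs up to `j`. -/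
lemma Code.after_input_congr (c : Code X Y S m n) (j : Fin (K + 1)) {s s' : Fin m → ∀ i, S i}
    (hs : ∀ k, tailFrom j.succ (s k) = tailFrom j.succ (s' k)) {y y' : Fin n → ∀ j, Y j}
    {t : Fin n} (hy : ∀ u < t, tailFrom j (y u) = tailFrom j (y' u)) :
    after j (c.input s y t) = after j (c.input s' y' t) := by
  funext ⟨k, hk⟩
  change c.input s y t k = c.input s' y' t k
  induction k using Fin.cases with
  | zero => exact absurd hk (Fin.not_lt_zero j)
  | succ i =>
    have hji : j ≤ i.castSucc := by
      rw [Fin.lt_def] at hk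
      rw [Fin.le_def]
      simp only [Fin.val_succ, Fin.val_castSucc] at hk ⊢
      omega
    simp only [Code.input_succ]
    congr 1
    · funext u
      exact eq_of_tailFrom_eq (hy _ (by rw [Fin.lt_def]; exact u.2)) hji
    · funext k
      exact eq_of_tailFrom_eq (hs k) (Fin.succ_le_succ_iff.2 hji)

lemma Code.nonempty_input (c : Code X Y S m n) (hn : 0 < n) (s : ∀ i, S i) :
    Nonempty (∀ j, X j) :=
  ⟨fun j => Fin.cases (motive := X) (c.enc (fun _ => s 0) ⟨0, hn⟩)
    (fun i => c.relay i ⟨0, hn⟩ (fun u => absurd u.2 (Nat.not_lt_zero _))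
      (fun _ => s i.castSucc.succ)) j⟩

lemma exists_of_pmf {Ω : Type*} (μ : PMF Ω) : Nonempty Ω :=
  let ⟨ω, _⟩ := μ.support_nonempty; ⟨ω⟩

/-- The joint probability of the source samples `s` and the channel outputs `y`. -/
def Code.law (c : Code X Y S m n) (W : (∀ j, X j) → PMF (∀ j, Y j)) (q : PMF (∀ i, S i))
    (s : Fin m → ∀ i, S i) (y : Fin n → ∀ j, Y j) : ℝ :=
  (∏ k, (q (s k)).toReal) * ∏ t, (W (c.input s y t) (y t)).toReal

lemma Code.law_nonneg (c : Code X Y S m n) (W : (∀ j, X j) → PMF (∀ j, Y j))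
    (q : PMF (∀ i, S i)) (s : Fin m → ∀ i, S i) (y : Fin n → ∀ j, Y j) : 0 ≤ c.law W q s y :=
  mul_nonneg (Finset.prod_nonneg fun _ _ => ENNReal.toReal_nonneg)
    (Finset.prod_nonneg fun _ _ => ENNReal.toReal_nonneg)

/-- The decoder recovers the source samples. -/
def Code.Correct (c : Code X Y S m n) (s : Fin m → ∀ i, S i) (y : Fin n → ∀ j, Y j) : Prop :=
  c.dec (fun t => y t (Fin.last K)) (fun k => s k (Fin.last K).succ) = fun k => s k 0

variable [∀ j, Fintype (X j)] [∀ j, Fintype (Y j)] [∀ i, Fintype (S i)]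

lemma Code.errorProb_eq_sum (c : Code X Y S m n) (W : (∀ j, X j) → PMF (∀ j, Y j))
    (q : PMF (∀ i, S i)) :
    c.errorProb W q = ∑ s, ∑ y, if c.Correct s y then 0 else c.law W q s y := by
  rw [Code.errorProb]
  refine Finset.sum_congr rfl fun s _ => Finset.sum_congr rfl fun y _ => ?_
  by_cases h : c.Correct s y
  · rw [if_pos h]
    exact if_neg (not_not_intro h)
  · rw [if_neg h]
    exact if_pos h

lemma sum_prod_pmf {A : Type*} [Fintype A] (q : PMF A) (m : ℕ) :
    ∑ s : Fin m → A, ∏ k, (q (s k)).toReal = 1 := by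
  rw [← Fintype.prod_sum (fun (_ : Fin m) a => (q a).toReal)]
  simp [sum_toReal_pmf]

lemma sum_prod_pmf_mul {A : Type*} [Fintype A] (q : PMF A) (m : ℕ) (f : A → ℝ) (k₀ : Fin m) :
    ∑ s : Fin m → A, (∏ k, (q (s k)).toReal) * f (s k₀) = ∑ a, (q a).toReal * f a := by
  have h := Fintype.prod_sum (fun (k : Fin m) a => (q a).toReal * if k = k₀ then f a else 1)
  have e : ∀ s : Fin m → A, ∏ k, ((q (s k)).toReal * if k = k₀ then f (s k) else 1) =
      (∏ k, (q (s k)).toReal) * f (s k₀) := fun s => by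
    rw [Finset.prod_mul_distrib, Finset.prod_ite_eq' Finset.univ k₀ (fun k => f (s k))]
    simp
  simp only [e] at h
  rw [← h, ← Finset.mul_prod_erase _ _ (Finset.mem_univ k₀)]
  simp only [if_true]
  rw [Finset.prod_eq_one, mul_one]
  intro k hk
  simp [Finset.ne_of_mem_erase hk, sum_toReal_pmf]

lemma Code.sum_law [Nonempty (∀ j, Y j)] (c : Code X Y S m n) (W : (∀ j, X j) → PMF (∀ j, Y j))
    (q : PMF (∀ i, S i)) : ∑ s, ∑ y, c.law W q s y = 1 := by
  rw [← sum_prod_pmf q m]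
  refine Finset.sum_congr rfl fun s _ => ?_
  simp only [Code.law]
  rw [← Finset.mul_sum, sum_causal_eq_one (fun x y => (W x y).toReal)
    (fun x => sum_toReal_pmf (W x)) _ (c.causal_input s), mul_one]

/-- The input distribution of a code, averaged over time. -/
def Code.avgWeight (c : Code X Y S m n) (W : (∀ j, X j) → PMF (∀ j, Y j)) (q : PMF (∀ i, S i))
    (x : ∀ j, X j) : ℝ :=
  (∑ t, ∑ s, ∑ y, if c.input s y t = x then c.law W q s y else 0) / n

lemma Code.avgWeight_nonneg (c : Code X Y S m n) (W : (∀ j, X j) → PMF (∀ j, Y j))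
    (q : PMF (∀ i, S i)) (x : ∀ j, X j) : 0 ≤ c.avgWeight W q x := by
  refine div_nonneg (Finset.sum_nonneg fun _ _ => Finset.sum_nonneg fun _ _ =>
    Finset.sum_nonneg fun _ _ => ?_) (Nat.cast_nonneg n)
  split_ifs
  · exact c.law_nonneg W q _ _
  · exact le_rfl

lemma Code.sum_avgWeight_mul (c : Code X Y S m n) (W : (∀ j, X j) → PMF (∀ j, Y j))
    (q : PMF (∀ i, S i)) (hn : 0 < n) (F : (∀ j, X j) → ℝ) :
    n * ∑ x, c.avgWeight W q x * F x =
      ∑ t, ∑ s, ∑ y, c.law W q s y * F (c.input s y t) := by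
  have hn' : (n : ℝ) ≠ 0 := by positivity
  simp only [Code.avgWeight, div_mul_eq_mul_div, ← Finset.sum_div, mul_div_cancel₀ _ hn']
  simp only [Finset.sum_mul, ite_mul, zero_mul]
  rw [Finset.sum_comm]
  refine Finset.sum_congr rfl fun t _ => ?_
  rw [Finset.sum_comm]
  refine Finset.sum_congr rfl fun s _ => ?_
  rw [Finset.sum_comm]
  simp

lemma Code.sum_avgWeight [Nonempty (∀ j, Y j)] (c : Code X Y S m n)
    (W : (∀ j, X j) → PMF (∀ j, Y j)) (q : PMF (∀ i, S i)) (hn : 0 < n) :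
    ∑ x, c.avgWeight W q x = 1 := by
  have h := c.sum_avgWeight_mul W q hn (fun _ => 1)
  have hn' : (n : ℝ) ≠ 0 := by positivity
  simp only [mul_one, c.sum_law W q, Finset.sum_const, Finset.card_univ, Fintype.card_fin,
    nsmul_eq_mul] at h
  exact mul_left_cancel₀ hn' (by rw [h, mul_one])

/-- Every input that occurs with positive probability has positive weight in the averaged law, so
the likelihood ratios in the converse are positive wherever they are used. -/
lemma Code.le_avgWeight (c : Code X Y S m n) (W : (∀ j, X j) → PMF (∀ j, Y j))
    (q : PMF (∀ i, S i)) (hn : 0 < n) (s : Fin m → ∀ i, S i) (y : Fin n → ∀ j, Y j) (t : Fin n) :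
    c.law W q s y ≤ n * c.avgWeight W q (c.input s y t) := by
  have hn' : (n : ℝ) ≠ 0 := by positivity
  have h0 : ∀ t' s' y', 0 ≤ if c.input s' y' t' = c.input s y t then c.law W q s' y' else 0 := by
    intro t' s' y'
    split_ifs
    · exact c.law_nonneg W q _ _
    · exact le_rfl
  rw [Code.avgWeight, mul_div_cancel₀ _ hn']
  calc c.law W q s y = if c.input s y t = c.input s y t then c.law W q s y else 0 := by simp
    _ ≤ ∑ y', if c.input s y' t = c.input s y t then c.law W q s y' else 0 :=
      Finset.single_le_sum (f := fun y' => if c.input s y' t = c.input s y t then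
        c.law W q s y' else 0) (fun y' _ => h0 t s y') (Finset.mem_univ y)
    _ ≤ ∑ s', ∑ y', if c.input s' y' t = c.input s y t then c.law W q s' y' else 0 :=
      Finset.single_le_sum (f := fun s' => ∑ y', if c.input s' y' t = c.input s y t then
        c.law W q s' y' else 0) (fun s' _ => Finset.sum_nonneg fun y' _ => h0 t s' y')
        (Finset.mem_univ s)
    _ ≤ _ := Finset.single_le_sum (f := fun t' => ∑ s', ∑ y', if c.input s' y' t' = c.input s y t
        then c.law W q s' y' else 0) (fun t' _ => Finset.sum_nonneg fun s' _ =>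
        Finset.sum_nonneg fun y' _ => h0 t' s' y') (Finset.mem_univ t)

lemma exists_pmf_of_weight {A : Type*} [Fintype A] (w : A → ℝ) (h0 : ∀ a, 0 ≤ w a)
    (h1 : ∑ a, w a = 1) : ∃ p : PMF A, ∀ a, (p a).toReal = w a := by
  refine ⟨PMF.ofFintype (fun a => ENNReal.ofReal (w a)) ?_, fun a => ?_⟩
  · rw [← ENNReal.ofReal_sum_of_nonneg fun a _ => h0 a, h1, ENNReal.ofReal_one]
  · rw [PMF.ofFintype_apply, ENNReal.toReal_ofReal (h0 a)]

/-- The channel in which the output `Y_j` is generated from the inputs after `X_j` only. -/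
def cutKernel (W : (∀ j, X j) → PMF (∀ j, Y j)) (p : PMF (∀ j, X j)) (j : Fin (K + 1))
    (x : ∀ j, X j) (y : ∀ j, Y j) : ℝ :=
  (W x y).toReal * (condOut W p j x (y j) / outProb W j x (y j))

lemma cutKernel_nonneg (W : (∀ j, X j) → PMF (∀ j, Y j)) (p : PMF (∀ j, X j)) (j : Fin (K + 1))
    (x : ∀ j, X j) (y : ∀ j, Y j) : 0 ≤ cutKernel W p j x y :=
  mul_nonneg ENNReal.toReal_nonneg
    (div_nonneg (condOut_nonneg _ _ _ _ _) (outProb_nonneg _ _ _ _))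

lemma sum_cutKernel_le (W : (∀ j, X j) → PMF (∀ j, Y j)) (p : PMF (∀ j, X j)) (j : Fin (K + 1))
    (x : ∀ j, X j) : ∑ y, cutKernel W p j x y ≤ 1 := by
  refine le_trans (le_of_eq (sum_outProb_mul W j x
    (fun b => condOut W p j x b / outProb W j x b)).symm) (le_trans ?_ (sum_condOut_le W p j x))
  refine Finset.sum_le_sum fun b _ => ?_
  rcases eq_or_ne (outProb W j x b) 0 with h | h
  · rw [h, zero_mul]; exact condOut_nonneg _ _ _ _ _
  · rw [mul_div_cancel₀ _ h]

/-- When the output `Y_j` is generated from the inputs after `X_j` only, a decoder does not beat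
guessing the source from the side information. -/
lemma Code.sum_cutKernel_correct_le (c : Code X Y S m n) {W : (∀ j, X j) → PMF (∀ j, Y j)}
    {q : PMF (∀ i, S i)} (hW : PhysicallyDegraded W) (hq : DegradedSideInfo q)
    (p : PMF (∀ j, X j)) (j : Fin (K + 1)) :
    ∑ s : Fin m → ∀ i, S i, ∑ y, (∏ k, (q (s k)).toReal / condSource q j (s k 0) (s k j.succ)) *
      ((if c.Correct s y then 1 else 0) * ∏ t, cutKernel W p j (c.input s y t) (y t)) ≤ 1 := by
  obtain ⟨R, hR0, hR1, hR⟩ := hW.exists_factor j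
  obtain ⟨x₀⟩ := exists_of_pmf p
  obtain ⟨y₀⟩ := exists_of_pmf (W x₀)
  obtain ⟨s₀⟩ := exists_of_pmf q
  -- Sections of the projections to tails: code and kernels are defined on full tuples, but only the
  -- tail matters below, so any completion of it may be inserted.
  obtain ⟨lx, hlx⟩ := (after_surjective j x₀).hasRightInverse
  obtain ⟨ly, hly⟩ := (tailFrom_surjective j y₀).hasRightInverse
  obtain ⟨ls, hls⟩ := (tailFrom_surjective j.succ s₀).hasRightInverse
  set U : (∀ k : {k // j < k}, X k) → Y j × (∀ k : {k // j < k}, Y k) → ℝ :=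
    fun v z => condOut W p j (lx v) z.1 * R v z.1 z.2 with hU
  have hU0 : ∀ v z, 0 ≤ U v z := fun v z => mul_nonneg (condOut_nonneg _ _ _ _ _) (hR0 _ _ _)
  have hU1 : ∀ v, ∑ z, U v z ≤ 1 := by
    intro v
    rw [Fintype.sum_prod_type]
    refine le_trans (Finset.sum_le_sum fun b _ => ?_) (sum_condOut_le W p j (lx v))
    simp only [hU]
    rw [← Finset.mul_sum]
    exact mul_le_of_le_one_right (condOut_nonneg _ _ _ _ _) (hR1 v b)
  have hQU : ∀ x z, ∑ y, (if tailFrom j y = z then cutKernel W p j x y else 0) ≤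
      U (after j x) z := by
    rintro x ⟨b, z⟩
    have e : ∑ y, (if tailFrom j y = (b, z) then cutKernel W p j x y else 0) =
        prob (W x) (fun y => (y j, after j y)) (b, z) *
          (condOut W p j x b / outProb W j x b) := by
      rw [prob_eq_sum, Finset.sum_mul]
      refine Finset.sum_congr rfl fun y _ => ?_
      by_cases h : tailFrom j y = (b, z)
      · rw [if_pos h]
        simp only [tailFrom] at h
        rw [if_pos h]
        simp only [Prod.mk.injEq] at h
        rw [cutKernel, h.1]
      · rw [if_neg h, if_neg (by simpa [tailFrom] using h), zero_mul]
    rw [e, hR, hU]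
    simp only
    rw [condOut_congr W p j (hlx (after j x))]
    rcases eq_or_ne (outProb W j x b) 0 with h | h
    · rw [h, zero_mul, zero_mul]
      exact mul_nonneg (condOut_nonneg _ _ _ _ _) (hR0 _ _ _)
    · refine le_of_eq ?_
      field_simp
  set v : (Fin m → S j.succ × (∀ k : {k // j.succ < k}, S k)) →
      (Fin n → Y j × (∀ k : {k // j < k}, Y k)) → Fin n → (∀ k : {k // j < k}, X k) :=
    fun b z t => after j (c.input (fun k => ls (b k)) (fun u => ly (z u)) t) with hv
  -- The auxiliary probability of correct decoding for a given source block and given tails of the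
  -- side information. The source block enters only the comparison with the decoder's output, not
  -- the channel factors.
  set Φ : (Fin m → S 0 × (S j.succ × (∀ k : {k // j.succ < k}, S k))) → ℝ := fun ab =>
    ∑ z, (if c.dec (fun t => ly (z t) (Fin.last K))
      (fun k => ls (ab k).2 (Fin.last K).succ) = (fun k => (ab k).1) then 1 else 0) *
        ∏ t, U (v (fun k => (ab k).2) z t) (z t) with hΦ
  have hvc : ∀ b, Causal (v b) := fun b t z z' h =>
    c.after_input_congr j (fun _ => rfl) fun u hu => by rw [h u hu]
  have hΦ0 : ∀ ab, 0 ≤ Φ ab := fun ab => Finset.sum_nonneg fun z _ =>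
    mul_nonneg (by split_ifs <;> simp) (Finset.prod_nonneg fun _ _ => hU0 _ _)
  have inner : ∀ s : Fin m → ∀ i, S i, ∑ y, (if c.Correct s y then 1 else 0) *
      ∏ t, cutKernel W p j (c.input s y t) (y t) ≤
        Φ (fun k => (s k 0, tailFrom j.succ (s k))) := by
    intro s
    have h := sum_causal_proj_le (cutKernel W p j) U (after j) (tailFrom j)
      (cutKernel_nonneg W p j) hU0 (fun x z => by convert hQU x z) (fun y t => c.input s y t)
      (v (fun k => tailFrom j.succ (s k))) (c.causal_input s) (hvc _)
      (fun y t => c.after_input_congr j (fun k => (hls _).symm) fun u _ => (hly _).symm)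
      (fun z => if c.dec (fun t => ly (z t) (Fin.last K))
        (fun k => ls (tailFrom j.succ (s k)) (Fin.last K).succ) = (fun k => s k 0) then 1 else 0)
      (fun z => by split_ifs <;> simp)
    refine le_trans (le_of_eq ?_) h
    refine Finset.sum_congr rfl fun y _ => ?_
    congr 1
    have e1 : ∀ t, ly (tailFrom j (y t)) (Fin.last K) = y t (Fin.last K) := fun t =>
      eq_of_tailFrom_eq (hly _) (Fin.le_last j)
    have e2 : ∀ k, ls (tailFrom j.succ (s k)) (Fin.last K).succ = s k (Fin.last K).succ :=
      fun k => eq_of_tailFrom_eq (hls _) (Fin.succ_le_succ_iff.2 (Fin.le_last j))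
    simp only [e1, e2]
    exact if_congr Iff.rfl rfl rfl
  have outer := sum_causal_proj_le (fun (_ : Unit) (s : ∀ i, S i) => (q s).toReal /
      condSource q j (s 0) (s j.succ)) (fun (_ : Unit) ab => prob q (tailFrom j.succ) ab.2)
    (fun _ => ()) (fun s => (s 0, tailFrom j.succ s))
    (fun _ s => div_nonneg ENNReal.toReal_nonneg (condSource_nonneg _ _ _ _))
    (fun _ _ => prob_nonneg _ _ _)
    (fun _ ab => by convert hq.sum_div_condSource_le j ab.1 ab.2) (n := m) (fun _ _ => ()) (fun _ _ => ())
    (fun _ _ _ _ => rfl) (fun _ _ _ _ => rfl) (fun _ _ => rfl) Φ hΦ0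
  refine le_trans (le_trans ?_ outer) ?_
  · refine Finset.sum_le_sum fun s _ => ?_
    rw [← Finset.mul_sum, mul_comm]
    exact mul_le_mul_of_nonneg_right (inner s) (Finset.prod_nonneg fun k _ =>
      div_nonneg ENNReal.toReal_nonneg (condSource_nonneg _ _ _ _))
  · rw [← (Equiv.arrowProdEquivProdArrow (Fin m) (fun _ => S 0)
      (fun _ => S j.succ × (∀ k : {k // j.succ < k}, S k))).symm.sum_comp,
      Fintype.sum_prod_type, Finset.sum_comm]
    have hsum : ∑ b : Fin m → S j.succ × (∀ k : {k // j.succ < k}, S k),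
        ∏ k, prob q (tailFrom j.succ) (b k) = 1 := by
      rw [← Fintype.prod_sum (fun (_ : Fin m) b => prob q (tailFrom j.succ) b)]
      have := sum_prob_mul q (tailFrom j.succ) (fun _ => 1)
      simp only [mul_one, sum_toReal_pmf] at this
      simp [this]
    rw [← hsum]
    refine Finset.sum_le_sum fun b _ => ?_
    simp only [Equiv.arrowProdEquivProdArrow, Equiv.coe_fn_symm_mk, hΦ]
    rw [← Finset.sum_mul]
    refine mul_le_of_le_one_left (Finset.prod_nonneg fun _ _ => prob_nonneg _ _ _) ?_
    rw [Finset.sum_comm]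
    refine le_trans (le_of_eq ?_) (sum_causal_le_one U hU0 hU1 (v b) (hvc b))
    refine Finset.sum_congr rfl fun z _ => ?_
    rw [← Finset.sum_mul]
    -- With the tails fixed the decoder's output is fixed, hence right for exactly one source block.
    have : ∀ d : Fin m → S 0, ∑ a : Fin m → S 0, (if d = (fun k => a k) then (1 : ℝ) else 0) = 1 := by
      intro d
      simp
    rw [this, one_mul]

/-- Change of measure. The expectation of `exp (g - ∑ ι)` is at most the auxiliary total mass plus
the auxiliary mass of correct decoding weighted by the inverse source probabilities. Each is at most
one, so `1 + x ≤ exp x` bounds the mean of `g - ∑ ι` by `2 - 1 = 1`. -/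
theorem Code.exists_input_bound (c : Code X Y S m n) {W : (∀ j, X j) → PMF (∀ j, Y j)}
    {q : PMF (∀ i, S i)} (hW : PhysicallyDegraded W) (hq : DegradedSideInfo q) (hn : 0 < n) :
    ∃ p : PMF (∀ j, X j), ∀ j : Fin (K + 1),
      m * condEntropy q (fun s => s 0) (fun s => s j.succ) -
        m * (∑ s : ∀ i, S i, -Real.log (condSource q j (s 0) (s j.succ))) * c.errorProb W q - 1 ≤
      n * cutInfo W p j := by
  obtain ⟨s₀⟩ := exists_of_pmf q
  obtain ⟨x₀⟩ := c.nonempty_input hn s₀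
  have hY : Nonempty (∀ j, Y j) := exists_of_pmf (W x₀)
  -- The law is chosen before the cut `j`, so a single `p` meets all the bounds at once.
  obtain ⟨p, hp⟩ := exists_pmf_of_weight (c.avgWeight W q) (c.avgWeight_nonneg W q)
    (c.sum_avgWeight W q hn)
  refine ⟨p, fun j => ?_⟩
  set ℓ : (∀ i, S i) → ℝ := fun s => -Real.log (condSource q j (s 0) (s j.succ)) with hℓ
  have hℓ0 : ∀ s, 0 ≤ ℓ s := fun s => neg_nonneg.2
    (Real.log_nonpos (condSource_nonneg _ _ _ _) (condSource_le_one _ _ _ _))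
  set Lm := ∑ s, ℓ s with hLm
  have hℓL : ∀ s, ℓ s ≤ Lm := fun s =>
    Finset.single_le_sum (f := ℓ) (fun s _ => hℓ0 s) (Finset.mem_univ s)
  set ι : (∀ j, X j) → (∀ j, Y j) → ℝ :=
    fun x y => Real.log (outProb W j x (y j) / condOut W p j x (y j)) with hι
  have hI : n * cutInfo W p j =
      ∑ s, ∑ y, c.law W q s y * ∑ t, ι (c.input s y t) (y t) := by
    have e : cutInfo W p j = ∑ x, c.avgWeight W q x * ∑ y, (W x y).toReal * ι x y := by
      rw [cutInfo_eq_sum]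
      simp only [hp, Finset.mul_sum, mul_assoc, hι]
    rw [e, c.sum_avgWeight_mul W q hn, Finset.sum_comm]
    refine Finset.sum_congr rfl fun s _ => ?_
    simp only [Finset.mul_sum (s := (Finset.univ : Finset (Fin n)))]
    rw [Finset.sum_comm (s := (Finset.univ : Finset (Fin n → ∀ j, Y j)))]
    refine Finset.sum_congr rfl fun t _ => ?_
    simp only [Code.law, mul_assoc]
    rw [← Finset.mul_sum, ← Finset.mul_sum, sum_causal_expect (fun x y => (W x y).toReal)
      (fun x => sum_toReal_pmf (W x)) _ (c.causal_input s) ι t]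
  set g : (Fin m → ∀ i, S i) → (Fin n → ∀ j, Y j) → ℝ :=
    fun s y => if c.Correct s y then ∑ k, ℓ (s k) else 0 with hg
  have pointwise : ∀ s y, c.law W q s y * g s y - c.law W q s y * ∑ t, ι (c.input s y t) (y t) ≤
      ((∏ k, (q (s k)).toReal) * ∏ t, cutKernel W p j (c.input s y t) (y t) +
        (∏ k, (q (s k)).toReal / condSource q j (s k 0) (s k j.succ)) *
        ((if c.Correct s y then 1 else 0) * ∏ t, cutKernel W p j (c.input s y t) (y t))) -
      c.law W q s y := by
    intro s y
    have hk0 : 0 ≤ ∏ t, cutKernel W p j (c.input s y t) (y t) :=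
      Finset.prod_nonneg fun _ _ => cutKernel_nonneg _ _ _ _ _
    have hq0 : 0 ≤ ∏ k, (q (s k)).toReal := Finset.prod_nonneg fun _ _ => ENNReal.toReal_nonneg
    have hc0 : 0 ≤ ∏ k, (q (s k)).toReal / condSource q j (s k 0) (s k j.succ) :=
      Finset.prod_nonneg fun _ _ => div_nonneg ENNReal.toReal_nonneg (condSource_nonneg _ _ _ _)
    rcases (c.law_nonneg W q s y).eq_or_lt with h0 | h0
    · rw [← h0]
      simp only [zero_mul, sub_zero]
      refine add_nonneg (mul_nonneg hq0 hk0) (mul_nonneg hc0 (mul_nonneg ?_ hk0))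
      split_ifs <;> simp
    · have hqk : ∀ k, 0 < (q (s k)).toReal := fun k =>
        lt_of_le_of_ne ENNReal.toReal_nonneg fun h => h0.ne' <| by
          rw [Code.law, Finset.prod_eq_zero (Finset.mem_univ k) h.symm, zero_mul]
      have hWt : ∀ t, 0 < (W (c.input s y t) (y t)).toReal := fun t =>
        lt_of_le_of_ne ENNReal.toReal_nonneg fun h => h0.ne' <| by
          rw [Code.law, Finset.prod_eq_zero (Finset.mem_univ t) h.symm, mul_zero]
      have hpt : ∀ t, 0 < (p (c.input s y t)).toReal := fun t => by
        rw [hp]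
        have := h0.trans_le (c.le_avgWeight W q hn s y t)
        exact (pos_iff_pos_of_mul_pos this).1 (by positivity)
      have hot : ∀ t, 0 < outProb W j (c.input s y t) (y t j) := fun t =>
        (hWt t).trans_le (toReal_le_outProb W j _ (y t))
      have hct : ∀ t, 0 < condOut W p j (c.input s y t) (y t j) := fun t =>
        condOut_pos W p j (hpt t) (hot t)
      have hsk : ∀ k, 0 < condSource q j (s k 0) (s k j.succ) := fun k =>
        condSource_pos q j (hqk k)
      have e1 : Real.exp (-∑ t, ι (c.input s y t) (y t)) =
          ∏ t, (condOut W p j (c.input s y t) (y t j) / outProb W j (c.input s y t) (y t j)) := by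
        rw [← Finset.sum_neg_distrib, Real.exp_sum]
        refine Finset.prod_congr rfl fun t _ => ?_
        rw [hι, ← Real.log_inv, Real.exp_log (inv_pos.2 (div_pos (hot t) (hct t))), inv_div]
      have e2 : Real.exp (∑ k, ℓ (s k)) = ∏ k, (condSource q j (s k 0) (s k j.succ))⁻¹ := by
        rw [Real.exp_sum]
        refine Finset.prod_congr rfl fun k _ => ?_
        change Real.exp (-Real.log _) = _
        rw [← Real.log_inv, Real.exp_log (inv_pos.2 (hsk k))]
      -- Since `g` vanishes on decoding errors, the exponential is bounded by the sum of its values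
      -- in the two cases; the term 1 is paid for by the total mass of the auxiliary law.
      have e3 : Real.exp (g s y) ≤ 1 + (if c.Correct s y then 1 else 0) *
          ∏ k, (condSource q j (s k 0) (s k j.succ))⁻¹ := by
        simp only [hg]
        split_ifs
        · rw [e2]; linarith
        · simp
      have e4 := Real.add_one_le_exp (g s y - ∑ t, ι (c.input s y t) (y t))
      rw [sub_eq_add_neg, Real.exp_add, e1] at e4
      have e5 : ∏ t, cutKernel W p j (c.input s y t) (y t) =
          (∏ t, (W (c.input s y t) (y t)).toReal) * ∏ t, (condOut W p j (c.input s y t) (y t j) /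
            outProb W j (c.input s y t) (y t j)) := by
        rw [← Finset.prod_mul_distrib]; rfl
      have e6 : ∏ k, (q (s k)).toReal / condSource q j (s k 0) (s k j.succ) =
          (∏ k, (q (s k)).toReal) * ∏ k, (condSource q j (s k 0) (s k j.succ))⁻¹ := by
        rw [← Finset.prod_mul_distrib]; rfl
      have hpr : 0 ≤ ∏ t, (condOut W p j (c.input s y t) (y t j) /
            outProb W j (c.input s y t) (y t j)) :=
        Finset.prod_nonneg fun t _ => (div_pos (hct t) (hot t)).le
      have e7 := mul_le_mul_of_nonneg_left
        (e4.trans (mul_le_mul_of_nonneg_right e3 hpr)) h0.le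
      rw [e5, e6]
      have e8 : c.law W q s y = (∏ k, (q (s k)).toReal) *
        ∏ t, (W (c.input s y t) (y t)).toReal := rfl
      have e9 : c.law W q s y * ((1 + (if c.Correct s y then 1 else 0) *
          ∏ k, (condSource q j (s k 0) (s k j.succ))⁻¹) *
          ∏ t, (condOut W p j (c.input s y t) (y t j) / outProb W j (c.input s y t) (y t j))) =
          (∏ k, (q (s k)).toReal) * ((∏ t, (W (c.input s y t) (y t)).toReal) *
            ∏ t, (condOut W p j (c.input s y t) (y t j) /
              outProb W j (c.input s y t) (y t j))) +
          (∏ k, (q (s k)).toReal) * (∏ k, (condSource q j (s k 0) (s k j.succ))⁻¹) *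
            ((if c.Correct s y then 1 else 0) * ((∏ t, (W (c.input s y t) (y t)).toReal) *
              ∏ t, (condOut W p j (c.input s y t) (y t j) /
                outProb W j (c.input s y t) (y t j)))) := by
        rw [e8]; ring
      rw [← e9]
      linarith
  have hsum := Finset.sum_le_sum fun s (_ : s ∈ Finset.univ) =>
    Finset.sum_le_sum fun y (_ : y ∈ Finset.univ) => pointwise s y
  simp only [Finset.sum_sub_distrib, Finset.sum_add_distrib, ← hI, c.sum_law W q] at hsum
  have hA : ∑ s : Fin m → ∀ i, S i, ∑ y, (∏ k, (q (s k)).toReal) *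
      ∏ t, cutKernel W p j (c.input s y t) (y t) ≤ 1 := by
    rw [← sum_prod_pmf q m]
    refine Finset.sum_le_sum fun s _ => ?_
    rw [← Finset.mul_sum]
    exact mul_le_of_le_one_right (Finset.prod_nonneg fun _ _ => ENNReal.toReal_nonneg)
      (sum_causal_le_one _ (cutKernel_nonneg W p j) (sum_cutKernel_le W p j) _ (c.causal_input s))
  have hB := c.sum_cutKernel_correct_le hW hq p j
  have hg1 : m * condEntropy q (fun s => s 0) (fun s => s j.succ) - m * Lm * c.errorProb W q ≤
      ∑ s, ∑ y, c.law W q s y * g s y := by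
    have e1 : m * condEntropy q (fun s => s 0) (fun s => s j.succ) =
        ∑ s, ∑ y, c.law W q s y * ∑ k, ℓ (s k) := by
      have : ∀ s : Fin m → ∀ i, S i, ∑ y, c.law W q s y * ∑ k, ℓ (s k) =
          ∑ k, (∏ k, (q (s k)).toReal) * ℓ (s k) := by
        intro s
        rw [← Finset.sum_mul, ← Finset.mul_sum]
        simp only [Code.law]
        rw [← Finset.mul_sum, sum_causal_eq_one (fun x y => (W x y).toReal)
          (fun x => sum_toReal_pmf (W x)) _ (c.causal_input s), mul_one]
      simp only [this]
      rw [Finset.sum_comm, condEntropy_source]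
      simp only [sum_prod_pmf_mul q m ℓ]
      simp [hℓ]
    rw [e1, c.errorProb_eq_sum, Finset.mul_sum, ← Finset.sum_sub_distrib]
    refine Finset.sum_le_sum fun s _ => ?_
    rw [Finset.mul_sum, ← Finset.sum_sub_distrib]
    refine Finset.sum_le_sum fun y _ => ?_
    simp only [hg]
    split_ifs
    · simp
    · rw [mul_comm (_ * Lm), ← mul_sub, mul_zero]
      refine mul_nonpos_of_nonneg_of_nonpos (c.law_nonneg W q s y) (sub_nonpos.2 ?_)
      refine (Finset.sum_le_sum fun k _ => hℓL (s k)).trans ?_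
      simp
  linarith

end Converse

/-! ### The upper bound on the capacity -/

section ConverseLimit

variable {K : ℕ} {X Y : Fin (K + 1) → Type*} {S : Fin (K + 2) → Type*}
  [∀ j, Fintype (X j)] [∀ j, Fintype (Y j)] [∀ i, Fintype (S i)]

/-- No limit of input laws is taken: for `a < r` a single code far enough in the sequence has small
error terms for all cuts simultaneously, and its averaged input law already yields the bound `a`. -/
theorem sourceChannelCapacity_le {W : (∀ j, X j) → PMF (∀ j, Y j)} {q : PMF (∀ i, S i)}
    (hW : PhysicallyDegraded W) (hq : DegradedSideInfo q) :
    sourceChannelCapacity W q ≤ ⨆ p : PMF (∀ j, X j), ⨅ j : Fin (K + 1),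
      ratio (cutInfo W p j) (condEntropy q (fun s => s 0) (fun s => s j.succ)) := by
  refine iSup₂_le fun r hr => ?_
  obtain ⟨m, n, c, hmn, hm, -, he⟩ := hr
  refine le_of_forall_lt_imp_le_of_dense fun a ha => ?_
  lift a to ℝ≥0 using (ha.trans ENNReal.coe_lt_top).ne
  rw [ENNReal.coe_lt_coe] at ha
  have ha' : (a : ℝ) < r := ha
  set H : Fin (K + 1) → ℝ := fun j => condEntropy q (fun s => s 0) (fun s => s j.succ) with hH
  set ℓ : Fin (K + 1) → ℝ :=
    fun j => ∑ s : ∀ i, S i, -Real.log (condSource q j (s 0) (s j.succ)) with hℓ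
  have hm' : Tendsto (fun k => ((m k : ℕ) : ℝ)⁻¹) atTop (𝓝 0) :=
    tendsto_inv_atTop_zero.comp (tendsto_natCast_atTop_atTop.comp hm)
  have hev : ∀ᶠ k in atTop, ∀ j, H j ≠ 0 →
      a * H j < r * (H j - ℓ j * (c k).errorProb W q - (m k : ℝ)⁻¹) := by
    rw [eventually_all]
    intro j
    by_cases hj : H j = 0
    · exact Eventually.of_forall fun k h => absurd hj h
    have hpos : 0 < H j := lt_of_le_of_ne (condEntropy_nonneg _ _ _) (Ne.symm hj)
    have ht : Tendsto (fun k => r * (H j - ℓ j * (c k).errorProb W q - (m k : ℝ)⁻¹)) atTop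
        (𝓝 (r * (H j - ℓ j * 0 - 0))) :=
      (((he.const_mul (ℓ j)).const_sub (H j)).sub hm').const_mul _
    have hlt : a * H j < r * (H j - ℓ j * 0 - 0) := by
      simpa using mul_lt_mul_of_pos_right ha' hpos
    filter_upwards [ht.eventually_const_lt hlt] with k hk _ using hk
  obtain ⟨k, hk, hmk⟩ := (hev.and (hm.eventually_gt_atTop 0)).exists
  obtain ⟨hn, hrate⟩ := hmn k
  obtain ⟨p, hp⟩ := (c k).exists_input_bound hW hq hn
  refine le_iSup_of_le p (le_iInf fun j => ?_)
  rw [ratio]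
  split_ifs with h0
  · exact le_top
  have hpos : 0 < H j := lt_of_le_of_ne (condEntropy_nonneg _ _ _) (Ne.symm h0)
  have h1 := hk j h0
  have h2 := hp j
  have hn' : (0 : ℝ) < n k := by exact_mod_cast hn
  have hm0 : (0 : ℝ) < m k := by exact_mod_cast hmk
  set β := H j - ℓ j * (c k).errorProb W q - (m k : ℝ)⁻¹ with hβ
  have hβ0 : 0 < β := by
    have h3 : 0 < r * β := lt_of_le_of_lt (mul_nonneg a.2 hpos.le) h1
    exact (pos_iff_pos_of_mul_pos h3).1 (lt_of_le_of_lt a.2 ha')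
  have h4 : m k * β ≤ n k * cutInfo W p j := by
    refine le_trans (le_of_eq ?_) h2
    rw [hβ, mul_sub, mul_sub, mul_inv_cancel₀ hm0.ne', mul_assoc]
  have h5 : r * n k ≤ m k := (le_div_iff₀ hn').1 hrate
  rw [← ENNReal.ofReal_coe_nnreal]
  refine ENNReal.ofReal_le_ofReal ((le_div_iff₀ hpos).2 ?_)
  refine h1.le.trans (le_of_mul_le_mul_left (le_trans ?_ h4) hn')
  calc n k * (r * β) = r * n k * β := by ring
    _ ≤ m k * β := mul_le_mul_of_nonneg_right h5 hβ0.le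

end ConverseLimit

/-! ### Product laws on the letters of a superposition code -/

section Mix

variable {L : ℕ} {𝒰 : Type*}

/-- The letters of `u` below level `a`, those of `v` from level `a` on. -/
def mix (a : ℕ) (u v : Fin L → 𝒰) : Fin L → 𝒰 := fun k => if (k : ℕ) < a then u k else v k

/-- The product weight of a tuple of letters. -/
def prodWeight (π : Fin L → 𝒰 → ℝ) (u : Fin L → 𝒰) : ℝ := ∏ a, π a (u a)

lemma prodWeight_nonneg {π : Fin L → 𝒰 → ℝ} (hπ : ∀ a v, 0 ≤ π a v) (u : Fin L → 𝒰) :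
    0 ≤ prodWeight π u := Finset.prod_nonneg fun _ _ => hπ _ _

lemma prodWeight_mix_mul (π : Fin L → 𝒰 → ℝ) (a : ℕ) (u v : Fin L → 𝒰) :
    prodWeight π (mix a u v) * prodWeight π (mix a v u) = prodWeight π u * prodWeight π v := by
  simp only [prodWeight, ← Finset.prod_mul_distrib, mix]
  refine Finset.prod_congr rfl fun k _ => ?_
  split_ifs
  · rfl
  · rw [mul_comm]

lemma prodWeight_update_mul (π : Fin L → 𝒰 → ℝ) (a : Fin L) (v : Fin L → 𝒰) (w : 𝒰) :
    prodWeight π (Function.update v a w) * π a (v a) = prodWeight π v * π a w := by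
  simp only [prodWeight]
  rw [← Finset.mul_prod_erase _ _ (Finset.mem_univ a),
    ← Finset.mul_prod_erase _ (fun k => π k (v k)) (Finset.mem_univ a), Function.update_self]
  have : ∏ k ∈ Finset.univ.erase a, π k (Function.update v a w k) =
      ∏ k ∈ Finset.univ.erase a, π k (v k) :=
    Finset.prod_congr rfl fun k hk => by
      rw [Function.update_of_ne (Finset.ne_of_mem_erase hk)]
  rw [this]
  ring

lemma mix_mix (a : ℕ) (u v : Fin L → 𝒰) : mix a (mix a u v) (mix a v u) = u := by
  funext k
  simp only [mix]
  split_ifs <;> rfl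

variable [Fintype 𝒰]

/-- The average of `F` when the letters from level `a` on are drawn afresh. -/
def avgFrom (π : Fin L → 𝒰 → ℝ) (a : ℕ) (F : (Fin L → 𝒰) → ℝ) (u : Fin L → 𝒰) : ℝ :=
  ∑ v, prodWeight π v * F (mix a u v)

lemma sum_prodWeight {π : Fin L → 𝒰 → ℝ} (hπ : ∀ a, ∑ v, π a v = 1) :
    ∑ u, prodWeight π u = 1 := by
  simp only [prodWeight]
  rw [← Fintype.prod_sum]
  simp [hπ]

lemma avgFrom_congr (π : Fin L → 𝒰 → ℝ) (a : ℕ) (F : (Fin L → 𝒰) → ℝ) {u u' : Fin L → 𝒰}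
    (h : ∀ k : Fin L, (k : ℕ) < a → u k = u' k) : avgFrom π a F u = avgFrom π a F u' := by
  refine Finset.sum_congr rfl fun v _ => ?_
  congr 2
  funext k
  simp only [mix]
  split_ifs with hk
  · exact h k hk
  · rfl

lemma avgFrom_nonneg {π : Fin L → 𝒰 → ℝ} (hπ : ∀ a v, 0 ≤ π a v) (a : ℕ) {F : (Fin L → 𝒰) → ℝ}
    (hF : ∀ u, 0 ≤ F u) (u : Fin L → 𝒰) : 0 ≤ avgFrom π a F u :=
  Finset.sum_nonneg fun _ _ => mul_nonneg (prodWeight_nonneg hπ _) (hF _)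

lemma avgFrom_of_le {π : Fin L → 𝒰 → ℝ} (hπ : ∀ a, ∑ v, π a v = 1) {a : ℕ} (ha : L ≤ a)
    (F : (Fin L → 𝒰) → ℝ) (u : Fin L → 𝒰) : avgFrom π a F u = F u := by
  have : ∀ v, mix a u v = u := fun v => funext fun k => if_pos (k.2.trans_le ha)
  simp only [avgFrom, this, ← Finset.sum_mul, sum_prodWeight hπ, one_mul]

lemma avgFrom_zero (π : Fin L → 𝒰 → ℝ) (F : (Fin L → 𝒰) → ℝ) (u : Fin L → 𝒰) :
    avgFrom π 0 F u = ∑ v, prodWeight π v * F v := rfl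

/-- The defining property of conditional expectation given the letters below level `a`. Exchanging
those letters between two independent tuples is an involution that preserves the product weight. -/
lemma sum_avgFrom_mul {π : Fin L → 𝒰 → ℝ} (hπ : ∀ a, ∑ v, π a v = 1) (a : ℕ)
    (F G : (Fin L → 𝒰) → ℝ)
    (hG : ∀ u u', (∀ k : Fin L, (k : ℕ) < a → u k = u' k) → G u = G u') :
    ∑ u, prodWeight π u * (avgFrom π a F u * G u) = ∑ u, prodWeight π u * (F u * G u) := by
  have h1 : ∑ u, prodWeight π u * (avgFrom π a F u * G u) =
      ∑ uv : (Fin L → 𝒰) × (Fin L → 𝒰), prodWeight π uv.1 * prodWeight π uv.2 *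
        (F (mix a uv.1 uv.2) * G (mix a uv.1 uv.2)) := by
    rw [Fintype.sum_prod_type]
    refine Finset.sum_congr rfl fun u _ => ?_
    rw [avgFrom, Finset.sum_mul, Finset.mul_sum]
    refine Finset.sum_congr rfl fun v _ => ?_
    rw [hG u (mix a u v) fun k hk => by simp [mix, hk]]
    ring
  set e : (Fin L → 𝒰) × (Fin L → 𝒰) ≃ (Fin L → 𝒰) × (Fin L → 𝒰) :=
    Function.Involutive.toPerm (fun uv => (mix a uv.1 uv.2, mix a uv.2 uv.1))
      (fun uv => by simp [mix_mix]) with he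
  rw [h1, ← e.sum_comp, Fintype.sum_prod_type]
  refine Finset.sum_congr rfl fun u _ => ?_
  have : ∀ v, prodWeight π (e (u, v)).1 * prodWeight π (e (u, v)).2 *
      (F (mix a (e (u, v)).1 (e (u, v)).2) * G (mix a (e (u, v)).1 (e (u, v)).2)) =
      prodWeight π v * (prodWeight π u * (F u * G u)) := by
    intro v
    change prodWeight π (mix a u v) * prodWeight π (mix a v u) *
      (F (mix a (mix a u v) (mix a v u)) * G (mix a (mix a u v) (mix a v u))) = _
    rw [prodWeight_mix_mul, mix_mix]
    ring
  simp only [this]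
  rw [← Finset.sum_mul, sum_prodWeight hπ, one_mul]

lemma sum_resample {π : Fin L → 𝒰 → ℝ} (hπ : ∀ a, ∑ v, π a v = 1) (a : Fin L)
    (H : (Fin L → 𝒰) → ℝ) :
    ∑ v, prodWeight π v * ∑ w, π a w * H (Function.update v a w) =
      ∑ v, prodWeight π v * H v := by
  set e : (Fin L → 𝒰) × 𝒰 ≃ (Fin L → 𝒰) × 𝒰 :=
    Function.Involutive.toPerm (fun vw => (Function.update vw.1 a vw.2, vw.1 a))
      (fun vw => by simp) with he
  have h1 : ∑ v, prodWeight π v * ∑ w, π a w * H (Function.update v a w) =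
      ∑ vw : (Fin L → 𝒰) × 𝒰, prodWeight π vw.1 * π a vw.2 * H (Function.update vw.1 a vw.2) := by
    rw [Fintype.sum_prod_type]
    simp only [Finset.mul_sum, mul_assoc]
  rw [h1, ← e.sum_comp, Fintype.sum_prod_type]
  refine Finset.sum_congr rfl fun v _ => ?_
  have : ∀ w, prodWeight π (e (v, w)).1 * π a (e (v, w)).2 *
      H (Function.update (e (v, w)).1 a (e (v, w)).2) = π a w * (prodWeight π v * H v) := by
    intro w
    change prodWeight π (Function.update v a w) * π a (v a) *
      H (Function.update (Function.update v a w) a (v a)) = _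
    rw [prodWeight_update_mul, Function.update_idem, Function.update_eq_self]
    ring
  simp only [this]
  rw [← Finset.sum_mul, hπ, one_mul]

/-- The tower property over one level: drawing the letter `a` and then all higher ones is the same
as drawing everything from `a` on. -/
lemma sum_avgFrom_update {π : Fin L → 𝒰 → ℝ} (hπ : ∀ a, ∑ v, π a v = 1) (a : Fin L)
    (F : (Fin L → 𝒰) → ℝ) (u : Fin L → 𝒰) :
    ∑ w, π a w * avgFrom π (a + 1) F (Function.update u a w) = avgFrom π a F u := by
  have hm : ∀ v w, mix (a + 1) (Function.update u a w) v = mix a u (Function.update v a w) := by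
    intro v w
    funext k
    simp only [mix, Function.update_apply]
    rcases lt_trichotomy k a with h | h | h
    · have : (k : ℕ) < a := h
      simp [this, h.ne, Nat.lt_succ_of_lt this]
    · simp [h]
    · have h' : (a : ℕ) < k := h
      simp [h.ne', Nat.not_lt.2 h'.le, show ¬ (k : ℕ) < a + 1 by omega]
  simp only [avgFrom, hm]
  rw [← sum_resample hπ a]
  simp only [Finset.mul_sum]
  rw [Finset.sum_comm]
  refine Finset.sum_congr rfl fun v _ => Finset.sum_congr rfl fun w _ => ?_
  ring

end Mix

/-! ### Representation of dependent inputs by independent letters -/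

section FunctionalRepresentation

variable {K : ℕ} {X : Fin (K + 1) → Type*}

/-- The entries `K, K - 1, …` of `x` and `x'` agree, `a` of them. -/
def AgreeTop (a : ℕ) (x x' : ∀ j, X j) : Prop := ∀ k : Fin (K + 1), K < k + a → x k = x' k

lemma AgreeTop.symm {a : ℕ} {x x' : ∀ j, X j} (h : AgreeTop a x x') : AgreeTop a x' x :=
  fun k hk => (h k hk).symm

lemma AgreeTop.trans {a : ℕ} {x x' x'' : ∀ j, X j} (h : AgreeTop a x x')
    (h' : AgreeTop a x' x'') : AgreeTop a x x'' := fun k hk => (h k hk).trans (h' k hk)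

lemma AgreeTop.mono {a b : ℕ} (hab : a ≤ b) {x x' : ∀ j, X j} (h : AgreeTop b x x') :
    AgreeTop a x x' := fun k hk => h k (hk.trans_le (by omega))

lemma agreeTop_iff_after (j : Fin (K + 1)) (x x' : ∀ j, X j) :
    AgreeTop (K - j) x x' ↔ after j x = after j x' := by
  have hj := j.2
  constructor
  · intro h
    funext ⟨k, hk⟩
    have hk' : (j : ℕ) < k := hk
    exact h k (by omega)
  · intro h k hk
    exact congrFun h ⟨k, by rw [Fin.lt_def]; omega⟩

/-- The index of the input determined at level `a`. -/
def levelIdx (K a : ℕ) : Fin (K + 1) := ⟨K - a, by omega⟩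

/-- The inputs determined by the letters below level `a`, the others being as in `x₀`. -/
def chain (x₀ : ∀ j, X j) (u : Fin (K + 1) → (∀ j, X j) → ∀ j, X j) : ℕ → ∀ j, X j
  | 0 => x₀
  | a + 1 => if h : a < K + 1 then Function.update (chain x₀ u a) (levelIdx K a)
      (u ⟨a, h⟩ (chain x₀ u a) (levelIdx K a)) else chain x₀ u a

lemma chain_succ (x₀ : ∀ j, X j) (u : Fin (K + 1) → (∀ j, X j) → ∀ j, X j) (a : Fin (K + 1)) :
    chain x₀ u (a + 1) = Function.update (chain x₀ u a) (levelIdx K a)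
      (u a (chain x₀ u a) (levelIdx K a)) := by
  rw [chain, dif_pos a.2]

lemma chain_congr (x₀ : ∀ j, X j) {u u' : Fin (K + 1) → (∀ j, X j) → ∀ j, X j} (a : ℕ)
    (h : ∀ k : Fin (K + 1), (k : ℕ) < a → u k = u' k) : chain x₀ u a = chain x₀ u' a := by
  induction a with
  | zero => rfl
  | succ a ih =>
    have ih' := ih fun k hk => h k (hk.trans (Nat.lt_succ_self a))
    simp only [chain]
    split_ifs with ha
    · rw [ih', h ⟨a, ha⟩ (Nat.lt_succ_self a)]
    · exact ih'

lemma agreeTop_update {a : ℕ} (ha : a < K + 1) (x : ∀ j, X j) (v : X (levelIdx K a)) :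
    AgreeTop a (Function.update x (levelIdx K a) v) x := by
  intro k hk
  refine Function.update_of_ne (fun h => ?_) _ _
  rw [h] at hk
  simp only [levelIdx] at hk
  omega

lemma agreeTop_chain (x₀ : ∀ j, X j) (u : Fin (K + 1) → (∀ j, X j) → ∀ j, X j) {a b : ℕ}
    (hab : a ≤ b) : AgreeTop a (chain x₀ u b) (chain x₀ u a) := by
  induction b, hab using Nat.le_induction with
  | base => exact fun _ _ => rfl
  | succ b hb ih =>
    refine AgreeTop.trans ?_ ih
    rw [chain]
    split_ifs with h
    · exact (agreeTop_update h _ _).mono hb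
    · exact fun _ _ => rfl

lemma agreeTop_succ_update {a : ℕ} {x z : ∀ j, X j} (h : AgreeTop a x z) :
    AgreeTop (a + 1) (Function.update z (levelIdx K a) (x (levelIdx K a))) x := by
  intro k hk
  by_cases hk' : k = levelIdx K a
  · subst hk'; simp
  · rw [Function.update_of_ne hk']
    refine (h k ?_).symm
    by_contra hlt
    refine hk' (Fin.ext ?_)
    simp only [levelIdx]
    omega

/-- The channel inputs determined by the letters. -/
def inputOf (x₀ : ∀ j, X j) (u : Fin (K + 1) → (∀ j, X j) → ∀ j, X j) : ∀ j, X j :=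
  chain x₀ u (K + 1)

/-- Level `k` settles the entry `K - k` and later levels leave it alone, so the entry `l` is final
after level `K - l`. This is why `T_l` can transmit without knowing the messages on higher levels.
-/
lemma inputOf_congr (x₀ : ∀ j, X j) {u u' : Fin (K + 1) → (∀ j, X j) → ∀ j, X j}
    (l : Fin (K + 1)) (h : ∀ k : Fin (K + 1), (k : ℕ) + l ≤ K → u k = u' k) :
    inputOf x₀ u l = inputOf x₀ u' l := by
  have hl := l.2
  have e : ∀ u, inputOf x₀ u l = chain x₀ u (K + 1 - l) l := fun u =>
    agreeTop_chain x₀ u (Nat.sub_le _ _) l (by omega)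
  rw [e, e, chain_congr x₀ _ fun k hk => h k (by omega)]

variable [∀ j, Fintype (X j)]

/-- The probability of agreement in the top `a` entries. -/
def topProb (p : PMF (∀ j, X j)) (a : ℕ) (g : (∀ j, X j) → ℝ) (z : ∀ j, X j) : ℝ :=
  ∑ x, if AgreeTop a x z then (p x).toReal * g x else 0

lemma topProb_congr (p : PMF (∀ j, X j)) (a : ℕ) (g : (∀ j, X j) → ℝ) {z z' : ∀ j, X j}
    (h : AgreeTop a z z') : topProb p a g z = topProb p a g z' := by
  refine Finset.sum_congr rfl fun x _ => if_congr ⟨fun h' => h'.trans h, fun h' => h'.trans h.symm⟩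
    rfl rfl

lemma topProb_nonneg (p : PMF (∀ j, X j)) (a : ℕ) (z : ∀ j, X j) : 0 ≤ topProb p a 1 z :=
  Finset.sum_nonneg fun x _ => by split_ifs <;> simp

lemma le_topProb (p : PMF (∀ j, X j)) (a : ℕ) {x z : ∀ j, X j} (h : AgreeTop a x z) :
    (p x).toReal ≤ topProb p a 1 z := by
  refine le_trans ?_ (Finset.single_le_sum (f := fun x => if AgreeTop a x z then
    (p x).toReal * (1 : (∀ j, X j) → ℝ) x else 0) (fun x _ => ?_) (Finset.mem_univ x))
  · simp [h]
  · split_ifs <;> simp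

/-- The conditional law of the inputs given the top `a` entries. -/
def topCond (p : PMF (∀ j, X j)) (a : ℕ) (z x : ∀ j, X j) : ℝ :=
  -- On a null condition the value is an arbitrary probability vector, so that the letters have
  -- total weight one without exception.
  if topProb p a 1 z = 0 then (p x).toReal
  else if AgreeTop a x z then (p x).toReal / topProb p a 1 z else 0

lemma topCond_nonneg (p : PMF (∀ j, X j)) (a : ℕ) (z x : ∀ j, X j) : 0 ≤ topCond p a z x := by
  rw [topCond]
  split_ifs
  · simp
  · exact div_nonneg (by simp) (topProb_nonneg p a z)
  · exact le_rfl

lemma sum_topCond (p : PMF (∀ j, X j)) (a : ℕ) (z : ∀ j, X j) : ∑ x, topCond p a z x = 1 := by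
  by_cases h : topProb p a 1 z = 0
  · simp only [topCond, h, if_true, sum_toReal_pmf]
  · simp only [topCond, h, if_false]
    rw [← div_self h]
    nth_rewrite 2 [topProb]
    rw [Finset.sum_div]
    refine Finset.sum_congr rfl fun x _ => ?_
    split_ifs <;> simp

/-- The law of the letter of level `a`: a random map whose values have the conditional laws of the
inputs given their top `a` entries. -/
def letterWeight (p : PMF (∀ j, X j)) (a : Fin (K + 1)) (v : (∀ j, X j) → ∀ j, X j) : ℝ :=
  ∏ z, topCond p a z (v z)

lemma letterWeight_nonneg (p : PMF (∀ j, X j)) (a : Fin (K + 1)) (v : (∀ j, X j) → ∀ j, X j) :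
    0 ≤ letterWeight p a v := Finset.prod_nonneg fun _ _ => topCond_nonneg _ _ _ _

/-- The values of a random letter at different arguments are independent; all but the one at `z` sum
out. -/
lemma sum_letterWeight_mul (p : PMF (∀ j, X j)) (a : Fin (K + 1)) (z : ∀ j, X j)
    (f : (∀ j, X j) → ℝ) : ∑ v, letterWeight p a v * f (v z) = ∑ x, topCond p a z x * f x := by
  have h := Fintype.prod_sum
    (fun (z' : ∀ j, X j) x => topCond p a z' x * if z' = z then f x else 1)
  have e : ∀ v : (∀ j, X j) → ∀ j, X j, ∏ z', (topCond p a z' (v z') *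
      if z' = z then f (v z') else 1) = letterWeight p a v * f (v z) := fun v => by
    rw [Finset.prod_mul_distrib, Finset.prod_ite_eq' Finset.univ z (fun z' => f (v z'))]
    simp [letterWeight]
  simp only [e] at h
  rw [← h, ← Finset.mul_prod_erase _ _ (Finset.mem_univ z)]
  simp only [if_true]
  rw [Finset.prod_eq_one, mul_one]
  intro z' hz'
  simp [Finset.ne_of_mem_erase hz', sum_topCond]

lemma sum_letterWeight (p : PMF (∀ j, X j)) (a : Fin (K + 1)) : ∑ v, letterWeight p a v = 1 := by
  obtain ⟨x₀⟩ := exists_of_pmf p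
  simpa [sum_topCond] using sum_letterWeight_mul p a x₀ (fun _ => 1)

/-- Conditioning on the letters below level `a` amounts to conditioning on the top `a` inputs they
determine; the identity is multiplied out to avoid a quotient. Downward induction: the letter of
level `a` draws from the conditional law given the top `a` entries, which reduces the claim to the
tower property for `p`. -/
lemma avgFrom_letterWeight_mul (p : PMF (∀ j, X j)) (x₀ : ∀ j, X j) (g : (∀ j, X j) → ℝ)
    {a : ℕ} (ha : a ≤ K + 1) (u : Fin (K + 1) → (∀ j, X j) → ∀ j, X j)
    (hu : topProb p a 1 (chain x₀ u a) ≠ 0) :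
    avgFrom (letterWeight p) a (fun u => g (inputOf x₀ u)) u * topProb p a 1 (chain x₀ u a) =
      topProb p a g (chain x₀ u a) := by
  induction ha using Nat.decreasingInduction generalizing u with
  | self =>
    rw [avgFrom_of_le (sum_letterWeight p) le_rfl]
    have : ∀ x, AgreeTop (K + 1) x (chain x₀ u (K + 1)) ↔ x = inputOf x₀ u := fun x =>
      ⟨fun h => funext fun k => h k (by omega), fun h => h ▸ fun _ _ => rfl⟩
    simp only [topProb, this, Finset.sum_ite_eq', Finset.mem_univ, if_true, Pi.one_apply, mul_one]
    rw [mul_comm]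
  | of_succ a ha ih =>
    set z := chain x₀ u a with hz
    set b : Fin (K + 1) := ⟨a, ha⟩ with hb
    set F : (Fin (K + 1) → (∀ j, X j) → ∀ j, X j) → ℝ := fun u => g (inputOf x₀ u) with hF
    have hrec := sum_avgFrom_update (sum_letterWeight p) b F u
    have hstep : ∀ w, letterWeight p b w * avgFrom (letterWeight p) (a + 1) F
        (Function.update u b w) = letterWeight p b w *
          (topProb p (a + 1) g (w z) / topProb p (a + 1) 1 (w z)) := by
      intro w
      by_cases hw : letterWeight p b w = 0
      · rw [hw, zero_mul, zero_mul]
      have hwz : topCond p a z (w z) ≠ 0 := fun h0 =>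
        hw (Finset.prod_eq_zero (Finset.mem_univ z) h0)
      rw [topCond, if_neg hu] at hwz
      have hag : AgreeTop a (w z) z := by
        by_contra h
        exact hwz (if_neg h)
      rw [if_pos hag] at hwz
      have hpw : 0 < (p (w z)).toReal :=
        lt_of_le_of_ne ENNReal.toReal_nonneg fun h => hwz (by rw [← h, zero_div])
      have hch : chain x₀ (Function.update u b w) (a + 1) =
          Function.update z (levelIdx K a) (w z (levelIdx K a)) := by
        have h1 := chain_succ x₀ (Function.update u b w) b
        have h2 : chain x₀ (Function.update u b w) a = z :=
          chain_congr x₀ a fun k hk =>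
            Function.update_of_ne (fun h => by rw [h] at hk; exact lt_irrefl _ hk) _ _
        rw [Function.update_self] at h1
        change chain x₀ (Function.update u b w) (a + 1) = _ at h1
        rw [h1]
        change Function.update (chain x₀ (Function.update u b w) a) (levelIdx K a)
          (w (chain x₀ (Function.update u b w) a) (levelIdx K a)) = _
        rw [h2]
      -- Only one entry of `w z` enters the chain, but its top `a` entries agree with `z` already,
      -- so the next conditioning is on `w z`.
      have hag' : AgreeTop (a + 1) (chain x₀ (Function.update u b w) (a + 1)) (w z) := by
        rw [hch]
        exact agreeTop_succ_update hag
      have hpos : topProb p (a + 1) 1 (w z) ≠ 0 :=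
        (hpw.trans_le (le_topProb p (a + 1) fun _ _ => rfl)).ne'
      have := ih (Function.update u b w) (by rw [topProb_congr p _ _ hag']; exact hpos)
      rw [topProb_congr p _ _ hag', topProb_congr p _ _ hag'] at this
      rw [← this, mul_div_cancel_right₀ _ hpos]
    change ∑ w, letterWeight p b w * avgFrom (letterWeight p) (a + 1) F (Function.update u b w) =
      avgFrom (letterWeight p) a F u at hrec
    rw [← hrec]
    simp only [hstep]
    rw [sum_letterWeight_mul p b z
      (fun x => topProb p (a + 1) g x / topProb p (a + 1) 1 x), Finset.sum_mul]
    have e1 : ∀ x, topCond p b z x * (topProb p (a + 1) g x / topProb p (a + 1) 1 x) *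
        topProb p a 1 z = ∑ x', if AgreeTop a x z ∧ AgreeTop (a + 1) x' x then
          (p x).toReal * ((p x').toReal * g x' / topProb p (a + 1) 1 x') else 0 := by
      intro x
      change topCond p a z x * _ * _ = _
      rw [topCond, if_neg hu]
      by_cases hx : AgreeTop a x z
      · rw [if_pos hx]
        have : (p x).toReal / topProb p a 1 z * (topProb p (a + 1) g x / topProb p (a + 1) 1 x) *
            topProb p a 1 z = (p x).toReal * (topProb p (a + 1) g x / topProb p (a + 1) 1 x) := by
          field_simp
        rw [this]
        nth_rewrite 1 [topProb]
        rw [Finset.sum_div, Finset.mul_sum]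
        refine Finset.sum_congr rfl fun x' _ => ?_
        by_cases hx' : AgreeTop (a + 1) x' x
        · rw [if_pos hx', if_pos ⟨hx, hx'⟩, topProb_congr p _ _ hx']
        · rw [if_neg hx', if_neg fun h => hx' h.2, zero_div, mul_zero]
      · rw [if_neg hx, zero_mul, zero_mul]
        refine (Finset.sum_eq_zero fun x' _ => if_neg fun h => hx h.1).symm
    simp only [e1]
    rw [Finset.sum_comm, topProb]
    refine Finset.sum_congr rfl fun x' _ => ?_
    have e2 : ∀ x, (if AgreeTop a x z ∧ AgreeTop (a + 1) x' x then
          (p x).toReal * ((p x').toReal * g x' / topProb p (a + 1) 1 x') else 0) =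
        if AgreeTop a x' z then (if AgreeTop (a + 1) x x' then
          (p x).toReal * (1 : (∀ j, X j) → ℝ) x else 0) *
            ((p x').toReal * g x' / topProb p (a + 1) 1 x') else 0 := by
      intro x
      by_cases hx : AgreeTop (a + 1) x x'
      · have h1 : AgreeTop a x z ↔ AgreeTop a x' z :=
          ⟨fun h => (hx.symm.mono (Nat.le_succ a)).trans h,
            fun h => (hx.mono (Nat.le_succ a)).trans h⟩
        simp [hx, hx.symm, h1]
      · have : ¬ AgreeTop (a + 1) x' x := fun h => hx h.symm
        simp [hx, this]
    simp only [e2]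
    split_ifs with hx'
    · rw [← Finset.sum_mul]
      change topProb p (a + 1) 1 x' * _ = _
      by_cases hpx : (p x').toReal = 0
      · simp [hpx]
      · have : topProb p (a + 1) 1 x' ≠ 0 :=
          ((lt_of_le_of_ne ENNReal.toReal_nonneg (Ne.symm hpx)).trans_le
            (le_topProb p (a + 1) fun _ _ => rfl)).ne'
        field_simp
    · simp

lemma sum_prodWeight_inputOf (p : PMF (∀ j, X j)) (x₀ : ∀ j, X j) (g : (∀ j, X j) → ℝ) :
    ∑ u, prodWeight (letterWeight p) u * g (inputOf x₀ u) = ∑ x, (p x).toReal * g x := by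
  have h0 : ∀ g z, topProb p 0 g z = ∑ x, (p x).toReal * g x := by
    intro g z
    refine Finset.sum_congr rfl fun x _ => if_pos fun k hk => ?_
    exact absurd k.2 (by omega)
  have h1 : ∀ z, topProb p 0 1 z = 1 := fun z => by simp [h0, sum_toReal_pmf]
  have h := avgFrom_letterWeight_mul p x₀ g (Nat.zero_le _) (fun _ => id) (by simp [h1])
  rwa [h1, mul_one, h0, avgFrom_zero] at h

/-- The indicator of the null inputs has mean zero under `p`, hence vanishes at every tuple of
letters of positive weight. -/
lemma toReal_inputOf_pos (p : PMF (∀ j, X j)) (x₀ : ∀ j, X j)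
    {u : Fin (K + 1) → (∀ j, X j) → ∀ j, X j} (hu : 0 < prodWeight (letterWeight p) u) :
    0 < (p (inputOf x₀ u)).toReal := by
  refine lt_of_le_of_ne ENNReal.toReal_nonneg fun h0 => ?_
  have h := sum_prodWeight_inputOf p x₀ (fun x => if (p x).toReal = 0 then 1 else 0)
  have e : ∑ x, (p x).toReal * (if (p x).toReal = 0 then (1 : ℝ) else 0) = 0 :=
    Finset.sum_eq_zero fun x _ => by split_ifs with h <;> simp [h]
  rw [e, Finset.sum_eq_zero_iff_of_nonneg fun u _ => mul_nonneg
    (prodWeight_nonneg (letterWeight_nonneg p) u) (by split_ifs <;> simp)] at h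
  have := h u (Finset.mem_univ u)
  rw [if_pos h0.symm, mul_one] at this
  exact hu.ne' this

variable {Y : Fin (K + 1) → Type*} [∀ j, Fintype (Y j)]

lemma avgFrom_outProb (W : (∀ j, X j) → PMF (∀ j, Y j)) (p : PMF (∀ j, X j)) (x₀ : ∀ j, X j)
    (j : Fin (K + 1)) (b : Y j) {u : Fin (K + 1) → (∀ j, X j) → ∀ j, X j}
    (hu : 0 < prodWeight (letterWeight p) u) :
    avgFrom (letterWeight p) (K - j) (fun u => outProb W j (inputOf x₀ u) b) u =
      condOut W p j (inputOf x₀ u) b := by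
  have hle : K - (j : ℕ) ≤ K + 1 := by omega
  have hag : AgreeTop (K - j) (chain x₀ u (K - j)) (inputOf x₀ u) :=
    (agreeTop_chain x₀ u hle).symm
  have hpos := toReal_inputOf_pos p x₀ hu
  have e : ∀ g, topProb p (K - j) g (inputOf x₀ u) =
      ∑ x', if after j x' = after j (inputOf x₀ u) then (p x').toReal * g x' else 0 := fun g =>
    Finset.sum_congr rfl fun x' _ => if_congr (agreeTop_iff_after j _ _) rfl rfl
  have e1 : topProb p (K - j) 1 (inputOf x₀ u) = tailProb p j (inputOf x₀ u) := by
    rw [e, tailProb]; simp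
  have ht := hpos.trans_le (le_tailProb p j (inputOf x₀ u))
  have h := avgFrom_letterWeight_mul p x₀ (fun x => outProb W j x b) hle u
    (by rw [topProb_congr p _ _ hag, e1]; exact ht.ne')
  rw [topProb_congr p _ _ hag, topProb_congr p _ _ hag, e1, e] at h
  rw [condOut, eq_div_iff ht.ne', h]

end FunctionalRepresentation

/-! ### Negative moments -/

/-- The function `l ↦ ∑ μ f ^ (-l)` has value 1 and slope `-∑ μ log f` at zero. For small `l > 0` it
therefore lies below a line of slightly larger slope, and this line lies below the exponential. It
plays the role of the law of large numbers. -/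
lemma eventually_sum_rpow_neg_le {I : Type*} [Fintype I] {μ f : I → ℝ} (h0 : ∀ i, 0 ≤ μ i)
    (h1 : ∑ i, μ i = 1) (hf : ∀ i, 0 < μ i → 0 < f i) {ε : ℝ} (hε : 0 < ε) :
    ∀ᶠ l in 𝓝[>] (0 : ℝ), ∑ i, μ i * f i ^ (-l) ≤
      Real.exp (-l * (∑ i, μ i * Real.log (f i) - ε)) := by
  have hd : HasDerivAt (fun l => ∑ i, μ i * Real.exp (-l * Real.log (f i)))
      (∑ i, μ i * (Real.exp (-0 * Real.log (f i)) * (-1 * Real.log (f i)))) 0 := by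
    refine HasDerivAt.fun_sum fun i _ => HasDerivAt.const_mul _ (HasDerivAt.exp ?_)
    exact (hasDerivAt_neg (0 : ℝ)).mul_const _
  have ht := hd.tendsto_slope_zero_right
  have hD : ∑ i, μ i * (Real.exp (-0 * Real.log (f i)) * (-1 * Real.log (f i))) =
      -∑ i, μ i * Real.log (f i) := by
    rw [← Finset.sum_neg_distrib]
    refine Finset.sum_congr rfl fun i _ => ?_
    simp
  rw [hD] at ht
  filter_upwards [ht.eventually_lt_const
    (show -∑ i, μ i * Real.log (f i) < -∑ i, μ i * Real.log (f i) + ε by linarith),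
    self_mem_nhdsWithin] with l hl hl0
  have hl0' : 0 < l := hl0
  simp only [zero_add, neg_zero, zero_mul, Real.exp_zero, mul_one, h1, smul_eq_mul] at hl
  rw [inv_mul_lt_iff₀ hl0'] at hl
  have e : ∑ i, μ i * f i ^ (-l) = ∑ i, μ i * Real.exp (-l * Real.log (f i)) := by
    refine Finset.sum_congr rfl fun i _ => ?_
    rcases (h0 i).eq_or_lt with h | h
    · simp [← h]
    · rw [Real.rpow_def_of_pos (hf i h), mul_comm (Real.log (f i))]
  rw [e]
  have := Real.add_one_le_exp (-l * (∑ i, μ i * Real.log (f i) - ε))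
  nlinarith

/-! ### Information densities of the levels -/

section Density

variable {K : ℕ} {X Y : Fin (K + 1) → Type*} [∀ j, Fintype (X j)] [∀ j, Fintype (Y j)]

/-- The letters of the code: random maps of the input tuples. -/
abbrev Letter (X : Fin (K + 1) → Type*) : Type _ := (∀ j, X j) → ∀ j, X j

/-- The probability that `T_{j+1}` receives `b` given the letters below level `a`. -/
def levelOut (W : (∀ j, X j) → PMF (∀ j, Y j)) (p : PMF (∀ j, X j)) (x₀ : ∀ j, X j)
    (j : Fin (K + 1)) (a : ℕ) (u : Fin (K + 1) → Letter X) (b : Y j) : ℝ :=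
  avgFrom (letterWeight p) a (fun u => outProb W j (inputOf x₀ u) b) u

/-- The likelihood ratio of the letter of level `a`, given the letters below. -/
def levelDensity (W : (∀ j, X j) → PMF (∀ j, Y j)) (p : PMF (∀ j, X j)) (x₀ : ∀ j, X j)
    (j : Fin (K + 1)) (a : ℕ) (u : Fin (K + 1) → Letter X) (b : Y j) : ℝ :=
  levelOut W p x₀ j (a + 1) u b / levelOut W p x₀ j a u b

/-- The expectation over the letters and the output of `T_{j+1}`. -/
def letterExp (W : (∀ j, X j) → PMF (∀ j, Y j)) (p : PMF (∀ j, X j)) (x₀ : ∀ j, X j)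
    (j : Fin (K + 1)) (f : (Fin (K + 1) → Letter X) → Y j → ℝ) : ℝ :=
  ∑ ub : (Fin (K + 1) → Letter X) × Y j,
    prodWeight (letterWeight p) ub.1 * outProb W j (inputOf x₀ ub.1) ub.2 * f ub.1 ub.2

variable (W : (∀ j, X j) → PMF (∀ j, Y j)) (p : PMF (∀ j, X j)) (x₀ : ∀ j, X j) (j : Fin (K + 1))

lemma levelOut_nonneg (a : ℕ) (u : Fin (K + 1) → Letter X) (b : Y j) :
    0 ≤ levelOut W p x₀ j a u b :=
  avgFrom_nonneg (letterWeight_nonneg p) a (fun _ => outProb_nonneg _ _ _ _) u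

lemma levelDensity_nonneg (a : ℕ) (u : Fin (K + 1) → Letter X) (b : Y j) :
    0 ≤ levelDensity W p x₀ j a u b :=
  div_nonneg (levelOut_nonneg _ _ _ _ _ _ _) (levelOut_nonneg _ _ _ _ _ _ _)

lemma levelOut_congr (a : ℕ) {u u' : Fin (K + 1) → Letter X}
    (h : ∀ k : Fin (K + 1), (k : ℕ) < a → u k = u' k) (b : Y j) :
    levelOut W p x₀ j a u b = levelOut W p x₀ j a u' b := avgFrom_congr _ _ _ h

lemma levelDensity_congr (a : ℕ) {u u' : Fin (K + 1) → Letter X}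
    (h : ∀ k : Fin (K + 1), (k : ℕ) ≤ a → u k = u' k) (b : Y j) :
    levelDensity W p x₀ j a u b = levelDensity W p x₀ j a u' b := by
  rw [levelDensity, levelDensity, levelOut_congr W p x₀ j (a + 1) fun k hk => h k (by omega),
    levelOut_congr W p x₀ j a fun k hk => h k hk.le]

lemma levelOut_pos (a : ℕ) {u : Fin (K + 1) → Letter X} {b : Y j}
    (hu : 0 < prodWeight (letterWeight p) u) (hb : 0 < outProb W j (inputOf x₀ u) b) :
    0 < levelOut W p x₀ j a u b := by
  refine (mul_pos hu hb).trans_le ?_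
  have hm : mix a u u = u := by
    funext k
    simp [mix]
  refine le_trans ?_ (Finset.single_le_sum (f := fun v => prodWeight (letterWeight p) v *
    outProb W j (inputOf x₀ (mix a u v)) b) (fun v _ => mul_nonneg
      (prodWeight_nonneg (letterWeight_nonneg p) v) (outProb_nonneg _ _ _ _)) (Finset.mem_univ u))
  simp only [hm, le_refl]

lemma levelDensity_pos (a : ℕ) {u : Fin (K + 1) → Letter X} {b : Y j}
    (hu : 0 < prodWeight (letterWeight p) u) (hb : 0 < outProb W j (inputOf x₀ u) b) :
    0 < levelDensity W p x₀ j a u b :=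
  div_pos (levelOut_pos _ _ _ _ _ hu hb) (levelOut_pos _ _ _ _ _ hu hb)

lemma letterExp_one : letterExp W p x₀ j (fun _ _ => 1) = 1 := by
  rw [letterExp, Fintype.sum_prod_type]
  simp only [mul_one, ← Finset.mul_sum, sum_outProb]
  exact sum_prodWeight (sum_letterWeight p)

/-- For a wrong message the letter of level `a` is independent of the output. Averaging the
numerator of the likelihood ratio over a fresh letter returns the denominator, so the mean is at
most one. -/
lemma sum_levelDensity_update_le (a : Fin (K + 1)) :
    ∑ u, prodWeight (letterWeight p) u * ∑ w, letterWeight p a w *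
      ∑ b, outProb W j (inputOf x₀ u) b *
        levelDensity W p x₀ j a (Function.update u a w) b ≤ 1 := by
  set π := letterWeight p with hπ
  -- This ratio is 1, or 0 where the probability vanishes.
  set R : Y j → (Fin (K + 1) → Letter X) → ℝ :=
    fun b u => levelOut W p x₀ j a u b / levelOut W p x₀ j a u b with hR
  have e1 : ∀ u b, ∑ w, π a w * levelDensity W p x₀ j a (Function.update u a w) b = R b u := by
    intro u b
    have h0 : ∀ (w : Letter X) (k : Fin (K + 1)), (k : ℕ) < a → Function.update u a w k = u k := by
      intro w k hk
      rw [Function.update_apply, if_neg (by rintro rfl; exact lt_irrefl _ hk)]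
    have h1 : ∀ w, levelOut W p x₀ j a (Function.update u a w) b = levelOut W p x₀ j a u b :=
      fun w => levelOut_congr W p x₀ j a (h0 w) b
    have h2 : ∑ w, π a w * levelOut W p x₀ j (a + 1) (Function.update u a w) b =
        levelOut W p x₀ j a u b :=
      sum_avgFrom_update (sum_letterWeight p) a (fun u => outProb W j (inputOf x₀ u) b) u
    simp only [levelDensity, h1, mul_div_assoc', ← Finset.sum_div, hR]
    rw [h2]
  calc _ = ∑ b, ∑ u, prodWeight π u * (outProb W j (inputOf x₀ u) b * R b u) := by
        rw [Finset.sum_comm]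
        refine Finset.sum_congr rfl fun u _ => ?_
        rw [← Finset.mul_sum]
        congr 1
        simp only [Finset.mul_sum, ← e1]
        rw [Finset.sum_comm]
        refine Finset.sum_congr rfl fun b _ => Finset.sum_congr rfl fun w _ => ?_
        ring
    _ = ∑ b, ∑ u, prodWeight π u * (levelOut W p x₀ j a u b * R b u) := by
        refine Finset.sum_congr rfl fun b _ => ?_
        refine (sum_avgFrom_mul (sum_letterWeight p) a
          (fun u => outProb W j (inputOf x₀ u) b) (R b) fun u u' h => ?_).symm
        simp only [hR]
        rw [levelOut_congr W p x₀ j a h]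
    _ ≤ ∑ b, ∑ u, prodWeight π u * (levelOut W p x₀ j a u b * 1) := by
        refine Finset.sum_le_sum fun b _ => Finset.sum_le_sum fun u _ => ?_
        exact mul_le_mul_of_nonneg_left (mul_le_mul_of_nonneg_left (div_self_le_one _)
          (levelOut_nonneg _ _ _ _ _ _ _)) (prodWeight_nonneg (letterWeight_nonneg p) u)
    _ = ∑ b, ∑ u, prodWeight π u * (outProb W j (inputOf x₀ u) b * 1) :=
        Finset.sum_congr rfl fun b _ =>
          sum_avgFrom_mul (sum_letterWeight p) a (fun u => outProb W j (inputOf x₀ u) b)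
            (fun _ => 1) fun _ _ _ => rfl
    _ = 1 := by
        refine Eq.trans ?_ (letterExp_one W p x₀ j)
        rw [letterExp, Fintype.sum_prod_type_right]
        simp only [mul_assoc, hπ]

lemma letterExp_congr {f g : (Fin (K + 1) → Letter X) → Y j → ℝ}
    (h : ∀ u b, 0 < prodWeight (letterWeight p) u → 0 < outProb W j (inputOf x₀ u) b →
      f u b = g u b) : letterExp W p x₀ j f = letterExp W p x₀ j g := by
  refine Finset.sum_congr rfl fun ub _ => ?_
  rcases (prodWeight_nonneg (letterWeight_nonneg p) ub.1).eq_or_lt with h0 | h0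
  · rw [← h0]; simp
  rcases (outProb_nonneg W j (inputOf x₀ ub.1) ub.2).eq_or_lt with h1 | h1
  · rw [← h1]; simp
  rw [h _ _ h0 h1]

/-- The chain rule as a telescoping sum. At the top all letters are known and the law of the output
is `outProb`; at level `K - j` exactly the inputs after `X_j` are known and it is `condOut`. -/
lemma sum_letterExp_log_levelDensity :
    ∑ a ∈ Finset.Ico (K - j : ℕ) (K + 1),
      letterExp W p x₀ j (fun u b => Real.log (levelDensity W p x₀ j a u b)) =
      cutInfo W p j := by
  have e1 : ∀ a, letterExp W p x₀ j (fun u b => Real.log (levelDensity W p x₀ j a u b)) =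
      letterExp W p x₀ j (fun u b => Real.log (levelOut W p x₀ j (a + 1) u b)) -
      letterExp W p x₀ j (fun u b => Real.log (levelOut W p x₀ j a u b)) := by
    intro a
    rw [letterExp_congr W p x₀ j (f := fun u b => Real.log (levelDensity W p x₀ j a u b))
      (g := fun u b => Real.log (levelOut W p x₀ j (a + 1) u b) -
      Real.log (levelOut W p x₀ j a u b)) fun u b hu hb => Real.log_div
        (levelOut_pos _ _ _ _ _ hu hb).ne' (levelOut_pos _ _ _ _ _ hu hb).ne']
    simp only [letterExp, mul_sub, Finset.sum_sub_distrib]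
  simp only [e1]
  rw [Finset.sum_Ico_sub (fun a => letterExp W p x₀ j
    (fun u b => Real.log (levelOut W p x₀ j a u b))) (by omega)]
  have e2 : letterExp W p x₀ j (fun u b => Real.log (levelOut W p x₀ j (K + 1) u b)) -
      letterExp W p x₀ j (fun u b => Real.log (levelOut W p x₀ j (K - j) u b)) =
      letterExp W p x₀ j (fun u b => Real.log (outProb W j (inputOf x₀ u) b /
        condOut W p j (inputOf x₀ u) b)) := by
    rw [letterExp_congr W p x₀ j (f := fun u b => Real.log (outProb W j (inputOf x₀ u) b /
        condOut W p j (inputOf x₀ u) b)) (g := fun u b =>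
          Real.log (levelOut W p x₀ j (K + 1) u b) - Real.log (levelOut W p x₀ j (K - j) u b))]
    · simp only [letterExp, mul_sub, Finset.sum_sub_distrib]
    · intro u b hu hb
      have h1 : levelOut W p x₀ j (K + 1) u b = outProb W j (inputOf x₀ u) b :=
        avgFrom_of_le (sum_letterWeight p) le_rfl _ _
      have h2 : levelOut W p x₀ j (K - j) u b = condOut W p j (inputOf x₀ u) b :=
        avgFrom_outProb W p x₀ j b hu
      rw [← Real.log_div (levelOut_pos _ _ _ _ _ hu hb).ne' (levelOut_pos _ _ _ _ _ hu hb).ne',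
        h1, h2]
  rw [e2, cutInfo_eq_sum, letterExp, Fintype.sum_prod_type]
  simp only [mul_assoc, ← Finset.mul_sum]
  rw [sum_prodWeight_inputOf p x₀ (fun x => ∑ b, outProb W j x b *
    Real.log (outProb W j x b / condOut W p j x b))]
  simp only [sum_outProb_mul]

lemma eventually_letterExp_rpow_neg_le (a : ℕ) {ε : ℝ} (hε : 0 < ε) :
    ∀ᶠ l in 𝓝[>] (0 : ℝ), letterExp W p x₀ j (fun u b => levelDensity W p x₀ j a u b ^ (-l)) ≤
      Real.exp (-l * (letterExp W p x₀ j
        (fun u b => Real.log (levelDensity W p x₀ j a u b)) - ε)) := by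
  refine eventually_sum_rpow_neg_le
    (μ := fun ub : (Fin (K + 1) → Letter X) × Y j => prodWeight (letterWeight p) ub.1 *
      outProb W j (inputOf x₀ ub.1) ub.2) (f := fun ub => levelDensity W p x₀ j a ub.1 ub.2)
    (fun ub => mul_nonneg (prodWeight_nonneg (letterWeight_nonneg p) _) (outProb_nonneg _ _ _ _))
    ?_ (fun ub h => ?_) hε
  · simpa [letterExp] using letterExp_one W p x₀ j
  · have h1 := prodWeight_nonneg (letterWeight_nonneg p) ub.1
    have h2 := outProb_nonneg W j (inputOf x₀ ub.1) ub.2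
    refine levelDensity_pos W p x₀ j a (lt_of_le_of_ne h1 fun h0 => ?_)
      (lt_of_le_of_ne h2 fun h0 => ?_)
    · simp [← h0] at h
    · simp [← h0] at h

end Density

/-! ### Random codebooks -/

/-- The marginal of a product law on distinct coordinates is again a product. -/
lemma sum_prod_comp_injective {I J 𝒰 : Type*} [Fintype I] [Fintype J] [Fintype 𝒰]
    [DecidableEq I] [DecidableEq J]
    {π : I → 𝒰 → ℝ} (hπ : ∀ i, ∑ v, π i v = 1) {e : J → I} (he : Function.Injective e)
    (f : (J → 𝒰) → ℝ) : ∑ h : I → 𝒰, (∏ i, π i (h i)) * f (fun j => h (e j)) =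
      ∑ v : J → 𝒰, (∏ j, π (e j) (v j)) * f v := by
  have h1 : ∀ h : I → 𝒰, f (fun j => h (e j)) =
      ∑ v : J → 𝒰, if v = (fun j => h (e j)) then f v else 0 := fun h => by simp
  simp only [h1, Finset.mul_sum]
  rw [Finset.sum_comm]
  refine Finset.sum_congr rfl fun v _ => ?_
  have h2 : ∀ h : I → 𝒰, (∏ i, π i (h i)) * (if v = (fun j => h (e j)) then f v else 0) =
      (∏ i, if ∀ j, e j = i → v j = h i then π i (h i) else 0) * f v := by
    intro h
    by_cases hv : v = fun j => h (e j)
    · rw [if_pos hv]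
      congr 1
      refine Finset.prod_congr rfl fun i _ => ?_
      rw [if_pos]
      rintro j rfl
      rw [hv]
    · rw [if_neg hv, mul_zero]
      obtain ⟨j, hj⟩ := Function.ne_iff.1 hv
      rw [Finset.prod_eq_zero (Finset.mem_univ (e j)), zero_mul]
      exact if_neg fun h' => hj (h' j rfl)
  simp only [h2]
  rw [← Finset.sum_mul, ← Fintype.prod_sum fun i x => if ∀ j, e j = i → v j = x then π i x else 0]
  congr 1
  have h3 : ∀ j, ∑ x, (if ∀ j', e j' = e j → v j' = x then π (e j) x else 0) = π (e j) (v j) := by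
    intro j
    have : ∀ x, (∀ j', e j' = e j → v j' = x) ↔ v j = x := fun x =>
      ⟨fun h => h j rfl, fun h j' hj' => by rw [he hj', h]⟩
    simp [this]
  rw [← Finset.prod_subset (Finset.subset_univ (Finset.univ.image e)), Finset.prod_image
    fun j _ j' _ h => he h]
  · exact Finset.prod_congr rfl fun j _ => h3 j
  · intro i _ hi
    have : ∀ x, ∀ j, e j = i → v j = x := fun x j hj =>
      absurd (Finset.mem_image.2 ⟨j, Finset.mem_univ j, hj⟩) hi
    rw [Finset.sum_congr rfl fun x _ => if_pos (this x), hπ]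

section RandomCoding

variable {K N n : ℕ} {X Y : Fin (K + 1) → Type*} [∀ j, Fintype (X j)] [∀ j, Fintype (Y j)]
  {M : Type*} [Fintype M] [DecidableEq M]

/-- The letters used at the time `τ`, which is a pair of a block index and a position in the block:
level `a` carries the message with index `a` plus the block index. -/
def letters (C : Fin N × Fin n → Fin (K + 1) × M → Letter X) (w : ℕ → M) (τ : Fin N × Fin n) :
    Fin (K + 1) → Letter X :=
  fun a => C τ (a, w (τ.1 + a))

/-- The probability of the letters of a codebook at one time. -/
def slotWeight (p : PMF (∀ j, X j)) (G : Fin (K + 1) × M → Letter X) : ℝ :=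
  ∏ i, letterWeight p i.1 (G i)

/-- The probability of a codebook. -/
def bookWeight (p : PMF (∀ j, X j)) (C : Fin N × Fin n → Fin (K + 1) × M → Letter X) : ℝ :=
  ∏ τ, slotWeight p (C τ)

/-- The probability of the channel outputs when all terminals know the messages. -/
def idealProb (W : (∀ j, X j) → PMF (∀ j, Y j)) (x₀ : ∀ j, X j)
    (C : Fin N × Fin n → Fin (K + 1) × M → Letter X) (w : ℕ → M)
    (y : Fin N × Fin n → ∀ j, Y j) : ℝ :=
  ∏ τ, (W (inputOf x₀ (letters C w τ)) (y τ)).toReal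

/-- Block `c` carries information for `T_{j+1}` on the message with index `e`. -/
def InWindow (j : Fin (K + 1)) (e c : ℕ) : Prop := c ≤ e ∧ e ≤ c + K ∧ K ≤ e - c + j

/-- The factor of the decoding metric belonging to the time `τ`. -/
def windowDensity (W : (∀ j, X j) → PMF (∀ j, Y j)) (p : PMF (∀ j, X j)) (x₀ : ∀ j, X j)
    (j : Fin (K + 1)) (e c : ℕ) (u : Fin (K + 1) → Letter X) (b : Y j) : ℝ :=
  if InWindow j e c then levelDensity W p x₀ j (e - c) u b else 1

/-- The metric with which `T_{j+1}` decodes the message with index `e`; `score` is the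
probability of the message given the side information. -/
def metric (W : (∀ j, X j) → PMF (∀ j, Y j)) (p : PMF (∀ j, X j)) (x₀ : ∀ j, X j)
    (C : Fin N × Fin n → Fin (K + 1) × M → Letter X) (score : M → ℝ) (j : Fin (K + 1)) (e : ℕ)
    (w : ℕ → M) (y : Fin N × Fin n → Y j) : ℝ :=
  score (w e) * ∏ τ, windowDensity W p x₀ j e τ.1 (letters C w τ) (y τ)

lemma slotWeight_nonneg (p : PMF (∀ j, X j)) (G : Fin (K + 1) × M → Letter X) :
    0 ≤ slotWeight p G := Finset.prod_nonneg fun _ _ => letterWeight_nonneg _ _ _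

lemma bookWeight_nonneg (p : PMF (∀ j, X j)) (C : Fin N × Fin n → Fin (K + 1) × M → Letter X) :
    0 ≤ bookWeight p C := Finset.prod_nonneg fun _ _ => slotWeight_nonneg _ _

lemma idealProb_nonneg (W : (∀ j, X j) → PMF (∀ j, Y j)) (x₀ : ∀ j, X j)
    (C : Fin N × Fin n → Fin (K + 1) × M → Letter X) (w : ℕ → M)
    (y : Fin N × Fin n → ∀ j, Y j) : 0 ≤ idealProb W x₀ C w y :=
  Finset.prod_nonneg fun _ _ => ENNReal.toReal_nonneg

lemma sum_slotWeight_mul (p : PMF (∀ j, X j)) (σ : Fin (K + 1) → M)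
    (f : (Fin (K + 1) → Letter X) → ℝ) :
    ∑ G : Fin (K + 1) × M → Letter X, slotWeight p G * f (fun a => G (a, σ a)) =
      ∑ u, prodWeight (letterWeight p) u * f u :=
  sum_prod_comp_injective (π := fun i : Fin (K + 1) × M => letterWeight p i.1)
    (fun i => sum_letterWeight p i.1) (e := fun a => (a, σ a))
    (fun _ _ h => (Prod.mk.inj h).1) f

lemma sum_slotWeight (p : PMF (∀ j, X j)) :
    ∑ G : Fin (K + 1) × M → Letter X, slotWeight p G = 1 := by
  simp only [slotWeight]
  rw [← Fintype.prod_sum fun (i : Fin (K + 1) × M) v => letterWeight p i.1 v]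
  simp [sum_letterWeight]

lemma sum_bookWeight (p : PMF (∀ j, X j)) :
    ∑ C : Fin N × Fin n → Fin (K + 1) × M → Letter X, bookWeight p C = 1 := by
  simp only [bookWeight]
  rw [← Fintype.prod_sum fun (_ : Fin N × Fin n) (G : Fin (K + 1) × M → Letter X) =>
    slotWeight p G]
  simp [sum_slotWeight]

/-- The letter of a competing message at level `a₀` is a codebook entry different from all those
sent, hence independent of them. `Option` adjoins it to the family of sent entries. -/
lemma sum_slotWeight_mul_alt (p : PMF (∀ j, X j)) (σ : Fin (K + 1) → M) (a₀ : Fin (K + 1))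
    (w₁ : M) (h : w₁ ≠ σ a₀) (f : (Fin (K + 1) → Letter X) → Letter X → ℝ) :
    ∑ G : Fin (K + 1) × M → Letter X,
      slotWeight p G * f (fun a => G (a, σ a)) (G (a₀, w₁)) =
      ∑ u, prodWeight (letterWeight p) u * ∑ v, letterWeight p a₀ v * f u v := by
  have key := sum_prod_comp_injective (π := fun i : Fin (K + 1) × M => letterWeight p i.1)
    (fun i => sum_letterWeight p i.1)
    (e := fun o : Option (Fin (K + 1)) => o.elim (a₀, w₁) fun a => (a, σ a)) (by
      rintro (_ | a) (_ | a') hh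
      · rfl
      · simp only [Option.elim, Prod.mk.injEq] at hh
        obtain ⟨rfl, h2⟩ := hh
        exact absurd h2 h
      · simp only [Option.elim, Prod.mk.injEq] at hh
        obtain ⟨rfl, h2⟩ := hh
        exact absurd h2.symm h
      · simp only [Option.elim, Prod.mk.injEq] at hh
        rw [hh.1]) (fun g => f (fun a => g (some a)) (g none))
  refine key.trans ?_
  rw [← (Equiv.piOptionEquivProd (β := fun _ => Letter X)).symm.sum_comp, Fintype.sum_prod_type,
    Finset.sum_comm]
  refine Finset.sum_congr rfl fun u _ => ?_
  rw [Finset.mul_sum]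
  refine Finset.sum_congr rfl fun v _ => ?_
  rw [Fintype.prod_option]
  simp only [Equiv.piOptionEquivProd, Equiv.coe_fn_symm_mk, Option.elim, prodWeight]
  ring

variable (W : (∀ j, X j) → PMF (∀ j, Y j)) (p : PMF (∀ j, X j)) (x₀ : ∀ j, X j)

lemma sum_bookWeight_idealProb_mul (w : ℕ → M)
    (ψ : Fin N × Fin n → (Fin (K + 1) × M → Letter X) → (∀ j, Y j) → ℝ) :
    ∑ C : Fin N × Fin n → Fin (K + 1) × M → Letter X, bookWeight p C *
      ∑ y, idealProb W x₀ C w y * ∏ τ, ψ τ (C τ) (y τ) =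
    ∏ τ : Fin N × Fin n, ∑ G, slotWeight p G *
      ∑ y, (W (inputOf x₀ fun a => G (a, w (τ.1 + a))) y).toReal * ψ τ G y := by
  rw [Fintype.prod_sum]
  refine Finset.sum_congr rfl fun C _ => ?_
  rw [Finset.prod_mul_distrib, bookWeight]
  congr 1
  rw [Fintype.prod_sum]
  refine Finset.sum_congr rfl fun y _ => ?_
  rw [Finset.prod_mul_distrib]
  rfl

variable (j : Fin (K + 1))

lemma windowDensity_nonneg (e c : ℕ) (u : Fin (K + 1) → Letter X) (b : Y j) :
    0 ≤ windowDensity W p x₀ j e c u b := by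
  rw [windowDensity]
  split_ifs
  · exact levelDensity_nonneg _ _ _ _ _ _ _
  · exact zero_le_one

/-- The factor of the negative moment of the metric belonging to block `c`. -/
def windowMoment (l : ℝ) (e c : ℕ) : ℝ :=
  if InWindow j e c then letterExp W p x₀ j (fun u b => levelDensity W p x₀ j (e - c) u b ^ (-l))
  else 1

lemma sum_slotWeight_windowDensity_rpow (l : ℝ) (e c : ℕ) (w : ℕ → M) :
    ∑ G, slotWeight p G * ∑ y, (W (inputOf x₀ fun a => G (a, w (c + a))) y).toReal *
      windowDensity W p x₀ j e c (fun a => G (a, w (c + a))) (y j) ^ (-l) =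
    windowMoment W p x₀ j l e c := by
  rw [sum_slotWeight_mul p (fun a => w (c + a)) (fun u => ∑ y, (W (inputOf x₀ u) y).toReal *
    windowDensity W p x₀ j e c u (y j) ^ (-l))]
  have e1 : ∀ u, ∑ y, (W (inputOf x₀ u) y).toReal * windowDensity W p x₀ j e c u (y j) ^ (-l) =
      ∑ b, outProb W j (inputOf x₀ u) b * windowDensity W p x₀ j e c u b ^ (-l) := fun u =>
    (sum_outProb_mul W j _ (fun b => windowDensity W p x₀ j e c u b ^ (-l))).symm
  simp only [e1]
  rw [windowMoment]
  split_ifs with h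
  · simp only [windowDensity, h, if_true, letterExp, Fintype.sum_prod_type, Finset.mul_sum,
      mul_assoc]
  · simp only [windowDensity, h, if_false, Real.one_rpow, mul_one, sum_outProb]
    exact sum_prodWeight (sum_letterWeight p)

/-- In block `c` the message index `e` occurs at level `e - c` only, so changing that message
replaces exactly one letter by an independent one. Blocks outside the window contribute the factor
1. -/
lemma sum_slotWeight_windowDensity_update_le (e c : ℕ) (w : ℕ → M) {w₁ : M} (hw₁ : w₁ ≠ w e) :
    ∑ G, slotWeight p G * ∑ y, (W (inputOf x₀ fun a => G (a, w (c + a))) y).toReal *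
      windowDensity W p x₀ j e c (fun a => G (a, Function.update w e w₁ (c + a))) (y j) ≤ 1 := by
  by_cases h : InWindow j e c
  · set a₀ : Fin (K + 1) := ⟨e - c, by have := h.1; have := h.2.1; omega⟩ with ha₀
    have hca : c + (a₀ : ℕ) = e := by simp only [ha₀]; have := h.1; omega
    have e1 : ∀ G : Fin (K + 1) × M → Letter X,
        (fun a => G (a, Function.update w e w₁ (c + a))) =
          Function.update (fun a => G (a, w (c + a))) a₀ (G (a₀, w₁)) := by
      intro G
      funext a
      by_cases ha : a = a₀
      · subst ha
        rw [Function.update_self, hca, Function.update_self]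
      · rw [Function.update_apply _ a₀, if_neg ha, Function.update_of_ne]
        intro h'
        exact ha (Fin.ext (by omega))
    simp only [e1]
    rw [sum_slotWeight_mul_alt p (fun a => w (c + a)) a₀ w₁ (by rwa [hca]) (fun u v =>
      ∑ y, (W (inputOf x₀ u) y).toReal * windowDensity W p x₀ j e c
        (Function.update u a₀ v) (y j))]
    refine le_trans (le_of_eq ?_) (sum_levelDensity_update_le W p x₀ j a₀)
    refine Finset.sum_congr rfl fun u _ => ?_
    congr 1
    refine Finset.sum_congr rfl fun v _ => ?_
    congr 1
    rw [sum_outProb_mul]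
    simp only [windowDensity, h, if_true]
    rfl
  · simp only [windowDensity, h, if_false, mul_one, sum_toReal_pmf, sum_slotWeight, le_refl]

/-- The true message fails the test of the metric, or a wrong one passes it. -/
def MetricFails (C : Fin N × Fin n → Fin (K + 1) × M → Letter X) (score : M → ℝ) (θ : ℝ) (e : ℕ)
    (w : ℕ → M) (y : Fin N × Fin n → Y j) : Prop :=
  ¬ θ ≤ metric W p x₀ C score j e w y ∨
    ∃ w₁, w₁ ≠ w e ∧ θ ≤ metric W p x₀ C score j e (Function.update w e w₁) y

lemma metric_nonneg (C : Fin N × Fin n → Fin (K + 1) × M → Letter X) {score : M → ℝ}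
    (hs : ∀ v, 0 ≤ score v) (e : ℕ) (w : ℕ → M) (y : Fin N × Fin n → Y j) :
    0 ≤ metric W p x₀ C score j e w y :=
  mul_nonneg (hs _) (Finset.prod_nonneg fun _ _ => windowDensity_nonneg _ _ _ _ _ _ _ _)

lemma metric_pos {C : Fin N × Fin n → Fin (K + 1) × M → Letter X} {score : M → ℝ} (e : ℕ)
    {w : ℕ → M} {y : Fin N × Fin n → ∀ j, Y j} (hs : 0 < score (w e)) (hC : bookWeight p C ≠ 0)
    (hy : idealProb W x₀ C w y ≠ 0) : 0 < metric W p x₀ C score j e w (fun τ => y τ j) := by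
  refine mul_pos hs (Finset.prod_pos fun τ _ => ?_)
  rw [windowDensity]
  split_ifs
  · refine levelDensity_pos W p x₀ j _ (Finset.prod_pos fun a _ => ?_) ?_
    · refine lt_of_le_of_ne (letterWeight_nonneg _ _ _) fun h => hC ?_
      refine Finset.prod_eq_zero (Finset.mem_univ τ) ?_
      exact Finset.prod_eq_zero (Finset.mem_univ (a, w (τ.1 + a))) h.symm
    · refine lt_of_lt_of_le (lt_of_le_of_ne ENNReal.toReal_nonneg fun h => hy ?_)
        (toReal_le_outProb W j _ (y τ))
      exact Finset.prod_eq_zero (Finset.mem_univ τ) h.symm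
  · exact zero_lt_one

/-- The average over the codebooks of the probability that the test of the metric fails. -/
theorem sum_bookWeight_metricFails_le {score : M → ℝ} (hs : ∀ v, 0 ≤ score v)
    (hs1 : ∑ v, score v ≤ 1) {θ l : ℝ} (hθ : 0 < θ) (hl : 0 < l) (e : ℕ) (w : ℕ → M)
    (hw : 0 < score (w e)) :
    ∑ C : Fin N × Fin n → Fin (K + 1) × M → Letter X, bookWeight p C *
      ∑ y, idealProb W x₀ C w y *
        (if MetricFails W p x₀ j C score θ e w (fun τ => y τ j) then 1 else 0) ≤
    θ ^ l * score (w e) ^ (-l) * ∏ τ : Fin N × Fin n, windowMoment W p x₀ j l e τ.1 + θ⁻¹ := by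
  set Λ : (Fin N × Fin n → Fin (K + 1) × M → Letter X) → (ℕ → M) →
      (Fin N × Fin n → ∀ j, Y j) → ℝ :=
    fun C w y => metric W p x₀ C score j e w (fun τ => y τ j) with hΛ
  have hΛ0 : ∀ C w y, 0 ≤ Λ C w y := fun C w y => metric_nonneg W p x₀ j C hs e w _
  -- Markov's inequality with a union bound: `(θ / Λ) ^ l ≥ 1` if the true message fails, `Λ / θ ≥
  -- 1` for a wrong one that passes. Null events are split off because `Λ ^ (-l)` is large only for
  -- positive `Λ`; at zero the real power takes the value 0.
  have pt : ∀ C y, bookWeight p C * (idealProb W x₀ C w y *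
      (if MetricFails W p x₀ j C score θ e w (fun τ => y τ j) then 1 else 0)) ≤
      bookWeight p C * (idealProb W x₀ C w y * (θ ^ l * Λ C w y ^ (-l) +
        ∑ w₁ ∈ Finset.univ.erase (w e), θ⁻¹ * Λ C (Function.update w e w₁) y)) := by
    intro C y
    by_cases hC : bookWeight p C = 0
    · rw [hC, zero_mul, zero_mul]
    by_cases hy : idealProb W x₀ C w y = 0
    · rw [hy, zero_mul, zero_mul]
    have hpos : 0 < Λ C w y := metric_pos W p x₀ j e hw hC hy
    refine mul_le_mul_of_nonneg_left (mul_le_mul_of_nonneg_left ?_ (idealProb_nonneg _ _ _ _ _))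
      (bookWeight_nonneg _ _)
    have t1 : 0 ≤ θ ^ l * Λ C w y ^ (-l) := by positivity
    have t2 : ∀ w₁, 0 ≤ θ⁻¹ * Λ C (Function.update w e w₁) y := fun w₁ =>
      mul_nonneg (inv_nonneg.2 hθ.le) (hΛ0 _ _ _)
    split_ifs with hf
    · rcases hf with hf | ⟨w₁, hw₁, hf⟩
      · refine le_add_of_le_of_nonneg ?_ (Finset.sum_nonneg fun w₁ _ => t2 w₁)
        rw [Real.rpow_neg hpos.le, ← div_eq_mul_inv, ← Real.div_rpow hθ.le hpos.le]
        exact Real.one_le_rpow ((one_le_div hpos).2 (not_le.1 hf).le) hl.le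
      · refine le_add_of_nonneg_of_le t1 (le_trans ?_ (Finset.single_le_sum
          (f := fun w₁ => θ⁻¹ * Λ C (Function.update w e w₁) y) (fun w₁ _ => t2 w₁)
          (Finset.mem_erase.2 ⟨hw₁, Finset.mem_univ w₁⟩)))
        change 1 ≤ θ⁻¹ * _
        rw [le_inv_mul_iff₀ hθ, mul_one]
        exact hf
    · exact add_nonneg t1 (Finset.sum_nonneg fun w₁ _ => t2 w₁)
  have main : ∀ C y, bookWeight p C * (idealProb W x₀ C w y * (θ ^ l * Λ C w y ^ (-l) +
        ∑ w₁ ∈ Finset.univ.erase (w e), θ⁻¹ * Λ C (Function.update w e w₁) y)) =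
      θ ^ l * score (w e) ^ (-l) * (bookWeight p C * (idealProb W x₀ C w y *
        ∏ τ, windowDensity W p x₀ j e τ.1 (letters C w τ) (y τ j) ^ (-l))) +
      ∑ w₁ ∈ Finset.univ.erase (w e), θ⁻¹ * score w₁ * (bookWeight p C * (idealProb W x₀ C w y *
        ∏ τ, windowDensity W p x₀ j e τ.1 (letters C (Function.update w e w₁) τ) (y τ j))) := by
    intro C y
    rw [mul_add, mul_add]
    congr 1
    · simp only [hΛ, metric]
      rw [Real.mul_rpow (hs _) (Finset.prod_nonneg fun _ _ => windowDensity_nonneg _ _ _ _ _ _ _ _),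
        ← Real.finsetProd_rpow _ _ fun _ _ => windowDensity_nonneg _ _ _ _ _ _ _ _]
      ring
    · rw [Finset.mul_sum, Finset.mul_sum]
      refine Finset.sum_congr rfl fun w₁ _ => ?_
      simp only [hΛ, metric, Function.update_self]
      ring
  simp only [Finset.mul_sum]
  refine (Finset.sum_le_sum fun C _ => Finset.sum_le_sum fun y _ => pt C y).trans ?_
  simp only [main, Finset.sum_add_distrib]
  refine add_le_add (le_of_eq ?_) ?_
  · simp only [← Finset.mul_sum]
    congr 1
    refine (sum_bookWeight_idealProb_mul W p x₀ w (fun τ G y =>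
      windowDensity W p x₀ j e τ.1 (fun a => G (a, w (τ.1 + a))) (y j) ^ (-l))).trans ?_
    exact Finset.prod_congr rfl fun τ _ =>
      sum_slotWeight_windowDensity_rpow W p x₀ j l e τ.1 w
  · rw [Finset.sum_congr rfl fun C _ => Finset.sum_comm, Finset.sum_comm]
    calc _ ≤ ∑ w₁ ∈ Finset.univ.erase (w e), θ⁻¹ * score w₁ * 1 := by
          refine Finset.sum_le_sum fun w₁ hw₁ => ?_
          simp only [← Finset.mul_sum]
          refine mul_le_mul_of_nonneg_left ?_ (mul_nonneg (inv_nonneg.2 hθ.le) (hs w₁))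
          refine (le_of_eq (sum_bookWeight_idealProb_mul W p x₀ w (fun τ G y =>
            windowDensity W p x₀ j e τ.1 (fun a => G (a, Function.update w e w₁ (τ.1 + a)))
              (y j)))).trans ?_
          refine Finset.prod_le_one (fun τ _ => ?_) fun τ _ =>
            sum_slotWeight_windowDensity_update_le W p x₀ j e τ.1 w (Finset.ne_of_mem_erase hw₁)
          exact Finset.sum_nonneg fun G _ => mul_nonneg (slotWeight_nonneg p G)
            (Finset.sum_nonneg fun y _ => mul_nonneg ENNReal.toReal_nonneg
              (windowDensity_nonneg _ _ _ _ _ _ _ _))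
      _ ≤ θ⁻¹ := by
          simp only [mul_one, ← Finset.mul_sum]
          refine mul_le_of_le_one_right (inv_nonneg.2 hθ.le) (le_trans ?_ hs1)
          exact Finset.sum_le_sum_of_subset_of_nonneg (Finset.subset_univ _) fun v _ _ => hs v

end RandomCoding

/-! ### Block Markov codes from sequential tests -/

section BlockCode

variable {K B m n : ℕ} {X Y : Fin (K + 1) → Type*} {S : Fin (K + 2) → Type*}

/-- The block of `f` with message index `e`; the blocks have the indices `K, …, K + B - 1`, and
outside this range the block is constant. -/
def block {A : Type*} (K : ℕ) {B m : ℕ} (d : A) (f : Fin (B * m) → A) (e : ℕ) : Fin m → A :=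
  fun k => if h : K ≤ e ∧ e < K + B then
    f (finProdFinEquiv (⟨e - K, by have := h.1; have := h.2; omega⟩, k)) else d

lemma block_add {A : Type*} (d : A) (f : Fin (B * m) → A) (b : Fin B) (k : Fin m) :
    block K d f (K + b) k = f (finProdFinEquiv (b, k)) := by
  have h : K ≤ K + (b : ℕ) ∧ K + (b : ℕ) < K + B := ⟨by omega, by omega⟩
  rw [block, dif_pos h]
  congr 3
  exact Fin.ext (by simp)

lemma block_of_not {A : Type*} (d : A) (f : Fin (B * m) → A) {e : ℕ}
    (h : ¬ (K ≤ e ∧ e < K + B)) : block K d f e = fun _ => d := by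
  funext k
  rw [block, dif_neg h]

/-- The successive decisions: the messages with index below the last argument are decided by the
test, the others have the value `w₀`. -/
def estimate {M 𝒮 Z : Type*} (K B : ℕ) (w₀ : M) (test : ℕ → (ℕ → M) → 𝒮 → Z → Prop)
    (σ : ℕ → 𝒮) (y : Z) : ℕ → ℕ → M
  | 0 => fun _ => w₀
  | e + 1 => Function.update (estimate K B w₀ test σ y e) e
      (if h : (K ≤ e ∧ e < K + B) ∧
          ∃ w₁, test e (Function.update (estimate K B w₀ test σ y e) e w₁) (σ e) y
        then h.2.choose else w₀)

/-- The test for the message with index `e` identifies the message. -/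
def Identifies {M 𝒮 Z : Type*} (test : ℕ → (ℕ → M) → 𝒮 → Z → Prop) (e : ℕ) (w : ℕ → M) (σ : 𝒮)
    (y : Z) : Prop :=
  test e w σ y ∧ ∀ w₁, w₁ ≠ w e → ¬ test e (Function.update w e w₁) σ y

/-- If every test singles out the true message given the true predecessors, induction shows that the
successive decisions never err, whatever the choice function does in other cases. -/
lemma estimate_eq {M 𝒮 Z : Type*} {w₀ : M} {test : ℕ → (ℕ → M) → 𝒮 → Z → Prop}
    (hw : ∀ e w w' σ y, (∀ e' ≤ e, w e' = w' e') → test e w σ y → test e w' σ y)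
    {σ : ℕ → 𝒮} {y : Z} {w : ℕ → M} (hw₀ : ∀ e, ¬ (K ≤ e ∧ e < K + B) → w e = w₀)
    (hgood : ∀ e, K ≤ e → e < K + B → Identifies test e w (σ e) y) (e : ℕ) :
    estimate K B w₀ test σ y e = fun e' => if e' < e then w e' else w₀ := by
  induction e with
  | zero => funext e'; simp [estimate]
  | succ e ih =>
    have hag : ∀ w₁, ∀ e' ≤ e, Function.update (estimate K B w₀ test σ y e) e w₁ e' =
        Function.update w e w₁ e' := by
      intro w₁ e' he'
      rcases he'.eq_or_lt with rfl | h
      · simp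
      · rw [Function.update_of_ne h.ne, Function.update_of_ne h.ne, ih]
        simp [h]
    have hdec : (if h : (K ≤ e ∧ e < K + B) ∧
          ∃ w₁, test e (Function.update (estimate K B w₀ test σ y e) e w₁) (σ e) y
        then h.2.choose else w₀) = w e := by
      by_cases hr : K ≤ e ∧ e < K + B
      · obtain ⟨h1, h2⟩ := hgood e hr.1 hr.2
        have hex : ∃ w₁, test e (Function.update (estimate K B w₀ test σ y e) e w₁) (σ e) y := by
          refine ⟨w e, hw e w _ _ _ (fun e' he' => ?_) h1⟩
          rw [hag _ e' he', Function.update_eq_self]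
        rw [dif_pos ⟨hr, hex⟩]
        by_contra hne
        exact h2 _ hne (hw e _ _ _ _ (hag _) hex.choose_spec)
      · rw [dif_neg fun h => hr h.1, hw₀ e hr]
    rw [estimate, hdec]
    funext e'
    rcases lt_trichotomy e' e with h | rfl | h
    · rw [Function.update_of_ne h.ne, ih]
      simp [h, h.trans (Nat.lt_succ_self e)]
    · simp
    · rw [Function.update_of_ne h.ne', ih]
      simp [h.not_gt, show ¬ e' < e + 1 by omega]

lemma estimate_congr {M 𝒮 Z : Type*} {w₀ : M} {test : ℕ → (ℕ → M) → 𝒮 → Z → Prop}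
    {σ : ℕ → 𝒮} {y y' : Z} (e : ℕ)
    (hy : ∀ e' < e, ∀ w, test e' w (σ e') y ↔ test e' w (σ e') y') :
    estimate K B w₀ test σ y e = estimate K B w₀ test σ y' e := by
  induction e with
  | zero => rfl
  | succ e ih =>
    have ih' := ih fun e' he' => hy e' (he'.trans (Nat.lt_succ_self e))
    simp only [estimate, ih']
    congr 1
    have : (fun w₁ => test e (Function.update (estimate K B w₀ test σ y' e) e w₁) (σ e) y) =
        fun w₁ => test e (Function.update (estimate K B w₀ test σ y' e) e w₁) (σ e) y' :=
      funext fun w₁ => propext (hy e (Nat.lt_succ_self e) _)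
    simp only [this]

variable [∀ j, Fintype (X j)] [∀ j, Fintype (Y j)] [∀ i, Fintype (S i)]

/-- If the inputs depend on the messages causally, and every terminal can identify the messages one
after the other by tests on the outputs received so far, then there is a code which fails at most
with the probability, computed as if all terminals knew the messages, that some test fails. -/
theorem exists_code_of_tests (W : (∀ j, X j) → PMF (∀ j, Y j)) (q : PMF (∀ i, S i))
    (s₀ : ∀ i, S i) (y₀ : ∀ j, Y j)
    (inp : (ℕ → Fin m → S 0) → Fin (B + K) × Fin n → ∀ j, X j)
    (hinp : ∀ w w' τ (l : Fin (K + 1)), (∀ a : ℕ, a + l ≤ K → w (τ.1 + a) = w' (τ.1 + a)) →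
      inp w τ l = inp w' τ l)
    (test : ∀ j : Fin (K + 1), ℕ → (ℕ → Fin m → S 0) → (Fin m → S j.succ) →
      (Fin (B + K) × Fin n → Y j) → Prop)
    (htest : ∀ (j : Fin (K + 1)) (e : ℕ) (w w' : ℕ → Fin m → S 0) (σ : Fin m → S j.succ)
      (y y' : Fin (B + K) × Fin n → Y j), (∀ e' ≤ e, w e' = w' e') →
      (∀ τ : Fin (B + K) × Fin n, τ.1 + K ≤ e + j → y τ = y' τ) →
      test j e w σ y → test j e w' σ y') :
    ∃ c : Code X Y S (B * m) ((B + K) * n), c.errorProb W q ≤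
      ∑ s : Fin (B * m) → ∀ i, S i, ∑ y : Fin (B + K) × Fin n → ∀ j, Y j,
        if ∀ (j : Fin (K + 1)) (e : ℕ), K ≤ e → e < K + B → Identifies (test j) e
          (block K (s₀ 0) fun k => s k 0) (block K (s₀ j.succ) (fun k => s k j.succ) e)
          (fun τ => y τ j) then 0
        else (∏ k, (q (s k)).toReal) *
          ∏ τ, (W (inp (block K (s₀ 0) fun k => s k 0) τ) (y τ)).toReal := by
  set fp : Fin (B + K) × Fin n ≃ Fin ((B + K) * n) := finProdFinEquiv with hfp
  set w₀ : Fin m → S 0 := fun _ => s₀ 0 with hw₀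
  set msg : (Fin (B * m) → S 0) → ℕ → Fin m → S 0 := block K (s₀ 0) with hmsg
  set est : ∀ j : Fin (K + 1), (Fin (B * m) → S j.succ) → (Fin (B + K) × Fin n → Y j) →
      ℕ → ℕ → Fin m → S 0 := fun j σ y => estimate K B w₀ (test j) (block K (s₀ j.succ) σ) y
    with hest
  set c : Code X Y S (B * m) ((B + K) * n) :=
    { enc := fun s t => inp (msg s) (fp.symm t) 0
      -- In block `b` the input of this relay depends on the messages below index `b + K - i` only.
      -- Their tests read blocks before `b`, so the padding `y₀` for outputs not yet received never
      -- affects them.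
      relay := fun i t y σ => inp (est i.castSucc σ
          (fun τ => if h : fp τ < t then y ⟨fp τ, h⟩ else y₀ i.castSucc)
          ((fp.symm t).1 + K - i)) (fp.symm t) i.succ
      dec := fun y σ k => est (Fin.last K) σ (fun τ => y (fp τ)) (K + B)
          (K + (finProdFinEquiv.symm k).1) (finProdFinEquiv.symm k).2 } with hc
  set Good : (Fin (B * m) → ∀ i, S i) → (Fin ((B + K) * n) → ∀ j, Y j) → Prop := fun s y =>
    ∀ (j : Fin (K + 1)) (e : ℕ), K ≤ e → e < K + B → Identifies (test j) e
      (msg fun k => s k 0) (block K (s₀ j.succ) (fun k => s k j.succ) e)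
      (fun τ => y (fp τ) j) with hGood
  have hestimate : ∀ s y, Good s y → ∀ j e,
      est j (fun k => s k j.succ) (fun τ => y (fp τ) j) e =
        fun e' => if e' < e then msg (fun k => s k 0) e' else w₀ := by
    intro s y hs j e
    exact estimate_eq (fun e w w' σ y h => htest j e w w' σ y y h fun _ _ => rfl)
      (fun e he => block_of_not _ _ he) (hs j) e
  have hinput : ∀ s y, Good s y → ∀ t,
      c.input s y t = inp (msg fun k => s k 0) (fp.symm t) := by
    intro s y hs t
    funext l
    induction l using Fin.cases with
    | zero => rfl
    | succ i =>
      rw [Code.input_succ]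
      change inp (est i.castSucc (fun k => s k i.castSucc.succ) _ _) (fp.symm t) i.succ = _
      have hi := i.2
      have hcong : est i.castSucc (fun k => s k i.castSucc.succ)
          (fun τ => if h : fp τ < t then y (Fin.castLE t.isLt.le ⟨fp τ, h⟩) i.castSucc
            else y₀ i.castSucc) ((fp.symm t).1 + K - i) =
          est i.castSucc (fun k => s k i.castSucc.succ) (fun τ => y (fp τ) i.castSucc)
            ((fp.symm t).1 + K - i) := by
        refine estimate_congr _ fun e' he' w => ?_
        have hag : ∀ τ : Fin (B + K) × Fin n, (τ.1 : ℕ) + K ≤ e' + (i.castSucc : Fin (K + 1)) →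
            (if h : fp τ < t then y (Fin.castLE t.isLt.le ⟨fp τ, h⟩) i.castSucc
              else y₀ i.castSucc) = y (fp τ) i.castSucc := by
          intro τ hτ
          rw [Fin.val_castSucc] at hτ
          have hlt : (τ.1 : ℕ) < (fp.symm t).1 := by omega
          have hft : fp τ < t := by
            rw [← fp.apply_symm_apply t, Fin.lt_def]
            simp only [hfp, finProdFinEquiv_apply_val]
            have h1 := τ.2.2
            have h2 : n * ((τ.1 : ℕ) + 1) ≤ n * ((fp.symm t).1 : ℕ) := Nat.mul_le_mul_left n hlt
            rw [mul_add, mul_one] at h2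
            simp only [hfp] at h2
            omega
          rw [dif_pos hft]
          rfl
        exact ⟨htest _ _ _ _ _ _ _ (fun _ _ => rfl) hag,
          htest _ _ _ _ _ _ _ (fun _ _ => rfl) fun τ hτ => (hag τ hτ).symm⟩
      refine Eq.trans (congrArg (fun w => inp w (fp.symm t) i.succ)
        (hcong.trans (hestimate s y hs _ _))) ?_
      refine hinp _ _ _ _ fun a ha => ?_
      rw [Fin.val_succ] at ha
      exact if_pos (by omega)
  have hcorrect : ∀ s y, Good s y → c.Correct s y := by
    intro s y hs
    funext k
    change est (Fin.last K) (fun k => s k (Fin.last K).succ) (fun τ => y (fp τ) (Fin.last K))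
      (K + B) (K + (finProdFinEquiv.symm k).1) (finProdFinEquiv.symm k).2 = s k 0
    rw [hestimate s y hs]
    have hb := (finProdFinEquiv.symm k).1.2
    simp only [show K + ((finProdFinEquiv.symm k).1 : ℕ) < K + B by omega, if_true, hmsg]
    rw [block_add, Prod.mk.eta, Equiv.apply_symm_apply]
  have hY : Nonempty (∀ j, Y j) := ⟨y₀⟩
  set ideal : (Fin (B * m) → ∀ i, S i) → (Fin ((B + K) * n) → ∀ j, Y j) → ℝ := fun s y =>
    (∏ k, (q (s k)).toReal) * ∏ t, (W (inp (msg fun k => s k 0) (fp.symm t)) (y t)).toReal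
    with hideal
  have hlaw : ∀ s y, Good s y → c.law W q s y = ideal s y := by
    intro s y hs
    simp only [Code.law, hideal, hinput s y hs]
  have hsum : ∑ s, ∑ y, ideal s y = 1 := by
    rw [← sum_prod_pmf q (B * m)]
    refine Finset.sum_congr rfl fun s _ => ?_
    simp only [hideal]
    rw [← Finset.mul_sum, ← Fintype.prod_sum fun t y =>
      (W (inp (msg fun k => s k 0) (fp.symm t)) y).toReal]
    simp [sum_toReal_pmf]
  -- The true and the ideal law agree on `Good` and both have total mass one, hence they give the
  -- complement the same probability. This avoids an analysis of error propagation.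
  have hsplit : ∀ f : (Fin (B * m) → ∀ i, S i) → (Fin ((B + K) * n) → ∀ j, Y j) → ℝ,
      ∑ s, ∑ y, f s y = ∑ s, ∑ y, (if Good s y then f s y else 0) +
        ∑ s, ∑ y, if Good s y then 0 else f s y := by
    intro f
    simp only [← Finset.sum_add_distrib]
    refine Finset.sum_congr rfl fun s _ => Finset.sum_congr rfl fun y _ => ?_
    split_ifs <;> simp
  have h1 := hsplit (c.law W q)
  have h2 := hsplit ideal
  rw [c.sum_law W q] at h1
  rw [hsum] at h2
  have h3 : ∑ s, ∑ y, (if Good s y then c.law W q s y else 0) =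
      ∑ s, ∑ y, if Good s y then ideal s y else 0 := by
    refine Finset.sum_congr rfl fun s _ => Finset.sum_congr rfl fun y _ => ?_
    split_ifs with h
    · exact hlaw s y h
    · rfl
  refine ⟨c, ?_⟩
  calc c.errorProb W q = ∑ s, ∑ y, if c.Correct s y then 0 else c.law W q s y :=
        c.errorProb_eq_sum W q
    _ ≤ ∑ s, ∑ y, if Good s y then 0 else c.law W q s y := by
        refine Finset.sum_le_sum fun s _ => Finset.sum_le_sum fun y _ => ?_
        by_cases h : Good s y
        · rw [if_pos h, if_pos (hcorrect s y h)]
        · rw [if_neg h]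
          split_ifs
          · exact c.law_nonneg W q s y
          · exact le_rfl
    _ = ∑ s, ∑ y, if Good s y then 0 else ideal s y := by linarith
    _ = _ := by
        refine Finset.sum_congr rfl fun s _ => ?_
        rw [← (Equiv.arrowCongr fp (Equiv.refl (∀ j, Y j))).sum_comp]
        refine Finset.sum_congr rfl fun y _ => ?_
        have e1 : ∀ τ, (Equiv.arrowCongr fp (Equiv.refl (∀ j, Y j))) y (fp τ) = y τ := fun τ => by
          simp
        simp only [hGood, hideal, e1]
        refine if_congr Iff.rfl rfl ?_
        congr 1
        rw [← fp.prod_comp]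
        simp

end BlockCode

/-! ### Achievability -/

section Achievability

variable {K : ℕ} {X Y : Fin (K + 1) → Type*} {S : Fin (K + 2) → Type*}
  [∀ j, Fintype (X j)] [∀ j, Fintype (Y j)] [∀ i, Fintype (S i)]
  (W : (∀ j, X j) → PMF (∀ j, Y j)) (p : PMF (∀ j, X j)) (x₀ : ∀ j, X j) (q : PMF (∀ i, S i))
  (j : Fin (K + 1))

/-- The negative moment of the conditional probability of a source letter. -/
def sourceMoment (l : ℝ) : ℝ := ∑ s, (q s).toReal * condSource q j (s 0) (s j.succ) ^ (-l)

/-- Distance from `e` matches the window blocks with the levels `K - j, …, K`. The bounds on `e`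
keep the whole window inside the transmission. -/
lemma sum_inWindow {N e : ℕ} (he : K ≤ e) (heN : e < N) (f : ℕ → ℝ) :
    ∑ c : Fin N, (if InWindow j e c then f (e - c) else 0) =
      ∑ a ∈ Finset.Ico (K - j : ℕ) (K + 1), f a := by
  have hj := j.2
  have h := Finset.sum_range (n := N) fun c => if InWindow j e c then f (e - c) else 0
  rw [← h, ← Finset.sum_filter]
  refine Finset.sum_nbij' (fun c => e - c) (fun a => e - a) ?_ ?_ ?_ ?_ ?_
  · intro c hc
    rw [Finset.mem_filter, Finset.mem_range, InWindow] at hc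
    rw [Finset.mem_Ico]
    omega
  · intro a ha
    rw [Finset.mem_Ico] at ha
    rw [Finset.mem_filter, Finset.mem_range, InWindow]
    omega
  · intro c hc
    rw [Finset.mem_filter, Finset.mem_range, InWindow] at hc
    omega
  · intro a ha
    rw [Finset.mem_Ico] at ha
    omega
  · intro c _
    rfl

/-- Each of the `j + 1` window blocks contributes `n` equal factors, one level per block; the
exponents add up by the chain rule, at a loss of `ε` per level. -/
lemma prod_windowMoment_le {N n e : ℕ} (he : K ≤ e) (heN : e < N) {l ε : ℝ}
    (hl : ∀ a ∈ Finset.Ico (K - j : ℕ) (K + 1),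
      letterExp W p x₀ j (fun u b => levelDensity W p x₀ j a u b ^ (-l)) ≤
        Real.exp (-l * (letterExp W p x₀ j
          (fun u b => Real.log (levelDensity W p x₀ j a u b)) - ε))) :
    ∏ τ : Fin N × Fin n, windowMoment W p x₀ j l e τ.1 ≤
      Real.exp (-l * (n * (cutInfo W p j - (j + 1) * ε))) := by
  have hj := j.2
  set f : ℕ → ℝ := fun a => letterExp W p x₀ j
    (fun u b => Real.log (levelDensity W p x₀ j a u b)) - ε with hf
  have h1 : ∀ c : Fin N, windowMoment W p x₀ j l e c ≤
      Real.exp (-l * (if InWindow j e c then f (e - c) else 0)) := by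
    intro c
    rw [windowMoment]
    split_ifs with h
    · refine hl _ (Finset.mem_Ico.2 ?_)
      simp only [InWindow] at h
      omega
    · simp
  have h0 : ∀ c : ℕ, 0 ≤ windowMoment W p x₀ j l e c := by
    intro c
    rw [windowMoment]
    split_ifs
    · exact Finset.sum_nonneg fun ub _ => mul_nonneg (mul_nonneg
        (prodWeight_nonneg (letterWeight_nonneg p) _) (outProb_nonneg _ _ _ _))
        (Real.rpow_nonneg (levelDensity_nonneg _ _ _ _ _ _ _) _)
    · exact zero_le_one
  refine (Finset.prod_le_prod (fun τ _ => h0 τ.1) fun τ _ => h1 τ.1).trans (le_of_eq ?_)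
  rw [← Real.exp_sum, ← Finset.mul_sum, Fintype.sum_prod_type]
  simp only [Finset.sum_const, Finset.card_univ, Fintype.card_fin, nsmul_eq_mul]
  rw [← Finset.mul_sum, sum_inWindow j he heN f]
  simp only [hf]
  rw [Finset.sum_sub_distrib, sum_letterExp_log_levelDensity]
  simp only [Finset.sum_const, Nat.card_Ico, nsmul_eq_mul]
  rw [show K + 1 - (K - (j : ℕ)) = j + 1 by omega]
  push_cast
  rfl

/-- The exponent `l` must suit both the channel and the source moments and stay fixed as `n` grows;
both estimates hold near zero, so a common small `l` exists. -/
lemma exists_threshold {r : ℝ} (hr : 0 < r)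
    (h : r * condEntropy q (fun s => s 0) (fun s => s j.succ) < cutInfo W p j) :
    ∃ (l : ℝ) (θ err : ℕ → ℝ), 0 < l ∧ (∀ n, 0 < θ n) ∧ Tendsto err atTop (𝓝 0) ∧
      ∀ (n m B e : ℕ), (m : ℝ) ≤ r * n + 1 → K ≤ e → e < K + B →
        θ n ^ l * sourceMoment q j l ^ m *
          ∏ τ : Fin (B + K) × Fin n, windowMoment W p x₀ j l e τ.1 + (θ n)⁻¹ ≤ err n := by
  set H := condEntropy q (fun s => s 0) (fun s => s j.succ) with hH
  have hH0 : 0 ≤ H := condEntropy_nonneg _ _ _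
  set D := cutInfo W p j - r * H with hD
  have hD0 : 0 < D := sub_pos.2 h
  have hJ : (0 : ℝ) < j + 1 + r := by positivity
  -- The slacks of the `j + 1` channel levels and of about `r` source letters per channel use add up
  -- to `D / 4`; the threshold `exp (n D / 4)` costs another quarter, which leaves the exponent `l D
  -- / 2`.
  set ε := D / (4 * (j + 1 + r)) with hε
  have hε0 : 0 < ε := by positivity
  have hεD : (j + 1 + r) * ε = D / 4 := by rw [hε]; field_simp
  have ev1 := (Finset.eventually_all (Finset.Ico (K - j : ℕ) (K + 1))).2 fun a _ =>
    eventually_letterExp_rpow_neg_le W p x₀ j a hε0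
  have ev2 := eventually_sum_rpow_neg_le (μ := fun s : ∀ i, S i => (q s).toReal)
    (f := fun s => condSource q j (s 0) (s j.succ)) (fun _ => ENNReal.toReal_nonneg)
    (sum_toReal_pmf q) (fun s hs => condSource_pos q j hs) hε0
  obtain ⟨l, ⟨hl1, hl2⟩, hl0⟩ := ((ev1.and ev2).and self_mem_nhdsWithin).exists
  have hl0' : 0 < l := hl0
  have hsrc : sourceMoment q j l ≤ Real.exp (l * (H + ε)) := by
    refine hl2.trans (le_of_eq ?_)
    rw [hH, condEntropy_source]
    simp only [mul_neg, Finset.sum_neg_distrib]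
    congr 1
    ring
  have hsrc0 : 0 ≤ sourceMoment q j l := Finset.sum_nonneg fun s _ =>
    mul_nonneg ENNReal.toReal_nonneg (Real.rpow_nonneg (condSource_nonneg _ _ _ _) _)
  refine ⟨l, fun n => Real.exp (D / 4 * n), fun n => Real.exp (l * (H + ε)) *
    Real.exp (-(l * D / 2 * n)) + Real.exp (-(D / 4 * n)), hl0', fun n => Real.exp_pos _, ?_, ?_⟩
  · have t : ∀ κ : ℝ, 0 < κ → Tendsto (fun n : ℕ => Real.exp (-(κ * n))) atTop (𝓝 0) := by
      intro κ hκ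
      exact Real.tendsto_exp_neg_atTop_nhds_zero.comp
        (tendsto_natCast_atTop_atTop.const_mul_atTop hκ)
    simpa using ((t (l * D / 2) (by positivity)).const_mul (Real.exp (l * (H + ε)))).add
      (t (D / 4) (by positivity))
  · intro n m B e hm he heB
    rw [← Real.exp_neg]
    refine add_le_add ?_ le_rfl
    have hw := prod_windowMoment_le W p x₀ j (n := n) he (show e < B + K by omega) hl1
    have hs : sourceMoment q j l ^ m ≤ Real.exp (l * (H + ε) * m) := by
      refine (pow_le_pow_left₀ hsrc0 hsrc m).trans (le_of_eq ?_)
      rw [← Real.exp_nat_mul]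
      congr 1
      ring
    rw [← Real.exp_mul]
    calc _ ≤ Real.exp (D / 4 * n * l) * Real.exp (l * (H + ε) * m) *
          Real.exp (-l * (n * (cutInfo W p j - (j + 1) * ε))) := by
          refine mul_le_mul (mul_le_mul_of_nonneg_left hs (Real.exp_pos _).le) hw ?_ (by positivity)
          refine Finset.prod_nonneg fun τ _ => ?_
          rw [windowMoment]
          split_ifs
          · exact Finset.sum_nonneg fun ub _ => mul_nonneg (mul_nonneg
              (prodWeight_nonneg (letterWeight_nonneg p) _) (outProb_nonneg _ _ _ _))
              (Real.rpow_nonneg (levelDensity_nonneg _ _ _ _ _ _ _) _)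
          · exact zero_le_one
      _ ≤ _ := by
          rw [← Real.exp_add, ← Real.exp_add, ← Real.exp_add, Real.exp_le_exp]
          have h1 : l * (H + ε) * m ≤ l * (H + ε) * (r * n + 1) :=
            mul_le_mul_of_nonneg_left hm (by positivity)
          have h2 : cutInfo W p j = D + r * H := by rw [hD]; ring
          have h3 : l * n * ((j + 1 + r) * ε) = l * n * (D / 4) := by rw [hεD]
          rw [h2]
          nlinarith

/-! ### Decoding tests and the selection of a codebook -/

variable {B m n : ℕ}

/-- The conditional probability of a source block given the block of the side information. -/
def blockScore (σ : Fin m → S j.succ) (v : Fin m → S 0) : ℝ := ∏ k, condSource q j (v k) (σ k)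

lemma sum_blockScore_le (σ : Fin m → S j.succ) : ∑ v, blockScore q j σ v ≤ 1 := by
  simp only [blockScore]
  rw [← Fintype.prod_sum fun k a => condSource q j a (σ k)]
  exact Finset.prod_le_one (fun k _ => Finset.sum_nonneg fun a _ => condSource_nonneg _ _ _ _)
    fun k _ => sum_condSource_le q j (σ k)

lemma blockScore_nonneg (σ : Fin m → S j.succ) (v : Fin m → S 0) : 0 ≤ blockScore q j σ v :=
  Finset.prod_nonneg fun _ _ => condSource_nonneg _ _ _ _

/-- The test used by `T_{j+1}`. If its side information determines the source it is based on this
alone, otherwise on the metric. -/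
def decodeTest (θ : ℝ) (C : Fin (B + K) × Fin n → Fin (K + 1) × (Fin m → S 0) → Letter X) (e : ℕ)
    (w : ℕ → Fin m → S 0) (σ : Fin m → S j.succ) (y : Fin (B + K) × Fin n → Y j) : Prop :=
  if condEntropy q (fun s => s 0) (fun s => s j.succ) = 0 then
    ∀ k, 0 < condSource q j (w e k) (σ k)
  else θ ≤ metric W p x₀ C (blockScore q j σ) j e w y

/-- A window factor at level `e - c` involves only letters up to that level, which carry messages up
to `e`, and the window ends with block `e + j - K`. This is the causality required by
`exists_code_of_tests`. -/
lemma decodeTest_congr {θ : ℝ}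
    {C : Fin (B + K) × Fin n → Fin (K + 1) × (Fin m → S 0) → Letter X} {e : ℕ}
    {w w' : ℕ → Fin m → S 0} {σ : Fin m → S j.succ} {y y' : Fin (B + K) × Fin n → Y j}
    (hw : ∀ e' ≤ e, w e' = w' e')
    (hy : ∀ τ : Fin (B + K) × Fin n, τ.1 + K ≤ e + j → y τ = y' τ)
    (h : decodeTest W p x₀ q j θ C e w σ y) : decodeTest W p x₀ q j θ C e w' σ y' := by
  rw [decodeTest] at h ⊢
  split_ifs at h ⊢
  · rwa [← hw e le_rfl]
  · refine h.trans (le_of_eq ?_)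
    rw [metric, metric, hw e le_rfl]
    congr 1
    refine Finset.prod_congr rfl fun τ _ => ?_
    rw [windowDensity, windowDensity]
    split_ifs with hτ
    · simp only [InWindow] at hτ
      rw [hy τ (by omega)]
      refine levelDensity_congr W p x₀ j _ (fun k hk => ?_) _
      rw [letters, letters, hw _ (by omega)]
    · rfl

lemma inputOf_letters_congr (C : Fin (B + K) × Fin n → Fin (K + 1) × (Fin m → S 0) → Letter X)
    (w w' : ℕ → Fin m → S 0) (τ : Fin (B + K) × Fin n) (l : Fin (K + 1))
    (h : ∀ a : ℕ, a + l ≤ K → w (τ.1 + a) = w' (τ.1 + a)) :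
    inputOf x₀ (letters C w τ) l = inputOf x₀ (letters C w' τ) l :=
  inputOf_congr x₀ l fun k hk => by rw [letters, letters, h k hk]

lemma condSource_eq_one (hH : condEntropy q (fun s => s 0) (fun s => s j.succ) = 0)
    {s : ∀ i, S i} (hs : 0 < (q s).toReal) : condSource q j (s 0) (s j.succ) = 1 := by
  rw [condEntropy_source, Finset.sum_eq_zero_iff_of_nonneg] at hH
  · have h := hH s (Finset.mem_univ s)
    rw [mul_eq_zero, neg_eq_zero] at h
    have hpos := condSource_pos q j hs
    rcases h with h | h
    · exact absurd h hs.ne'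
    · exact Real.eq_one_of_pos_of_log_eq_zero hpos h
  · intro s _
    exact mul_nonneg ENNReal.toReal_nonneg (neg_nonneg.2
      (Real.log_nonpos (condSource_nonneg _ _ _ _) (condSource_le_one _ _ _ _)))

/-- The conditional probabilities given a side information letter sum to at most one, so next to a
letter of probability one no other is possible. Such a terminal needs no channel information, as it
must since its cut may carry none. -/
lemma identifies_of_condEntropy_eq_zero
    (hH : condEntropy q (fun s => s 0) (fun s => s j.succ) = 0) (θ : ℝ)
    (C : Fin (B + K) × Fin n → Fin (K + 1) × (Fin m → S 0) → Letter X) (e : ℕ)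
    (w : ℕ → Fin m → S 0) (σ : Fin m → S j.succ) (y : Fin (B + K) × Fin n → Y j)
    (h : ∀ k, condSource q j (w e k) (σ k) = 1) :
    Identifies (decodeTest W p x₀ q j θ C) e w σ y := by
  refine ⟨?_, fun w₁ hw₁ => ?_⟩
  · rw [decodeTest, if_pos hH]
    intro k
    rw [h k]
    exact zero_lt_one
  · rw [decodeTest, if_pos hH]
    intro h'
    obtain ⟨k, hk⟩ := Function.ne_iff.1 hw₁
    have h1 := h' k
    rw [Function.update_self] at h1
    have h2 : condSource q j (w₁ k) (σ k) + condSource q j (w e k) (σ k) ≤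
        ∑ a, condSource q j a (σ k) := by
      rw [← Finset.sum_pair (f := fun a => condSource q j a (σ k)) hk]
      exact Finset.sum_le_sum_of_subset_of_nonneg (Finset.subset_univ _)
        fun a _ _ => condSource_nonneg _ _ _ _
    have h3 := sum_condSource_le q j (σ k)
    rw [h k] at h2
    linarith

/-- A block consists of `m` distinct i.i.d. samples, so the moment of its score is a power. -/
lemma sum_prod_blockScore_rpow (s₀ : ∀ i, S i) (l : ℝ) {e : ℕ} (he : K ≤ e) (heB : e < K + B) :
    ∑ s : Fin (B * m) → ∀ i, S i, (∏ k, (q (s k)).toReal) *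
      blockScore q j (block K (s₀ j.succ) (fun k => s k j.succ) e)
        (block K (s₀ 0) (fun k => s k 0) e) ^ (-l) = sourceMoment q j l ^ m := by
  obtain ⟨b, rfl⟩ : ∃ b : Fin B, e = K + b := ⟨⟨e - K, by omega⟩, by simp; omega⟩
  simp only [blockScore, block_add]
  have h := sum_prod_comp_injective (I := Fin (B * m)) (J := Fin m)
    (π := fun _ (s : ∀ i, S i) => (q s).toReal) (fun _ => sum_toReal_pmf q)
    (e := fun k => finProdFinEquiv (b, k))
    (fun k k' hk => (Prod.mk.inj (finProdFinEquiv.injective hk)).2)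
    (fun v => (∏ k, condSource q j (v k 0) (v k j.succ)) ^ (-l))
  refine h.trans ?_
  simp only [← Real.finsetProd_rpow _ _ fun _ _ => condSource_nonneg _ _ _ _,
    ← Finset.prod_mul_distrib]
  rw [← Fintype.prod_sum fun (_ : Fin m) (s : ∀ i, S i) =>
    (q s).toReal * condSource q j (s 0) (s j.succ) ^ (-l)]
  simp [sourceMoment]

/-- The average over the codebooks and the sources of the probability that a test fails. -/
lemma sum_bookWeight_not_identifies_le (s₀ : ∀ i, S i) {θ l err : ℝ} (hθ : 0 < θ) (hl : 0 < l)
    (herr : 0 ≤ err) {e : ℕ} (he : K ≤ e) (heB : e < K + B)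
    (h : condEntropy q (fun s => s 0) (fun s => s j.succ) ≠ 0 →
      θ ^ l * sourceMoment q j l ^ m *
        ∏ τ : Fin (B + K) × Fin n, windowMoment W p x₀ j l e τ.1 + θ⁻¹ ≤ err) :
    ∑ C : Fin (B + K) × Fin n → Fin (K + 1) × (Fin m → S 0) → Letter X, bookWeight p C *
      ∑ s : Fin (B * m) → ∀ i, S i, (∏ k, (q (s k)).toReal) *
        ∑ y, idealProb W x₀ C (block K (s₀ 0) fun k => s k 0) y *
          (if Identifies (decodeTest W p x₀ q j θ C) e (block K (s₀ 0) fun k => s k 0)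
            (block K (s₀ j.succ) (fun k => s k j.succ) e) (fun τ => y τ j) then 0 else 1) ≤ err := by
  obtain ⟨b, hb⟩ : ∃ b : Fin B, e = K + b := ⟨⟨e - K, by omega⟩, by simp; omega⟩
  by_cases hH : condEntropy q (fun s => s 0) (fun s => s j.succ) = 0
  · refine le_trans (le_of_eq ?_) herr
    refine Finset.sum_eq_zero fun C _ => mul_eq_zero_of_right _ (Finset.sum_eq_zero fun s _ => ?_)
    rw [mul_eq_zero]
    by_cases hs : ∏ k, (q (s k)).toReal = 0
    · exact Or.inl hs
    · refine Or.inr (Finset.sum_eq_zero fun y _ => mul_eq_zero_of_right _ (if_pos ?_))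
      refine identifies_of_condEntropy_eq_zero W p x₀ q j hH θ C e _ _ _ fun k => ?_
      subst hb
      rw [block_add, block_add]
      refine condSource_eq_one q j hH (lt_of_le_of_ne ENNReal.toReal_nonneg fun h0 => hs ?_)
      exact Finset.prod_eq_zero (Finset.mem_univ _) h0.symm
  · refine le_trans ?_ (h hH)
    have pt : ∀ s : Fin (B * m) → ∀ i, S i, (∏ k, (q (s k)).toReal) *
        ∑ C : Fin (B + K) × Fin n → Fin (K + 1) × (Fin m → S 0) → Letter X, bookWeight p C *
        ∑ y, idealProb W x₀ C (block K (s₀ 0) fun k => s k 0) y *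
          (if Identifies (decodeTest W p x₀ q j θ C) e (block K (s₀ 0) fun k => s k 0)
            (block K (s₀ j.succ) (fun k => s k j.succ) e) (fun τ => y τ j) then 0 else 1) ≤
        (∏ k, (q (s k)).toReal) * (θ ^ l * blockScore q j
          (block K (s₀ j.succ) (fun k => s k j.succ) e) (block K (s₀ 0) (fun k => s k 0) e) ^ (-l) *
            ∏ τ : Fin (B + K) × Fin n, windowMoment W p x₀ j l e τ.1 + θ⁻¹) := by
      intro s
      by_cases hs : ∏ k, (q (s k)).toReal = 0
      · rw [hs, zero_mul, zero_mul]
      refine mul_le_mul_of_nonneg_left ?_ (Finset.prod_nonneg fun _ _ => ENNReal.toReal_nonneg)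
      have hpos : 0 < blockScore q j (block K (s₀ j.succ) (fun k => s k j.succ) e)
          (block K (s₀ 0) (fun k => s k 0) e) := by
        refine Finset.prod_pos fun k _ => ?_
        subst hb
        rw [block_add, block_add]
        refine condSource_pos q j (lt_of_le_of_ne ENNReal.toReal_nonneg fun h0 => hs ?_)
        exact Finset.prod_eq_zero (Finset.mem_univ _) h0.symm
      refine le_trans (le_of_eq ?_) (sum_bookWeight_metricFails_le W p x₀ j
        (blockScore_nonneg q j _) (sum_blockScore_le q j _) hθ hl e _ hpos)
      refine Finset.sum_congr rfl fun C _ => ?_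
      congr 1
      refine Finset.sum_congr rfl fun y _ => ?_
      congr 1
      have hiff : MetricFails W p x₀ j C
          (blockScore q j (block K (s₀ j.succ) (fun k => s k j.succ) e)) θ e
          (block K (s₀ 0) fun k => s k 0) (fun τ => y τ j) ↔
          ¬ Identifies (decodeTest W p x₀ q j θ C) e (block K (s₀ 0) fun k => s k 0)
            (block K (s₀ j.succ) (fun k => s k j.succ) e) (fun τ => y τ j) := by
        simp only [MetricFails, Identifies, decodeTest, hH, if_false]
        rw [not_and_or]
        push Not
        rfl
      by_cases hf : Identifies (decodeTest W p x₀ q j θ C) e (block K (s₀ 0) fun k => s k 0)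
            (block K (s₀ j.succ) (fun k => s k j.succ) e) (fun τ => y τ j)
      · rw [if_pos hf, if_neg fun h => (hiff.1 h) hf]
      · rw [if_neg hf, if_pos (hiff.2 hf)]
    calc _ = ∑ s : Fin (B * m) → ∀ i, S i, (∏ k, (q (s k)).toReal) *
        ∑ C : Fin (B + K) × Fin n → Fin (K + 1) × (Fin m → S 0) → Letter X, bookWeight p C *
        ∑ y, idealProb W x₀ C (block K (s₀ 0) fun k => s k 0) y *
          (if Identifies (decodeTest W p x₀ q j θ C) e (block K (s₀ 0) fun k => s k 0)
            (block K (s₀ j.succ) (fun k => s k j.succ) e) (fun τ => y τ j) then 0 else 1) := by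
          simp only [Finset.mul_sum (s := (Finset.univ : Finset (Fin (B * m) → ∀ i, S i)))]
          rw [Finset.sum_comm]
          refine Finset.sum_congr rfl fun s _ => ?_
          rw [Finset.mul_sum]
          refine Finset.sum_congr rfl fun C _ => ?_
          ring
      _ ≤ _ := Finset.sum_le_sum fun s _ => pt s
      _ = _ := by
          simp only [mul_add, Finset.sum_add_distrib, ← Finset.sum_mul, sum_prod_pmf, one_mul]
          rw [← sum_prod_blockScore_rpow q j s₀ l he heB (m := m), Finset.mul_sum, Finset.sum_mul]
          congr 1
          refine Finset.sum_congr rfl fun s _ => ?_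
          ring

lemma exists_le_of_sum_weight_le {I : Type*} [Fintype I] {μ f : I → ℝ} {b : ℝ}
    (h0 : ∀ i, 0 ≤ μ i) (h1 : ∑ i, μ i = 1) (h : ∑ i, μ i * f i ≤ b) : ∃ i, f i ≤ b := by
  by_contra! hf
  obtain ⟨i, -, hi⟩ : ∃ i ∈ Finset.univ, μ i ≠ 0 := by
    by_contra! hall
    rw [Finset.sum_eq_zero hall] at h1
    exact zero_ne_one h1
  have : ∑ i, μ i * b < ∑ i, μ i * f i :=
    Finset.sum_lt_sum (fun i _ => mul_le_mul_of_nonneg_left (hf i).le (h0 i))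
      ⟨i, Finset.mem_univ i, mul_lt_mul_of_pos_left (hf i)
        (lt_of_le_of_ne (h0 i) (Ne.symm hi))⟩
  rw [← Finset.sum_mul, h1, one_mul] at this
  linarith

/-- The union bound over terminals and source blocks is taken before the codebook is fixed, so one
codebook of at most average cost works for all of them. -/
theorem exists_code_errorProb_le (s₀ : ∀ i, S i) {θ l err : Fin (K + 1) → ℝ}
    (hθ : ∀ j, 0 < θ j) (hl : ∀ j, 0 < l j) (herr : ∀ j, 0 ≤ err j)
    (h : ∀ (j : Fin (K + 1)) (e : ℕ), K ≤ e → e < K + B →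
      condEntropy q (fun s => s 0) (fun s => s j.succ) ≠ 0 →
      θ j ^ l j * sourceMoment q j (l j) ^ m *
        ∏ τ : Fin (B + K) × Fin n, windowMoment W p x₀ j (l j) e τ.1 + (θ j)⁻¹ ≤ err j) :
    ∃ c : Code X Y S (B * m) ((B + K) * n), c.errorProb W q ≤ B * ∑ j, err j := by
  obtain ⟨y₀⟩ := exists_of_pmf (W x₀)
  set bad : (Fin (B + K) × Fin n → Fin (K + 1) × (Fin m → S 0) → Letter X) → Fin (K + 1) → ℕ →
      (Fin (B * m) → ∀ i, S i) → (Fin (B + K) × Fin n → ∀ j, Y j) → ℝ := fun C j e s y =>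
    if Identifies (decodeTest W p x₀ q j (θ j) C) e (block K (s₀ 0) fun k => s k 0)
      (block K (s₀ j.succ) (fun k => s k j.succ) e) (fun τ => y τ j) then 0 else 1 with hbad
  set F : (Fin (B + K) × Fin n → Fin (K + 1) × (Fin m → S 0) → Letter X) → ℝ := fun C =>
    ∑ j, ∑ e ∈ Finset.Ico K (K + B), ∑ s : Fin (B * m) → ∀ i, S i, (∏ k, (q (s k)).toReal) *
      ∑ y, idealProb W x₀ C (block K (s₀ 0) fun k => s k 0) y * bad C j e s y with hF
  have havg : ∑ C, bookWeight p C * F C ≤ B * ∑ j, err j := by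
    have e1 : ∑ C, bookWeight p C * F C = ∑ j, ∑ e ∈ Finset.Ico K (K + B), ∑ C, bookWeight p C *
        ∑ s : Fin (B * m) → ∀ i, S i, (∏ k, (q (s k)).toReal) *
        ∑ y, idealProb W x₀ C (block K (s₀ 0) fun k => s k 0) y * bad C j e s y := by
      simp only [hF]
      rw [Finset.sum_congr rfl fun C _ => Finset.mul_sum _ _ _, Finset.sum_comm]
      refine Finset.sum_congr rfl fun j _ => ?_
      rw [Finset.sum_congr rfl fun C _ => Finset.mul_sum _ _ _, Finset.sum_comm]
    rw [e1, Finset.mul_sum]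
    refine Finset.sum_le_sum fun j _ => ?_
    calc _ ≤ ∑ e ∈ Finset.Ico K (K + B), err j := by
          refine Finset.sum_le_sum fun e he => ?_
          rw [Finset.mem_Ico] at he
          exact sum_bookWeight_not_identifies_le W p x₀ q j s₀ (hθ j) (hl j) (herr j) he.1 he.2
            (h j e he.1 he.2)
      _ = _ := by simp
  obtain ⟨C, hC⟩ := exists_le_of_sum_weight_le (bookWeight_nonneg p) (sum_bookWeight p) havg
  obtain ⟨c, hc⟩ := exists_code_of_tests W q s₀ y₀ (fun w τ => inputOf x₀ (letters C w τ))
    (inputOf_letters_congr x₀ C) (fun j => decodeTest W p x₀ q j (θ j) C)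
    (fun j e w w' σ y y' hw hy => decodeTest_congr W p x₀ q j hw hy)
  refine ⟨c, hc.trans (le_trans ?_ hC)⟩
  have e2 : F C = ∑ s : Fin (B * m) → ∀ i, S i, ∑ y, ∑ j, ∑ e ∈ Finset.Ico K (K + B),
      (∏ k, (q (s k)).toReal) * (idealProb W x₀ C (block K (s₀ 0) fun k => s k 0) y *
        bad C j e s y) := by
    simp only [hF, Finset.mul_sum (s := (Finset.univ : Finset (Fin (B + K) × Fin n → ∀ j, Y j)))]
    rw [Finset.sum_congr rfl fun j _ => Finset.sum_comm, Finset.sum_comm]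
    refine Finset.sum_congr rfl fun s _ => ?_
    rw [Finset.sum_congr rfl fun j _ => Finset.sum_comm, Finset.sum_comm]
  rw [e2]
  refine Finset.sum_le_sum fun s _ => Finset.sum_le_sum fun y _ => ?_
  have hnn : ∀ j e, 0 ≤ (∏ k, (q (s k)).toReal) *
      (idealProb W x₀ C (block K (s₀ 0) fun k => s k 0) y * bad C j e s y) := by
    intro j e
    refine mul_nonneg (Finset.prod_nonneg fun _ _ => ENNReal.toReal_nonneg)
      (mul_nonneg (idealProb_nonneg _ _ _ _ _) ?_)
    simp only [hbad]
    split_ifs <;> simp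
  split_ifs with hgood
  · exact Finset.sum_nonneg fun j _ => Finset.sum_nonneg fun e _ => hnn j e
  · push Not at hgood
    obtain ⟨j, e, he, heB, hne⟩ := hgood
    refine le_trans (le_of_eq ?_) ((Finset.single_le_sum (f := fun e => (∏ k, (q (s k)).toReal) *
      (idealProb W x₀ C (block K (s₀ 0) fun k => s k 0) y * bad C j e s y)) (fun e _ => hnn j e)
      (Finset.mem_Ico.2 ⟨he, heB⟩)).trans (Finset.single_le_sum (f := fun j =>
        ∑ e ∈ Finset.Ico K (K + B), (∏ k, (q (s k)).toReal) *
      (idealProb W x₀ C (block K (s₀ 0) fun k => s k 0) y * bad C j e s y))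
      (fun j _ => Finset.sum_nonneg fun e _ => hnn j e) (Finset.mem_univ j)))
    simp only [hbad]
    rw [if_neg hne, mul_one]
    rfl

/-- The number `B` of source blocks stays fixed while the block length grows. The gap between `r`
and `r'` pays for the `K` extra transmission blocks, and the error is at most `B` times a null
sequence. -/
theorem achievable_of_lt {r : ℝ≥0} {r' : ℝ} (hr : (r : ℝ) < r')
    (h : ∀ j : Fin (K + 1), condEntropy q (fun s => s 0) (fun s => s j.succ) ≠ 0 →
      r' * condEntropy q (fun s => s 0) (fun s => s j.succ) < cutInfo W p j) :
    Achievable W q r := by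
  obtain ⟨x₀⟩ := exists_of_pmf p
  obtain ⟨s₀⟩ := exists_of_pmf q
  have hr'0 : 0 < r' := lt_of_le_of_lt r.2 hr
  have hth : ∀ j : Fin (K + 1), ∃ (l : ℝ) (θ err : ℕ → ℝ), 0 < l ∧ (∀ n, 0 < θ n) ∧
      Tendsto err atTop (𝓝 0) ∧ (∀ n, 0 ≤ err n) ∧
      ∀ (n m B e : ℕ), (m : ℝ) ≤ r' * n + 1 → K ≤ e → e < K + B →
        condEntropy q (fun s => s 0) (fun s => s j.succ) ≠ 0 →
        θ n ^ l * sourceMoment q j l ^ m *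
          ∏ τ : Fin (B + K) × Fin n, windowMoment W p x₀ j l e τ.1 + (θ n)⁻¹ ≤ err n := by
    intro j
    by_cases hH : condEntropy q (fun s => s 0) (fun s => s j.succ) = 0
    · exact ⟨1, fun _ => 1, fun _ => 0, one_pos, fun _ => one_pos, tendsto_const_nhds,
        fun _ => le_rfl, fun _ _ _ _ _ _ _ h => absurd hH h⟩
    · obtain ⟨l, θ, err, h1, h2, h3, h4⟩ := exists_threshold W p x₀ q j hr'0 (h j hH)
      exact ⟨l, θ, fun n => |err n|, h1, h2, by simpa using h3.abs, fun n => abs_nonneg _,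
        fun n m B e hm he heB _ => (h4 n m B e hm he heB).trans (le_abs_self _)⟩
  choose l θ err hl hθ hlim herr hbound using hth
  -- This choice makes `r * (B + K) ≤ B * r'`, so the rate loss `B / (B + K)` is affordable.
  obtain ⟨B, hB⟩ := exists_nat_gt (r * K / (r' - r))
  have hd : 0 < r' - r := sub_pos.2 hr
  have hB0 : 0 < B := by
    have : (0 : ℝ) < B := lt_of_le_of_lt (by positivity) hB
    exact_mod_cast this
  rw [div_lt_iff₀ hd] at hB
  have hcode : ∀ k : ℕ, ∃ c : Code X Y S (B * ⌈r' * (k + 1 : ℕ)⌉₊) ((B + K) * (k + 1)),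
      c.errorProb W q ≤ B * ∑ j, err j (k + 1) := fun k =>
    exists_code_errorProb_le W p x₀ q s₀ (fun j => hθ j (k + 1)) hl (fun j => herr j (k + 1))
      fun j e he heB hH => hbound j (k + 1) _ B e
        (Nat.ceil_lt_add_one (by positivity)).le he heB hH
  choose c hc using hcode
  refine ⟨fun k => B * ⌈r' * (k + 1 : ℕ)⌉₊, fun k => (B + K) * (k + 1), c, fun k => ⟨?_, ?_⟩,
    ?_, ?_, ?_⟩
  · positivity
  · have hk : (0 : ℝ) < (k + 1 : ℕ) := by positivity
    have hBK : (0 : ℝ) < B + K := by positivity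
    rw [le_div_iff₀ (by positivity)]
    push_cast
    have h1 : r' * (k + 1) ≤ (⌈r' * (k + 1)⌉₊ : ℝ) := Nat.le_ceil _
    have h2 : r * (B + K) ≤ B * r' := by linarith
    calc (r : ℝ) * ((B + K) * (k + 1)) = r * (B + K) * (k + 1) := by ring
      _ ≤ B * r' * (k + 1) := mul_le_mul_of_nonneg_right h2 (by positivity)
      _ = B * (r' * (k + 1)) := by ring
      _ ≤ _ := mul_le_mul_of_nonneg_left h1 (by positivity)
  · refine tendsto_atTop_mono (fun k => Nat.le_mul_of_pos_left _ hB0) ?_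
    refine tendsto_nat_ceil_atTop.comp (Tendsto.const_mul_atTop hr'0 ?_)
    exact tendsto_natCast_atTop_atTop.comp (tendsto_add_atTop_nat 1)
  · exact tendsto_atTop_mono (fun k => (Nat.le_succ k).trans
      (Nat.le_mul_of_pos_left _ (by omega))) tendsto_id
  · have hlim' : Tendsto (fun k => B * ∑ j, err j (k + 1)) atTop (𝓝 0) := by
      have := (tendsto_finsetSum (Finset.univ : Finset (Fin (K + 1))) fun j _ =>
        (hlim j).comp (tendsto_add_atTop_nat 1)).const_mul (B : ℝ)
      simpa using this
    refine tendsto_of_tendsto_of_tendsto_of_le_of_le tendsto_const_nhds hlim' (fun k => ?_) hc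
    change 0 ≤ (c k).errorProb W q
    rw [Code.errorProb_eq_sum]
    refine Finset.sum_nonneg fun s _ => Finset.sum_nonneg fun y _ => ?_
    split_ifs
    · exact le_rfl
    · exact (c k).law_nonneg W q s y

/-- A rate strictly below the minimum leaves a margin at each cut; the margins are finitely many, so
a common one exists. Cuts of zero conditional entropy impose nothing and receive an arbitrary
margin. -/
theorem le_sourceChannelCapacity : ⨅ j : Fin (K + 1),
      ratio (cutInfo W p j) (condEntropy q (fun s => s 0) (fun s => s j.succ)) ≤
    sourceChannelCapacity W q := by
  refine le_of_forall_lt_imp_le_of_dense fun a ha => ?_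
  lift a to ℝ≥0 using (ha.trans_le le_top).ne
  refine le_iSup₂_of_le a ?_ le_rfl
  have hj : ∀ j : Fin (K + 1), ∃ r' : ℝ, (a : ℝ) < r' ∧
      (condEntropy q (fun s => s 0) (fun s => s j.succ) ≠ 0 →
        r' * condEntropy q (fun s => s 0) (fun s => s j.succ) < cutInfo W p j) := by
    intro j
    by_cases hH : condEntropy q (fun s => s 0) (fun s => s j.succ) = 0
    · exact ⟨a + 1, lt_add_one _, fun h => absurd hH h⟩
    · have hpos : 0 < condEntropy q (fun s => s 0) (fun s => s j.succ) :=
        lt_of_le_of_ne (condEntropy_nonneg _ _ _) (Ne.symm hH)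
      have h1 := ha.trans_le (iInf_le _ j)
      rw [ratio, if_neg hH, ← ENNReal.ofReal_coe_nnreal, ENNReal.ofReal_lt_ofReal_iff'] at h1
      obtain ⟨r', h2, h3⟩ := exists_between h1.1
      exact ⟨r', h2, fun _ => (lt_div_iff₀ hpos).1 h3⟩
  choose r' hr1 hr2 using hj
  obtain ⟨j₀, -, hj₀⟩ := Finset.exists_min_image Finset.univ r' Finset.univ_nonempty
  refine achievable_of_lt W p q (hr1 j₀) fun j hH => lt_of_le_of_lt ?_ (hr2 j hH)
  exact mul_le_mul_of_nonneg_right (hj₀ j (Finset.mem_univ j)) (condEntropy_nonneg _ _ _)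

end Achievability

end

end RelayNetwork

theorem theorem2 {K : ℕ} {X Y : Fin (K + 1) → Type*} {S : Fin (K + 2) → Type*}
    [∀ j, Fintype (X j)] [∀ j, Fintype (Y j)] [∀ i, Fintype (S i)]
    (W : (∀ j, X j) → PMF (∀ j, Y j)) (q : PMF (∀ i, S i))
    (hW : RelayNetwork.PhysicallyDegraded W) (hq : RelayNetwork.DegradedSideInfo q) :
    RelayNetwork.sourceChannelCapacity W q =
      ⨆ p : PMF (∀ j, X j), ⨅ j : Fin (K + 1),
        RelayNetwork.ratio (RelayNetwork.cutInfo W p j)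
          (RelayNetwork.condEntropy q (fun s => s 0) (fun s => s j.succ)) :=
  le_antisymm (RelayNetwork.sourceChannelCapacity_le hW hq)
    (iSup_le fun p => RelayNetwork.le_sourceChannelCapacity W p q)
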